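/- Let $\Omega=\mathbb T^3=(\mathbb R/\mathbb Z)^3$, $|\Omega|=1$, and let $a>0$, $\gamma\ge1$, $p(\rho)=a\rho^\gamma$, $\varepsilon>0$, $r_3>0$, $\kappa\in(0,1)$. **Viscosities.** Let $\mu\in C^0([0,\infty);[0,\infty))\cap C^2((0,\infty))$ and suppose that there are $\frac23<\alpha_1<\alpha_2<4$ with $0<\frac1{\alpha_2}\rho\mu'(\rho)\le\mu(\rho)\le\frac1{\alpha_1}\rho\mu'(\rho)$ for all $\rho>0$, that $|\rho\mu''(\rho)/\mu'(\rho)|$ is bounded on $(0,\infty)$, and put $\lambda(\rho)=2(\rho\mu'(\rho)-\mu(\rho))$ (BD relation). Let $\tilde\nu>0$ be such that $\lambda+\frac23\mu\ge\tilde\nu\mu$. Assume * near vacuum: $\lim_{\rho\to0}\rho\mu'(\rho)/\mu(\rho)=\alpha$ with $\frac23<\alpha\le4$, and either ($\alpha<1$, or $\mu(\rho)\ge c\rho$ for some $c>0$ and all small $\rho$), or ($\alpha\ge1$ and $\gamma<\alpha$); * at infinity: either $\lim_{\rho\to\infty}\rho\mu'(\rho)/\mu(\rho)=\beta$ with $1<\beta<4$,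 or there is $M>0$ with $\mu(\rho)=\rho$ for all $\rho\ge M$. **Notation.** $s'(\rho)=\mu'(\rho)/\rho$, $v=2\nabla s(\rho)$ (that is, $\rho v=2\nabla\mu(\rho)$ with $\mu(\rho)\in W^{1,1}(\Omega)$), $w=u+\kappa v$, $H(\rho)=\rho\int_1^\rho p(s)s^{-2}ds$, $h(\rho)=\rho\int_1^\rho\mu(s)s^{-2}ds$, $G(\rho|r)=G(\rho)-G(r)-G'(r)(\rho-r)$ for $G=H,h$, $Z(\rho)=\int_0^\rho\sqrt{\mu(s)}\,\mu'(s)s^{-1}ds$, $Z_1(\rho)=\int_0^\rho\mu'(s)\mu(s)^{-1/4}s^{-1/2}ds$. For $\theta>0$ let $$\mathcal E(\rho,u)=\int_\Omega\Big[\theta\rho\big(|w|^2+(\kappa(1-\kappa)+\varepsilon)|v|^2\big)+H(\rho|r)+2\kappa r_3\,h(\rho|r)\Big]dx\in[0,\infty]$$ ($=\infty$ if $\mu(\rho)\notin W^{1,1}(\Omega)$). **Global weak solutions.** Let $C_0>0$ (the constant $C_{\alpha_1,\tilde\nu}$). A pair $(\rho,u)$ is a global weak solution with mean density $r=\int_\Omega\rho\,dx$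 if the following hold. 1. $\rho\ge0$, $\rho\in C([0,\infty);L^\gamma_{\rm weak})$, $\mu(\rho)\in C([0,\infty);L^{3/2}_{\rm weak})$, $\rho u\in C([0,\infty);L^{2\gamma/(\gamma+1)}_{\rm weak})$; the initial data are the values $\rho_0,(\rho u)_0$ at $t=0$, with $v_0=2\nabla s(\rho_0)$. 2. For a.e. $t>0$, with tensors $\mathbb T_\mu,\mathbb T_\varepsilon$ as in 3, $$\int_\Omega\Big[\rho\Big(\tfrac{|w|^2}2+[(1-\kappa)\kappa+\varepsilon]\tfrac{|v|^2}2\Big)+H(\rho)+2r_3\kappa h(\rho)\Big](t)\,dx+\int_0^t\!\!\int_\Omega\Big[\tilde\nu|\mathbb T_\mu|^2+r_3\rho|u|^2+\varepsilon C_0\big(|\nabla^2Z(\rho)|^2+|\nabla Z_1(\rho)|^4+|\mathbb T_\varepsilon|^2\big)+2\kappa\tfrac{\mu'(\rho)p'(\rho)}\rho|\nabla\rho|^2\Big]dx\,d\tau$$ is at most the first integral taken at $t=0$, which is finite. 3. For $(f,\mathbb T)=(u,\mathbb T_\mu)$ and $(f,\mathbb T)=(v,\mathbb T_\varepsilon)$: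 $\sqrt\mu\,\mathbb T=\nabla(\mu f)-f\otimes\rho\nabla s(\rho)$ and $\frac{\lambda}{2\mu}{\rm Tr}(\sqrt\mu\,\mathbb T)={\rm div}\big(\frac{\lambda}{2\mu}\mu f\big)-f\cdot\rho\nabla s(\rho)\,\frac{\rho\mu''(\rho)}{\mu'(\rho)}$ weakly. 4. $\mu(\rho)\in L^\infty(0,\infty;W^{1,1})$, $\mu(\rho)u\in L^\infty(0,\infty;L^{3/2})\cap L^2(0,\infty;W^{1,1})$, $\partial_t\mu(\rho)\in L^\infty(0,\infty;W^{-1,1})$, and for some $q>1$, $Z(\rho)\in L^q(0,T;L^1)$ for all $T<\infty$. 5. In $\mathcal D'((0,\infty)\times\Omega)$, with $\mathbb S_\mu,\mathbb S_\varepsilon$ the symmetric parts of $\mathbb T_\mu,\mathbb T_\varepsilon$ (all terms being locally integrable on $[0,\infty)\times\Omega$): $$\partial_t\rho+{\rm div}(\rho u)=0,\qquad \partial_t\mu(\rho)+{\rm div}(\mu(\rho)u)+\tfrac{\lambda}{2\mu}{\rm Tr}(\sqrt\mu\,\mathbb T_\mu)=0,$$ $$\partial_t(\rho u)+{\rm div}(\rho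 u\otimes u)+\nabla p(\rho)+r_3\rho u-2{\rm div}\big(\sqrt\mu\,\mathbb S_\mu+\tfrac{\lambda}{2\mu}{\rm Tr}(\sqrt\mu\,\mathbb S_\mu){\rm Id}\big)-2\varepsilon\,{\rm div}\big(\sqrt\mu\,\mathbb S_\varepsilon+\tfrac{\lambda}{2\mu}{\rm Tr}(\sqrt\mu\,\mathbb S_\varepsilon){\rm Id}\big)=0.$$ 6. $(\rho,u)$ is a limit of regularized solutions: there are $(\rho_n,u_n)$ with $\rho_n>0$ of class $C^2$ in $x$, $u_n$ continuous in $x$, $\int_\Omega\rho_n(t)\,dx=r$, such that $\mathcal E_n(t)=\mathcal E(\rho_n(t),u_n(t))$ (with $v_n=2\nabla s(\rho_n)$) is continuous on $[0,\infty)$, differentiable on $(0,\infty)$ and satisfies $$\mathcal E_n'(t)+\varepsilon C_0\int_\Omega|\nabla^2Z(\rho_n)|^2dx+\kappa\int_\Omega\mu'(\rho_n)H''(\rho_n)|\nabla\rho_n|^2dx+\int_\Omega r_3\rho_n|u_n|^2dx\le0\qquad(t>0);$$ moreover $\rho_n(t)\to\rho(t)$, $\rho_nu_n(t)\to\rho u(t)$,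 $\mu(\rho_n)(t)\to\mu(\rho)(t)$ in $\mathcal D'(\Omega)$ for every $t\ge0$, and $\mathcal E_n(0)\to\mathcal E(\rho(0),u(0))$. **Theorem.** Under these assumptions there is a constant $C>0$, depending only on $\mu,a,\gamma,\varepsilon,r_3,\kappa,C_0,\theta$ and $r$, such that every global weak solution $(\rho,u)$ with mean density $r$ satisfies $$\mathcal E(\rho(t),u(t))\le\mathcal E(\rho(0),u(0))\,e^{-Ct}\qquad\text{for all }t\ge0.$$ The case $\mu(\rho)=\rho$, $\lambda=0$ (any $\gamma\ge1$) is the quantum Navier–Stokes system with drag. -/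

import Mathlib

open MeasureTheory Filter Topology Set
open scoped ENNReal ContDiff

namespace NSK

noncomputable section

/-! ## The torus, fields, derivatives and weak derivatives -/

/-- The torus `𝕋³ = (ℝ / ℤ)³`. -/
abbrev T3 := Fin 3 → UnitAddCircle

/-- Vectors of `ℝ³`; lengths are always written through `sq3`, so that the default norm of the
function type plays no role. -/
abbrev Vec := Fin 3 → ℝ

/-- Tensors of order two; rows are indexed first. -/
abbrev Tens := Fin 3 → Fin 3 → ℝ

/-- The Haar probability measure of the torus: `|Ω| = 1`. -/
def vol : Measure T3 := Measure.pi fun _ => AddCircle.haarAddCircle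

/-- Space-time measure on `(0, ∞) × 𝕋³`. -/
def stVol : Measure (ℝ × T3) := (volume.restrict (Ioi (0 : ℝ))).prod vol

/-- Squared Euclidean length of a vector. -/
def sq3 (v : Vec) : ℝ := ∑ i, v i ^ 2

/-- Squared Euclidean (Frobenius) norm of a tensor. -/
def sq9 (A : Tens) : ℝ := ∑ i, ∑ j, A i j ^ 2

/-- Trace of a tensor. -/
def tr (A : Tens) : ℝ := ∑ i, A i i

/-- Symmetric part of a tensor. -/
def symm (A : Tens) : Tens := fun i j => (A i j + A j i) / 2

/-- The projection `ℝ³ → 𝕋³`. -/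
def toTorus (y : Vec) : T3 := fun i => (y i : UnitAddCircle)

/-- `f` is of class `C^n` on the torus. -/
def IsCn (n : WithTop ℕ∞) (f : T3 → ℝ) : Prop := ContDiff ℝ n fun y : Vec => f (toTorus y)

/-- The partial derivative `∂ᵢ f` of a function on the torus. -/
def pd (i : Fin 3) (f : T3 → ℝ) (x : T3) : ℝ :=
  deriv (fun s : ℝ => f (x + Pi.single i (s : UnitAddCircle))) 0

/-- `f` belongs to `W^{1,1}(𝕋³)` and its weak gradient is `G`. -/
def IsWeakGrad (f : T3 → ℝ) (G : T3 → Vec) : Prop :=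
  Integrable f vol ∧ (∀ i, Integrable (fun x => G x i) vol) ∧
    ∀ φ : T3 → ℝ, IsCn ∞ φ → ∀ i, ∫ x, f x * pd i φ x ∂vol = -∫ x, G x i * φ x ∂vol

/-- The integrable vector field `F` has the integrable function `g` as weak divergence. -/
def IsWeakDiv (F : T3 → Vec) (g : T3 → ℝ) : Prop :=
  (∀ i, Integrable (fun x => F x i) vol) ∧ Integrable g vol ∧
    ∀ φ : T3 → ℝ, IsCn ∞ φ →
      ∫ x, ∑ i, F x i * pd i φ x ∂vol = -∫ x, g x * φ x ∂vol

/-- Test functions on `(0, ∞) × 𝕋³`: smooth, and supported in time in a compact part of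
`(0, ∞)`. -/
def IsTest (Φ : ℝ → T3 → ℝ) : Prop :=
  ContDiff ℝ ∞ (fun z : ℝ × Vec => Φ z.1 (toTorus z.2)) ∧
    ∃ b c : ℝ, 0 < b ∧ b < c ∧ ∀ t, t ∉ Icc b c → ∀ x, Φ t x = 0

/-- The time derivative. -/
def dt (Φ : ℝ → T3 → ℝ) (t : ℝ) (x : T3) : ℝ := deriv (fun s => Φ s x) t

/-- Integral over `(0, ∞) × 𝕋³`. -/
def stInt (F : ℝ → T3 → ℝ) : ℝ := ∫ z, F z.1 z.2 ∂stVol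

/-- Joint measurability on `(0, ∞) × 𝕋³`. -/
def STMeas (F : ℝ → T3 → ℝ) : Prop := AEStronglyMeasurable (fun z : ℝ × T3 => F z.1 z.2) stVol

/-- `F` is integrable on `(0, T) × 𝕋³` for every finite `T`. -/
def STLocInt (F : ℝ → T3 → ℝ) : Prop :=
  ∀ T : ℝ, 0 < T →
    Integrable (fun z : ℝ × T3 => F z.1 z.2) ((volume.restrict (Ioo 0 T)).prod vol)

/-- `f ∈ C⁰([0, ∞); L^p_weak(𝕋³))`. -/
def WeakCont (p : ℝ≥0∞) (f : ℝ → T3 → ℝ) : Prop :=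
  (∀ t, 0 ≤ t → MemLp (f t) p vol) ∧
    ∀ q : ℝ≥0∞, ENNReal.HolderConjugate p q → ∀ φ : T3 → ℝ, MemLp φ q vol →
      ContinuousOn (fun t => ∫ x, f t x * φ x ∂vol) (Ici 0)

/-! ## Constitutive laws -/

/-- The pressure law `p(s) = a s^γ`. -/
def pres (a γ s : ℝ) : ℝ := a * s ^ γ

/-- The bulk viscosity given by the BD relation `λ(s) = 2 (μ'(s) s - μ(s))`. -/
def lam (μ : ℝ → ℝ) (s : ℝ) : ℝ := 2 * (deriv μ s * s - μ s)

/-- The potential `ρ ∫₁^ρ f(s) / s² ds` of a function `f`. -/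
def potential (f : ℝ → ℝ) (ρ : ℝ) : ℝ := ρ * ∫ s in (1 : ℝ)..ρ, f s / s ^ 2

/-- The relative value `G(ρ | r) = G(ρ) - G(r) - G'(r) (ρ - r)`. -/
def relative (G : ℝ → ℝ) (ρ r : ℝ) : ℝ := G ρ - G r - deriv G r * (ρ - r)

/-- `H`, the potential of the pressure. -/
def bigH (a γ : ℝ) : ℝ → ℝ := potential (pres a γ)

/-- `h`, the potential of the shear viscosity. -/
def smallh (μ : ℝ → ℝ) : ℝ → ℝ := potential μ

/-- A primitive `s` of `μ'(τ) / τ` on `(0, ∞)`. -/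
def sFun (μ : ℝ → ℝ) (ρ : ℝ) : ℝ := ∫ τ in (1 : ℝ)..ρ, deriv μ τ / τ

/-- `Z(ρ) = ∫₀^ρ √μ(s) μ'(s) / s ds`. -/
def bigZ (μ : ℝ → ℝ) (ρ : ℝ) : ℝ := ∫ s in (0 : ℝ)..ρ, Real.sqrt (μ s) * deriv μ s / s

/-- `Z₁(ρ) = ∫₀^ρ μ'(s) / (μ(s)^{1/4} s^{1/2}) ds`. -/
def bigZ1 (μ : ℝ → ℝ) (ρ : ℝ) : ℝ :=
  ∫ s in (0 : ℝ)..ρ, deriv μ s / (μ s ^ (1 / 4 : ℝ) * Real.sqrt s)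

/-- The standing assumptions on the shear viscosity. -/
structure IsViscosity (μ : ℝ → ℝ) (α₁ α₂ : ℝ) : Prop where
  cont : ContinuousOn μ (Ici 0)
  nonneg : ∀ s, 0 ≤ s → 0 ≤ μ s
  smooth : ContDiffOn ℝ 2 μ (Ioi 0)
  alpha_lt : 2 / 3 < α₁ ∧ α₁ < α₂ ∧ α₂ < 4
  bounds : ∀ s, 0 < s → 0 < 1 / α₂ * (s * deriv μ s) ∧
    1 / α₂ * (s * deriv μ s) ≤ μ s ∧ μ s ≤ 1 / α₁ * (s * deriv μ s)
  second : ∃ K, ∀ s, 0 < s → |s * deriv (deriv μ) s / deriv μ s| ≤ K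

/-- Behaviour near vacuum, with limit exponent `α`, in relation to the pressure exponent `γ`. -/
def VacuumBehaviour (μ : ℝ → ℝ) (γ α : ℝ) : Prop :=
  Tendsto (fun s => s * deriv μ s / μ s) (𝓝[>] 0) (𝓝 α) ∧ 2 / 3 < α ∧ α ≤ 4 ∧
    ((α < 1 ∨ ∃ s₀ c : ℝ, 0 < s₀ ∧ 0 < c ∧ ∀ s, 0 < s → s < s₀ → c * s ≤ μ s) ∨
      (1 ≤ α ∧ γ < α))

/-- Behaviour at infinity: limit exponent `β ∈ (1, 4)`, or `μ(s) = s` for all large `s`. -/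
def InfinityBehaviour (μ : ℝ → ℝ) : Prop :=
  (∃ β : ℝ, 1 < β ∧ β < 4 ∧ Tendsto (fun s => s * deriv μ s / μ s) atTop (𝓝 β)) ∨
    ∃ M : ℝ, 0 < M ∧ ∀ s, M ≤ s → μ s = s

/-! ## Parameters and energies -/

/-- The data of the system: shear viscosity `μ`, pressure constants `a` and `γ`, capillarity
constant `ε`, drag constant `r₃`, and the parameter `κ` of the entropy. -/
structure Params where
  μ : ℝ → ℝ
  a : ℝ
  γ : ℝ
  ε : ℝ
  r₃ : ℝ
  κ : ℝ

/-- `v` is the velocity `2 ∇s(ρ)`, `s'(ρ) = μ'(ρ) / ρ`. As vacuum is allowed, this is expressed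
by `ρ v = 2 ∇μ(ρ)`, where `μ(ρ) ∈ W^{1,1}`. It determines `v` almost everywhere on `{ρ > 0}`;
every expression below carries a factor that vanishes on `{ρ = 0}`. -/
def IsDriftVel (μ : ℝ → ℝ) (ρ : T3 → ℝ) (v : T3 → Vec) : Prop :=
  IsWeakGrad (fun x => μ (ρ x)) fun x i => ρ x * v x i / 2

/-- The effective velocity `w = u + κ v = u + 2 κ ∇s(ρ)`. -/
def wVel (κ : ℝ) (u v : Vec) : Vec := fun i => u i + κ * v i

/-- Density of the `κ`-entropy,
`ρ (|w|²/2 + [(1-κ)κ + ε] |v|²/2) + H(ρ) + 2 r₃ κ h(ρ)`. -/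
def entDensity (P : Params) (ρ : ℝ) (u v : Vec) : ℝ :=
  ρ * (sq3 (wVel P.κ u v) / 2 + ((1 - P.κ) * P.κ + P.ε) * (sq3 v / 2)) + bigH P.a P.γ ρ +
    2 * P.r₃ * P.κ * smallh P.μ ρ

/-- Density of the relative `κ`-entropy, with weight `θ` on the kinetic part,
`θ ρ (|w|² + (κ(1-κ) + ε) |v|²) + H(ρ|r) + 2 κ r₃ h(ρ|r)`. -/
def relDensity (P : Params) (θ r : ℝ) (ρ : ℝ) (u v : Vec) : ℝ :=
  θ * (ρ * (sq3 (wVel P.κ u v) + (P.κ * (1 - P.κ) + P.ε) * sq3 v)) +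
    relative (bigH P.a P.γ) ρ r + 2 * P.κ * P.r₃ * relative (smallh P.μ) ρ r

/-- The relative `κ`-entropy `E` of a density and a velocity on the torus, with values in
`[0, ∞]`. The integrand is nonnegative and does not depend on the choice of `v`, so that the
infimum is the common value of the integrals over all `v = 2 ∇s(ρ)`; it is `∞` if
`μ(ρ)` is not in `W^{1,1}`. -/
def relEntropy (P : Params) (θ r : ℝ) (ρ : T3 → ℝ) (u : T3 → Vec) : ℝ≥0∞ :=
  ⨅ v ∈ {v : T3 → Vec | IsDriftVel P.μ ρ v},
    ∫⁻ x, ENNReal.ofReal (relDensity P θ r (ρ x) (u x) (v x)) ∂vol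

/-! ## Global weak solutions -/

/-- The factor `λ(s) / (2 μ(s))`. -/
def bulkRatio (μ : ℝ → ℝ) (s : ℝ) : ℝ := lam μ s / (2 * μ s)

/-- The tensor `√μ(ρ) T`. -/
def sqrtMuT (μ : ℝ → ℝ) (ρ : ℝ) (T : Tens) : Tens := fun i j => Real.sqrt (μ ρ) * T i j

/-- The stress `√μ(ρ) S + λ(ρ)/(2μ(ρ)) Tr(√μ(ρ) S) Id`, `S` being the symmetric part of `T`. -/
def stress (μ : ℝ → ℝ) (ρ : ℝ) (T : Tens) : Tens := fun i j =>
  sqrtMuT μ ρ (symm T) i j + if i = j then bulkRatio μ ρ * tr (sqrtMuT μ ρ (symm T)) else 0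

/-- The two compatibility conditions that define the tensor `T` associated with a velocity `f`
(`f = u` for `T_μ` and `f = v` for `T_ε`), at a fixed time; `ρ v / 2 = ρ ∇s(ρ)`:
`√μ(ρ) T = ∇(μ(ρ) f) - f ⊗ ρ ∇s(ρ)` and
`λ/(2μ) Tr(√μ T) = div(λ/(2μ) μ f) - f · ρ ∇s(ρ) ρ μ''(ρ) / μ'(ρ)`. -/
structure IsCompatible (μ : ℝ → ℝ) (ρ : T3 → ℝ) (v f : T3 → Vec) (T : T3 → Tens) : Prop where
  grad : ∀ i, IsWeakGrad (fun x => μ (ρ x) * f x i)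
    fun x j => sqrtMuT μ (ρ x) (T x) i j + f x i * (ρ x * v x j / 2)
  div : IsWeakDiv (fun x j => bulkRatio μ (ρ x) * (μ (ρ x) * f x j))
    fun x => bulkRatio μ (ρ x) * tr (sqrtMuT μ (ρ x) (T x)) +
      (∑ j, f x j * (ρ x * v x j / 2)) *
        (ρ x * deriv (deriv μ) (ρ x) / deriv μ (ρ x))

/-- Auxiliary fields of a weak solution: `v = 2 ∇s(ρ)`, the tensors `T_μ` and `T_ε`, and the weak
derivatives `∇Z(ρ)`, `∇²Z(ρ)`, `∇Z₁(ρ)`. -/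
structure Aux where
  v : ℝ → T3 → Vec
  Tmu : ℝ → T3 → Tens
  Teps : ℝ → T3 → Tens
  dZ : ℝ → T3 → Vec
  ddZ : ℝ → T3 → Tens
  dZ1 : ℝ → T3 → Vec

/-- The gradient of the density, `∇ρ = ρ v / (2 μ'(ρ))` (from `v = 2 μ'(ρ) ∇ρ / ρ`). -/
def gradRho (μ : ℝ → ℝ) (ρ : ℝ) (v : Vec) : Vec := fun i => ρ * v i / (2 * deriv μ ρ)

/-- Density of the dissipation in the energy estimate,
`ν |T_μ|² + r₃ ρ |u|² + ε C₀ (|∇²Z|² + |∇Z₁|⁴ + |T_ε|²) + 2 κ (μ'(ρ) p'(ρ) / ρ) |∇ρ|²`. -/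
def dissDensity (P : Params) (ν C₀ : ℝ) (ρ : ℝ → T3 → ℝ) (u : ℝ → T3 → Vec) (A : Aux)
    (t : ℝ) (x : T3) : ℝ :=
  ν * sq9 (A.Tmu t x) + P.r₃ * (ρ t x * sq3 (u t x)) +
    P.ε * C₀ * (sq9 (A.ddZ t x) + sq3 (A.dZ1 t x) ^ 2 + sq9 (A.Teps t x)) +
    2 * P.κ * (deriv P.μ (ρ t x) * deriv (pres P.a P.γ) (ρ t x) / ρ t x *
      sq3 (gradRho P.μ (ρ t x) (A.v t x)))

/-- The bulk of the definition of a global weak solution: regularity, energy estimate, extra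
estimates and equations. The initial data are `ρ(0)` and `(ρ u)(0)`. -/
structure IsWeakSolWith (P : Params) (ν C₀ : ℝ) (ρ : ℝ → T3 → ℝ) (u : ℝ → T3 → Vec)
    (A : Aux) : Prop where
  -- measurability
  meas_rho : STMeas ρ
  meas_u : ∀ i, STMeas fun t x => u t x i
  meas_v : ∀ i, STMeas fun t x => A.v t x i
  meas_Tmu : ∀ i j, STMeas fun t x => A.Tmu t x i j
  meas_Teps : ∀ i j, STMeas fun t x => A.Teps t x i j
  meas_ddZ : ∀ i j, STMeas fun t x => A.ddZ t x i j
  meas_dZ1 : ∀ i, STMeas fun t x => A.dZ1 t x i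
  -- density, viscosity and momentum
  rho_cont : WeakCont (ENNReal.ofReal P.γ) ρ
  rho_nonneg : ∀ t, 0 ≤ t → ∀ᵐ x ∂vol, 0 ≤ ρ t x
  mu_cont : WeakCont (3 / 2) fun t x => P.μ (ρ t x)
  mom_cont : ∀ i, WeakCont (ENNReal.ofReal (2 * P.γ / (P.γ + 1))) fun t x => ρ t x * u t x i
  -- the auxiliary fields
  drift : ∀ᵐ t ∂volume.restrict (Ioi (0 : ℝ)), IsDriftVel P.μ (ρ t) (A.v t)
  drift_zero : IsDriftVel P.μ (ρ 0) (A.v 0)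
  compat_mu : ∀ᵐ t ∂volume.restrict (Ioi (0 : ℝ)),
    IsCompatible P.μ (ρ t) (A.v t) (u t) (A.Tmu t)
  compat_eps : ∀ᵐ t ∂volume.restrict (Ioi (0 : ℝ)),
    IsCompatible P.μ (ρ t) (A.v t) (A.v t) (A.Teps t)
  grad_Z : ∀ᵐ t ∂volume.restrict (Ioi (0 : ℝ)),
    IsWeakGrad (fun x => bigZ P.μ (ρ t x)) (A.dZ t)
  hess_Z : ∀ᵐ t ∂volume.restrict (Ioi (0 : ℝ)),
    ∀ i, IsWeakGrad (fun x => A.dZ t x i) fun x j => A.ddZ t x i j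
  grad_Z1 : ∀ᵐ t ∂volume.restrict (Ioi (0 : ℝ)),
    IsWeakGrad (fun x => bigZ1 P.μ (ρ t x)) (A.dZ1 t)
  -- the energy estimate
  energy_zero : Integrable (fun x => entDensity P (ρ 0 x) (u 0 x) (A.v 0 x)) vol
  energy : ∀ᵐ t ∂volume.restrict (Ioi (0 : ℝ)),
    Integrable (fun x => entDensity P (ρ t x) (u t x) (A.v t x)) vol ∧
    ((∫ x, entDensity P (ρ t x) (u t x) (A.v t x) ∂vol : ℝ) : EReal) +
        ((∫⁻ z, ENNReal.ofReal (dissDensity P ν C₀ ρ u A z.1 z.2)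
          ∂((volume.restrict (Ioo 0 t)).prod vol) : ℝ≥0∞) : EReal) ≤
      ((∫ x, entDensity P (ρ 0 x) (u 0 x) (A.v 0 x) ∂vol : ℝ) : EReal)
  -- `μ(ρ) ∈ L^∞(0, ∞; W^{1,1})`
  mu_W11 : ∃ K : ℝ, ∀ᵐ t ∂volume.restrict (Ioi (0 : ℝ)),
    ∫ x, |P.μ (ρ t x)| ∂vol + ∑ i, ∫ x, |ρ t x * A.v t x i / 2| ∂vol ≤ K
  -- `μ(ρ) u ∈ L^∞(0, ∞; L^{3/2}) ∩ L²(0, ∞; W^{1,1})`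
  muu_L32 : ∃ K : ℝ, ∀ i, ∀ᵐ t ∂volume.restrict (Ioi (0 : ℝ)),
    eLpNorm (fun x => P.μ (ρ t x) * u t x i) (3 / 2) vol ≤ ENNReal.ofReal K
  muu_L2W11 : ∀ i, ∫⁻ t in Ioi (0 : ℝ),
    (∫⁻ x, ENNReal.ofReal |P.μ (ρ t x) * u t x i| ∂vol +
      ∑ j, ∫⁻ x, ENNReal.ofReal |sqrtMuT P.μ (ρ t x) (A.Tmu t x) i j +
        u t x i * (ρ t x * A.v t x j / 2)| ∂vol) ^ 2 < ⊤
  -- `∂ₜ μ(ρ) ∈ L^∞(0, ∞; W^{-1,1})`, that is, `∂ₜ μ(ρ) = g + div F` with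
  -- `g` and `F` in `L^∞(0, ∞; L¹)`
  dtmu : ∃ (g : ℝ → T3 → ℝ) (F : ℝ → T3 → Vec) (K : ℝ),
    STMeas g ∧ (∀ i, STMeas fun t x => F t x i) ∧
    (∀ᵐ t ∂volume.restrict (Ioi (0 : ℝ)),
      Integrable (g t) vol ∧ (∀ i, Integrable (fun x => F t x i) vol) ∧
        ∫ x, |g t x| ∂vol + ∑ i, ∫ x, |F t x i| ∂vol ≤ K) ∧
    ∀ Φ, IsTest Φ → -stInt (fun t x => P.μ (ρ t x) * dt Φ t x) =
      stInt fun t x => g t x * Φ t x - ∑ i, F t x i * pd i (Φ t) x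
  -- `Z(ρ) ∈ L^{1+}_loc([0, ∞); L¹)`
  Z_L1plus : ∃ p : ℝ, 1 < p ∧ ∀ T : ℝ, 0 < T →
    ∫⁻ t in Ioo 0 T, (∫⁻ x, ENNReal.ofReal |bigZ P.μ (ρ t x)| ∂vol) ^ p < ⊤
  -- local integrability of the terms of the equations
  int_rho : STLocInt ρ
  int_mom : ∀ i, STLocInt fun t x => ρ t x * u t x i
  int_conv : ∀ i j, STLocInt fun t x => ρ t x * u t x i * u t x j
  int_pres : STLocInt fun t x => pres P.a P.γ (ρ t x)
  int_mu : STLocInt fun t x => P.μ (ρ t x)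
  int_muu : ∀ i, STLocInt fun t x => P.μ (ρ t x) * u t x i
  int_Tmu : ∀ i j, STLocInt fun t x => sqrtMuT P.μ (ρ t x) (A.Tmu t x) i j
  int_Teps : ∀ i j, STLocInt fun t x => sqrtMuT P.μ (ρ t x) (A.Teps t x) i j
  -- mass equation, `∂ₜ ρ + div(ρ u) = 0`
  mass : ∀ Φ, IsTest Φ →
    stInt (fun t x => ρ t x * dt Φ t x + ∑ j, ρ t x * u t x j * pd j (Φ t) x) = 0
  -- momentum equation, component by component
  momentum : ∀ i, ∀ Φ, IsTest Φ →
    stInt (fun t x => ρ t x * u t x i * dt Φ t x +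
      ∑ j, ρ t x * u t x i * u t x j * pd j (Φ t) x +
      pres P.a P.γ (ρ t x) * pd i (Φ t) x - P.r₃ * (ρ t x * u t x i) * Φ t x -
      2 * ∑ j, stress P.μ (ρ t x) (A.Tmu t x) i j * pd j (Φ t) x -
      2 * P.ε * ∑ j, stress P.μ (ρ t x) (A.Teps t x) i j * pd j (Φ t) x) = 0
  -- viscosity equation, `∂ₜ μ(ρ) + div(μ(ρ) u) + λ/(2μ) Tr(√μ T_μ) = 0`
  viscosity : ∀ Φ, IsTest Φ →
    stInt (fun t x => P.μ (ρ t x) * dt Φ t x +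
      ∑ j, P.μ (ρ t x) * u t x j * pd j (Φ t) x -
      bulkRatio P.μ (ρ t x) * tr (sqrtMuT P.μ (ρ t x) (A.Tmu t x)) * Φ t x) = 0

/-- The velocity `v = 2 ∇s(ρ)` of a positive `C¹` density. -/
def vClassical (μ : ℝ → ℝ) (ρ : T3 → ℝ) (x : T3) : Vec :=
  fun i => 2 * pd i (fun y => sFun μ (ρ y)) x

/-- The relative `κ`-entropy of a regularized (smooth, positive) state. -/
def relEntropyClassical (P : Params) (θ r : ℝ) (ρ : T3 → ℝ) (u : T3 → Vec) : ℝ :=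
  ∫ x, relDensity P θ r (ρ x) (u x) (vClassical P.μ ρ x) ∂vol

/-- A regularized solution with mean density `r`: the density is positive and of class `C²` in
space, the velocities are continuous in space, and the relative `κ`-entropy satisfies the
dissipation inequality
`E' + ε C₀ ∫ |∇²Z(ρ)|² + κ ∫ μ'(ρ) H''(ρ) |∇ρ|² + r₃ ∫ ρ |u|² ≤ 0`. -/
structure IsRegularized (P : Params) (C₀ θ r : ℝ) (ρ : ℝ → T3 → ℝ) (u : ℝ → T3 → Vec) :
    Prop where
  rho_pos : ∀ t, 0 ≤ t → ∀ x, 0 < ρ t x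
  rho_C2 : ∀ t, 0 ≤ t → IsCn 2 (ρ t)
  u_cont : ∀ t, 0 ≤ t → Continuous (u t)
  mean : ∀ t, 0 ≤ t → ∫ x, ρ t x ∂vol = r
  ent_cont : ContinuousOn (fun t => relEntropyClassical P θ r (ρ t) (u t)) (Ici 0)
  ent_diff : ∀ t, 0 < t →
    DifferentiableAt ℝ (fun t => relEntropyClassical P θ r (ρ t) (u t)) t
  dissipation : ∀ t, 0 < t →
    deriv (fun t => relEntropyClassical P θ r (ρ t) (u t)) t +
      P.ε * C₀ * ∫ x, sq9 (fun i j => pd j (pd i fun y => bigZ P.μ (ρ t y)) x) ∂vol +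
      P.κ * ∫ x, deriv P.μ (ρ t x) * deriv (deriv (bigH P.a P.γ)) (ρ t x) *
        sq3 (fun i => pd i (ρ t) x) ∂vol +
      ∫ x, P.r₃ * (ρ t x * sq3 (u t x)) ∂vol ≤ 0

/-- `(ρ, u)` is the limit of regularized solutions: at every time the densities, the momenta and
the viscosities converge in the sense of distributions on the torus, and the initial relative
entropies converge. -/
def IsLimitOfRegularized (P : Params) (C₀ θ r : ℝ) (ρ : ℝ → T3 → ℝ) (u : ℝ → T3 → Vec) : Prop :=
  ∃ (ρn : ℕ → ℝ → T3 → ℝ) (un : ℕ → ℝ → T3 → Vec),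
    (∀ n, IsRegularized P C₀ θ r (ρn n) (un n)) ∧
    (∀ t, 0 ≤ t → ∀ φ : T3 → ℝ, IsCn ∞ φ →
      Tendsto (fun n => ∫ x, ρn n t x * φ x ∂vol) atTop (𝓝 (∫ x, ρ t x * φ x ∂vol)) ∧
      (∀ i, Tendsto (fun n => ∫ x, ρn n t x * un n t x i * φ x ∂vol) atTop
        (𝓝 (∫ x, ρ t x * u t x i * φ x ∂vol))) ∧
      Tendsto (fun n => ∫ x, P.μ (ρn n t x) * φ x ∂vol) atTop
        (𝓝 (∫ x, P.μ (ρ t x) * φ x ∂vol))) ∧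
    Tendsto (fun n => ENNReal.ofReal (relEntropyClassical P θ r (ρn n 0) (un n 0))) atTop
      (𝓝 (relEntropy P θ r (ρ 0) (u 0)))

/-- Global weak solutions of the compressible Navier-Stokes-Korteweg system with drag, with mean
density `r`. -/
structure IsGlobalWeakSolution (P : Params) (ν C₀ θ r : ℝ) (ρ : ℝ → T3 → ℝ)
    (u : ℝ → T3 → Vec) : Prop where
  weak : ∃ A : Aux, IsWeakSolWith P ν C₀ ρ u A
  mean : ∫ x, ρ 0 x ∂vol = r
  limit : IsLimitOfRegularized P C₀ θ r ρ u

end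

end NSK

/-!
The proof has two halves: an entropy-dissipation inequality for the regularized solutions, and lower
semicontinuity of the entropy along the weak convergence.

**The dissipation controls the entropy** (`exists_mul_relEntropyClassical_le`). Let `ρ > 0` be of
class `C²` with mean `r`. Some point has density exactly `r`, so that the embedding of `W^{2,2}` in
the continuous functions, obtained from Fourier series on the three-dimensional torus
(`exists_sq_sub_le_hessian`), gives `|Z(ρ(x)) - Z(r)|² ≤ C ∫ |∇²Z(ρ)|²` for every `x`. Comparing
derivatives yields the pointwise bound `h(s|r) ≤ C (1 + s) (Z(s) - Z(r))²`
(`exists_relative_smallh_le`), and the integral of `1 + ρ` is `1 + r`. For `H(s|r)` the same bound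
holds up to a multiple of the positive part of `F(s) - F(2r)`, squared, where
`F' = √(μ'(s) s^(γ-2))` (`exists_relative_bigH_le`). The integral of `|∇F(ρ)|²` is, up to a
constant, the pressure part of the dissipation; since `ρ ≤ 2r` on a set of measure at least one
half, Poincaré's inequality bounds the remaining term. The vacuum alternative says that, pointwise
in the density, `s ≤ C μ(s)` or `μ'(s) ≤ C s^(γ-1)`, whence
`ρ|v|² ≤ C (|∇Z(ρ)|² + |∇F(ρ)|²)`; finally `ρ|w|²` is bounded by `ρ|u|²`, which the drag
dissipates, and `ρ|v|²`. So the energy inequality becomes `E' + C E ≤ 0`, and the regularized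
entropies decay exponentially, with a constant that does not depend on the solution
(`exists_regularized_decay`).

**Passage to the limit** (`relEntropy_le_liminf`). The entropy density is a convex function of
`(ρ, ρw, ρv)`, a supremum of affine functions. These three quantities converge in `𝒟'(Ω)` at every
time. Mollification turns distributional into pointwise convergence, Jensen's
inequality for the affine minorants removes the mollifier on the regularized side, and Fatou's
lemma, used twice, gives lower semicontinuity (`lintegral_affineSup_le_liminf`). The limit must be
shown to have a drift velocity at *every* time: the functional `φ ↦ -2 ∫ μ(ρ) ∂ᵢφ` inherits from the
regularized drifts a bound by the norm of `φ` in `L²(ρ dx)`, so that Riesz's representation theorem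
provides `v` (`exists_isDriftVel`).
-/

namespace NSK

noncomputable section

/-! ### Calculus on the torus -/

instance : IsProbabilityMeasure vol := by unfold vol; infer_instance

instance : vol.IsAddHaarMeasure := by unfold vol; infer_instance

lemma isOpenQuotientMap_toTorus : IsOpenQuotientMap toTorus :=
  IsOpenQuotientMap.piMap (f := fun _ : Fin 3 => ((↑) : ℝ → UnitAddCircle))
    fun _ => QuotientAddGroup.isOpenQuotientMap_mk

lemma toTorus_add (y z : Vec) : toTorus (y + z) = toTorus y + toTorus z := by
  ext i; simp [toTorus]

lemma toTorus_single (i : Fin 3) (s : ℝ) :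
    toTorus (Pi.single i s) = Pi.single i (s : UnitAddCircle) := by
  ext j
  by_cases h : j = i
  · subst h; simp [toTorus]
  · simp [toTorus, h]

lemma toTorus_surjective : Function.Surjective toTorus := isOpenQuotientMap_toTorus.surjective

namespace IsCn

variable {n m : WithTop ℕ∞} {f g : T3 → ℝ} {i : Fin 3}

lemma continuous (hf : IsCn n f) : Continuous f :=
  isOpenQuotientMap_toTorus.isQuotientMap.continuous_iff.2 (ContDiff.continuous hf)

lemma integrable (hf : IsCn n f) : Integrable f vol :=
  hf.continuous.integrable_of_hasCompactSupport (HasCompactSupport.of_compactSpace f)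

lemma const (c : ℝ) : IsCn n fun _ => c := contDiff_const

lemma add (hf : IsCn n f) (hg : IsCn n g) : IsCn n fun x => f x + g x := ContDiff.add hf hg

lemma sub (hf : IsCn n f) (hg : IsCn n g) : IsCn n fun x => f x - g x := ContDiff.sub hf hg

lemma mul (hf : IsCn n f) (hg : IsCn n g) : IsCn n fun x => f x * g x := ContDiff.mul hf hg

lemma pow (hf : IsCn n f) (k : ℕ) : IsCn n fun x => f x ^ k := ContDiff.pow hf k

lemma of_le (hf : IsCn n f) (h : m ≤ n) : IsCn m f := ContDiff.of_le hf h

lemma comp_of_pos {G : ℝ → ℝ} (hG : ContDiffOn ℝ n G (Ioi 0)) (hf : IsCn n f)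
    (hpos : ∀ x, 0 < f x) : IsCn n fun x => G (f x) :=
  hG.comp_contDiff hf fun y => hpos (toTorus y)

lemma sub_left (hf : IsCn n f) (x : T3) : IsCn n fun y => f (x - y) := by
  obtain ⟨z, rfl⟩ := toTorus_surjective x
  have h : ∀ y : Vec, toTorus z - toTorus y = toTorus (z - y) := by
    intro y
    rw [sub_eq_iff_eq_add, ← toTorus_add, sub_add_cancel]
  unfold IsCn
  simp only [h]
  exact ContDiff.comp (g := fun y : Vec => f (toTorus y)) hf (contDiff_const.sub contDiff_id)

lemma hasDerivAt (hf : IsCn n f) (hn : n ≠ 0) (i : Fin 3) (x : T3) (s : ℝ) :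
    HasDerivAt (fun s : ℝ => f (x + Pi.single i (s : UnitAddCircle)))
      (pd i f (x + Pi.single i (s : UnitAddCircle))) s := by
  obtain ⟨y, rfl⟩ := toTorus_surjective x
  have hd : DifferentiableAt ℝ (fun s : ℝ => f (toTorus y + Pi.single i (s : UnitAddCircle))) s := by
    have h : (fun s : ℝ => f (toTorus y + Pi.single i (s : UnitAddCircle))) =
        (fun z : Vec => f (toTorus z)) ∘ fun s : ℝ => y + s • Pi.single i (1 : ℝ) := by
      ext s
      rw [Function.comp_apply, ← Pi.single_smul, smul_eq_mul, mul_one, toTorus_add, toTorus_single]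
    rw [h]
    exact (ContDiff.differentiable hf hn _).comp _ (by fun_prop)
  have h2 : (fun s' : ℝ => f (toTorus y + Pi.single i (s : UnitAddCircle) +
      Pi.single i (s' : UnitAddCircle))) =
      fun s' => (fun s : ℝ => f (toTorus y + Pi.single i (s : UnitAddCircle))) (s + s') := by
    ext s'
    simp only [AddCircle.coe_add, Pi.single_add, add_assoc]
  have h3 : pd i f (toTorus y + Pi.single i (s : UnitAddCircle)) =
      deriv (fun s : ℝ => f (toTorus y + Pi.single i (s : UnitAddCircle))) s := by
    unfold NSK.pd
    rw [h2]
    refine (deriv_comp_const_add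
      (fun s : ℝ => f (toTorus y + Pi.single i (s : UnitAddCircle))) s 0).trans ?_
    rw [add_zero]
  rw [h3]
  exact hd.hasDerivAt

lemma hasDerivAt_zero (hf : IsCn n f) (hn : n ≠ 0) (i : Fin 3) (x : T3) :
    HasDerivAt (fun s : ℝ => f (x + Pi.single i (s : UnitAddCircle))) (pd i f x) 0 := by
  simpa using hf.hasDerivAt hn i x 0

lemma pd_toTorus (hf : IsCn n f) (hn : n ≠ 0) (i : Fin 3) (y : Vec) :
    NSK.pd i f (toTorus y) = fderiv ℝ (fun z : Vec => f (toTorus z)) y (Pi.single i 1) := by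
  have h := (ContDiff.differentiable hf hn y).hasFDerivAt
  have h' := (hf.hasDerivAt_zero hn i (toTorus y))
  refine h'.unique ?_
  have h2 : HasDerivAt (fun s : ℝ => y + s • (Pi.single i (1 : ℝ) : Vec)) (Pi.single i 1) 0 := by
    simpa using ((hasDerivAt_id (0 : ℝ)).smul_const (Pi.single i (1 : ℝ) : Vec)).const_add y
  have h3 := HasFDerivAt.comp_hasDerivAt (0 : ℝ) (by simpa using h) h2
  convert h3 using 1
  ext s
  rw [Function.comp_apply, ← Pi.single_smul, smul_eq_mul, mul_one, toTorus_add, toTorus_single]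

lemma pd (hf : IsCn n f) (hmn : m + 1 ≤ n) (i : Fin 3) : IsCn m (pd i f) := by
  have hn : n ≠ 0 := by
    rintro rfl
    simp at hmn
  have h : (fun y : Vec => NSK.pd i f (toTorus y)) =
      fun y => fderiv ℝ (fun z : Vec => f (toTorus z)) y (Pi.single i 1) :=
    funext (hf.pd_toTorus hn i)
  unfold IsCn
  rw [h]
  exact (ContDiff.fderiv_right hf hmn).clm_apply contDiff_const

end IsCn

section

variable {f g : T3 → ℝ}

lemma continuous_pd (hf : IsCn 1 f) (i : Fin 3) : Continuous (pd i f) :=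
  (hf.pd (m := 0) (by simp) i).continuous

lemma pd_add (hf : IsCn 1 f) (hg : IsCn 1 g) (i : Fin 3) (x : T3) :
    pd i (fun x => f x + g x) x = pd i f x + pd i g x :=
  ((hf.hasDerivAt_zero one_ne_zero i x).add (hg.hasDerivAt_zero one_ne_zero i x)).deriv

lemma pd_const_mul (c : ℝ) (hf : IsCn 1 f) (i : Fin 3) (x : T3) :
    pd i (fun x => c * f x) x = c * pd i f x :=
  ((hf.hasDerivAt_zero one_ne_zero i x).const_mul c).deriv

lemma pd_mul (hf : IsCn 1 f) (hg : IsCn 1 g) (i : Fin 3) (x : T3) :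
    pd i (fun x => f x * g x) x = pd i f x * g x + f x * pd i g x := by
  have h := (hf.hasDerivAt_zero one_ne_zero i x).fun_mul (hg.hasDerivAt_zero one_ne_zero i x)
  simp only [AddCircle.coe_zero, Pi.single_zero, add_zero] at h
  exact h.deriv

/-- The chain rule for a function of a `C¹` function on the torus. -/
lemma pd_comp {G : ℝ → ℝ} {G' : ℝ} (hf : IsCn 1 f) (i : Fin 3) (x : T3)
    (hG : HasDerivAt G G' (f x)) : pd i (fun y => G (f y)) x = G' * pd i f x := by
  have h := hf.hasDerivAt_zero one_ne_zero i x
  exact (HasDerivAt.comp (0 : ℝ) (h₂ := G) (by simpa using hG) h).deriv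

/-- The integral of a partial derivative vanishes, by translation invariance. -/
lemma integral_pd (hf : IsCn 1 f) (i : Fin 3) : ∫ x, pd i f x ∂vol = 0 := by
  have hc := continuous_pd hf i
  obtain ⟨K, hK⟩ := isCompact_univ.exists_bound_of_continuousOn hc.continuousOn
  have hshift (s : ℝ) : Continuous fun x => f (x + Pi.single i (s : UnitAddCircle)) :=
    hf.continuous.comp (continuous_id.add (continuous_const (y := (Pi.single i ↑s : T3))))
  have h := hasDerivAt_integral_of_dominated_loc_of_deriv_le (μ := vol) (𝕜 := ℝ)
    (F := fun s x => f (x + Pi.single i (s : UnitAddCircle)))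
    (F' := fun s x => pd i f (x + Pi.single i (s : UnitAddCircle))) (x₀ := 0) (bound := fun _ => K)
    (s := univ) univ_mem
    (Eventually.of_forall fun s => (hshift s).aestronglyMeasurable)
    (by simpa using hf.integrable)
    (by simpa using hc.aestronglyMeasurable)
    (Eventually.of_forall fun x s _ => hK _ (mem_univ _))
    (integrable_const K)
    (Eventually.of_forall fun x s _ => hf.hasDerivAt one_ne_zero i x s)
  have h2 : (fun s : ℝ => ∫ x, f (x + Pi.single i (s : UnitAddCircle)) ∂vol) =
      fun _ => ∫ x, f x ∂vol := by
    ext s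
    exact integral_add_right_eq_self f _
  have h3 := h.2
  rw [h2] at h3
  simpa using h3.unique (hasDerivAt_const 0 _)

/-- Integration by parts on the torus. -/
lemma integral_pd_mul (hf : IsCn 1 f) (hg : IsCn 1 g) (i : Fin 3) :
    ∫ x, pd i f x * g x ∂vol = -∫ x, f x * pd i g x ∂vol := by
  have h := integral_pd (hf.mul hg) i
  have hi1 : Integrable (fun x => pd i f x * g x) vol :=
    ((continuous_pd hf i).mul hg.continuous).integrable_of_hasCompactSupport
      (HasCompactSupport.of_compactSpace _)
  have hi2 : Integrable (fun x => f x * pd i g x) vol :=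
    (hf.continuous.mul (continuous_pd hg i)).integrable_of_hasCompactSupport
      (HasCompactSupport.of_compactSpace _)
  rw [integral_congr_ae (Eventually.of_forall fun x => pd_mul hf hg i x),
    integral_add hi1 hi2] at h
  linarith

end

/-! ### Fourier series and Sobolev inequalities on the torus -/

open UnitAddTorus in
lemma mFourierCoeff_eq_integral_vol (f : T3 → ℂ) (k : Fin 3 → ℤ) :
    mFourierCoeff f k = ∫ x, mFourier (-k) x • f x ∂vol := rfl

open UnitAddTorus in
lemma hasSum_norm_sq_mFourierCoeff {f : T3 → ℝ} (hf : Continuous f) :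
    HasSum (fun k => ‖mFourierCoeff (fun x => (f x : ℂ)) k‖ ^ 2) (∫ x, f x ^ 2 ∂vol) := by
  let F : C(T3, ℂ) := ⟨fun x => (f x : ℂ), by fun_prop⟩
  have h := hasSum_sq_mFourierCoeff (ContinuousMap.toLp 2 vol ℂ F)
  convert h using 1
  · ext k
    exact congrArg (fun z : ℂ => ‖z‖ ^ 2) (mFourierCoeff_toLp F k).symm
  · refine integral_congr_ae ?_
    filter_upwards [F.coeFn_toLp (p := 2) (𝕜 := ℂ) vol] with x hx
    have h2 : f x ^ 2 = ‖F x‖ ^ 2 := by simp [F]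
    exact h2.trans (congrArg (fun z : ℂ => ‖z‖ ^ 2) hx.symm)

open UnitAddTorus in
lemma isCn_mFourier (k : Fin 3 → ℤ) :
    IsCn ∞ (fun x => (mFourier k x).re) ∧ IsCn ∞ (fun x => (mFourier k x).im) := by
  have h : ContDiff ℝ ∞ fun y : Vec => mFourier k (toTorus y) := by
    simp only [mFourier, toTorus, ContinuousMap.coe_mk, fourier_coe_apply]
    refine contDiff_prod fun i _ => ?_
    refine ContDiff.cexp ?_
    have : ContDiff ℝ ∞ fun y : Vec => ((y i : ℝ) : ℂ) :=
      Complex.ofRealCLM.contDiff.comp (contDiff_apply ℝ ℝ i)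
    fun_prop
  exact ⟨Complex.reCLM.contDiff.comp h, Complex.imCLM.contDiff.comp h⟩

open UnitAddTorus in
lemma hasDerivAt_mFourier (k : Fin 3 → ℤ) (i : Fin 3) (x : T3) :
    HasDerivAt (fun s : ℝ => mFourier k (x + Pi.single i (s : UnitAddCircle)))
      (mFourier k x * (2 * Real.pi * Complex.I * k i)) 0 := by
  have h : (fun s : ℝ => mFourier k (x + Pi.single i (s : UnitAddCircle))) =
      fun s : ℝ => mFourier k x * fourier (k i) (s : UnitAddCircle) := by
    ext s
    have h1 : ∏ j, fourier (k j) ((Pi.single i (s : UnitAddCircle) : T3) j) =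
        fourier (k i) (s : UnitAddCircle) := by
      rw [Finset.prod_eq_single i]
      · simp
      · intro j _ hj
        rw [Pi.single_eq_of_ne hj]; simp
      · simp
    simp only [mFourier, ContinuousMap.coe_mk, ← h1, ← Finset.prod_mul_distrib, Pi.add_apply]
    refine Finset.prod_congr rfl fun j _ => ?_
    simp only [fourier_apply, smul_add, AddCircle.toCircle_add, Circle.coe_mul]
  rw [h]
  have h2 := (hasDerivAt_fourier 1 (k i) 0).const_mul (mFourier k x)
  simpa using h2

open UnitAddTorus in
lemma pd_mFourier (k : Fin 3 → ℤ) (i : Fin 3) (x : T3) :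
    pd i (fun x => (mFourier k x).re) x = -(2 * Real.pi * k i) * (mFourier k x).im ∧
    pd i (fun x => (mFourier k x).im) x = 2 * Real.pi * k i * (mFourier k x).re := by
  have h := hasDerivAt_mFourier k i x
  constructor
  · have h1 := (Complex.reCLM.hasFDerivAt.comp_hasDerivAt (0 : ℝ) h).deriv
    refine h1.trans ?_
    simp
    ring
  · have h1 := (Complex.imCLM.hasFDerivAt.comp_hasDerivAt (0 : ℝ) h).deriv
    refine h1.trans ?_
    simp
    ring

lemma integrable_of_continuous {f : T3 → ℝ} (hf : Continuous f) : Integrable f vol :=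
  hf.integrable_of_hasCompactSupport (HasCompactSupport.of_compactSpace f)

open UnitAddTorus in
lemma mFourierCoeff_ofReal {f : T3 → ℝ} (hf : Continuous f) (k : Fin 3 → ℤ) :
    mFourierCoeff (fun x => (f x : ℂ)) k =
      ((∫ x, f x * (mFourier (-k) x).re ∂vol : ℝ) : ℂ) +
        ((∫ x, f x * (mFourier (-k) x).im ∂vol : ℝ) : ℂ) * Complex.I := by
  have h1 : Integrable (fun x => ((f x * (mFourier (-k) x).re : ℝ) : ℂ)) vol :=
    (integrable_of_continuous
      (hf.mul (Complex.continuous_re.comp (mFourier (-k)).continuous))).ofReal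
  have h2 : Integrable (fun x => ((f x * (mFourier (-k) x).im : ℝ) : ℂ) * Complex.I) vol :=
    (integrable_of_continuous
      (hf.mul (Complex.continuous_im.comp (mFourier (-k)).continuous))).ofReal.mul_const _
  rw [mFourierCoeff_eq_integral_vol, ← integral_complex_ofReal, ← integral_complex_ofReal,
    ← integral_mul_const, ← integral_add h1 h2]
  refine integral_congr_ae (Eventually.of_forall fun x => ?_)
  apply Complex.ext <;> simp <;> ring

open UnitAddTorus in
lemma mFourierCoeff_pd {f : T3 → ℝ} (hf : IsCn 1 f) (i : Fin 3) (k : Fin 3 → ℤ) :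
    mFourierCoeff (fun x => (pd i f x : ℂ)) k =
      2 * Real.pi * Complex.I * k i * mFourierCoeff (fun x => (f x : ℂ)) k := by
  obtain ⟨hre, him⟩ := isCn_mFourier (-k)
  rw [mFourierCoeff_ofReal (continuous_pd hf i), mFourierCoeff_ofReal hf.continuous,
    integral_pd_mul hf (hre.of_le (by simp)), integral_pd_mul hf (him.of_le (by simp))]
  simp only [(pd_mFourier (-k) i _).1, (pd_mFourier (-k) i _).2, mul_left_comm (f _),
    integral_const_mul]
  apply Complex.ext <;> simp

open UnitAddTorus in
lemma norm_mFourierCoeff_pd_sq {f : T3 → ℝ} (hf : IsCn 1 f) (i : Fin 3) (k : Fin 3 → ℤ) :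
    (k i : ℝ) ^ 2 * ‖mFourierCoeff (fun x => (f x : ℂ)) k‖ ^ 2 ≤
      ‖mFourierCoeff (fun x => (pd i f x : ℂ)) k‖ ^ 2 := by
  have hpi : 1 ≤ (2 * Real.pi) ^ 2 := by nlinarith [Real.pi_gt_three]
  rw [mFourierCoeff_pd hf]
  simp only [norm_mul, mul_pow, Complex.norm_I, Complex.norm_ofNat, Complex.norm_real,
    Complex.norm_intCast, Real.norm_eq_abs, sq_abs, mul_one]
  have h0 : 0 ≤ (k i : ℝ) ^ 2 * ‖mFourierCoeff (fun x => (f x : ℂ)) k‖ ^ 2 := by positivity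
  rw [mul_pow] at hpi
  nlinarith

/-- Squared length of a frequency. -/
def freqSq (k : Fin 3 → ℤ) : ℝ := ∑ i, (k i : ℝ) ^ 2

lemma one_le_freqSq {k : Fin 3 → ℤ} (hk : k ≠ 0) : 1 ≤ freqSq k := by
  obtain ⟨i, hi⟩ := Function.ne_iff.1 hk
  have h1 : (1 : ℝ) ≤ (k i : ℝ) ^ 2 := by
    rw [← sq_abs]
    have : (1 : ℝ) ≤ |(k i : ℝ)| := by exact_mod_cast Int.one_le_abs hi
    nlinarith
  exact h1.trans (Finset.single_le_sum (f := fun i => (k i : ℝ) ^ 2)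
    (fun j _ => sq_nonneg _) (Finset.mem_univ i))

open UnitAddTorus in
lemma summable_freqSq_mul {f : T3 → ℝ} (hf : IsCn 1 f) :
    Summable (fun k => freqSq k * ‖mFourierCoeff (fun x => (f x : ℂ)) k‖ ^ 2) ∧
    ∑' k, freqSq k * ‖mFourierCoeff (fun x => (f x : ℂ)) k‖ ^ 2 ≤
      ∫ x, ∑ i, pd i f x ^ 2 ∂vol := by
  have hs := hasSum_sum (s := Finset.univ)
    fun i _ => hasSum_norm_sq_mFourierCoeff (continuous_pd hf i)
  have hle : ∀ k, freqSq k * ‖mFourierCoeff (fun x => (f x : ℂ)) k‖ ^ 2 ≤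
      ∑ i, ‖mFourierCoeff (fun x => (pd i f x : ℂ)) k‖ ^ 2 := by
    intro k
    rw [freqSq, Finset.sum_mul]
    exact Finset.sum_le_sum fun i _ => norm_mFourierCoeff_pd_sq hf i k
  have h0 : ∀ k, 0 ≤ freqSq k * ‖mFourierCoeff (fun x => (f x : ℂ)) k‖ ^ 2 := fun k =>
    mul_nonneg (Finset.sum_nonneg fun i _ => sq_nonneg _) (sq_nonneg _)
  have hsum := Summable.of_nonneg_of_le h0 hle hs.summable
  refine ⟨hsum, (hasSum_le hle hsum.hasSum hs).trans_eq ?_⟩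
  rw [integral_finsetSum]
  exact fun i _ => integrable_of_continuous ((continuous_pd hf i).pow 2)

open UnitAddTorus in
/-- The Poincaré inequality on the torus. -/
lemma poincare {f : T3 → ℝ} (hf : IsCn 1 f) :
    ∫ x, (f x - ∫ y, f y ∂vol) ^ 2 ∂vol ≤ ∫ x, ∑ i, pd i f x ^ 2 ∂vol := by
  set m := ∫ y, f y ∂vol
  have hg : IsCn 1 fun x => f x - m := hf.sub (IsCn.const m)
  have hpd : ∀ i x, pd i (fun x => f x - m) x = pd i f x := by
    intro i x
    exact ((hf.hasDerivAt_zero one_ne_zero i x).sub_const m).deriv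
  have h1 := hasSum_norm_sq_mFourierCoeff hg.continuous
  obtain ⟨h2, h3⟩ := summable_freqSq_mul hg
  simp only [hpd] at h3
  refine le_trans ?_ h3
  refine hasSum_le (fun k => ?_) h1 h2.hasSum
  by_cases hk : k = 0
  · have h0 : mFourierCoeff (fun x => ((f x - m : ℝ) : ℂ)) 0 = 0 := by
      rw [mFourierCoeff_ofReal hg.continuous]
      have : ∫ x, (f x - m) ∂vol = 0 := by
        rw [integral_sub hf.integrable (integrable_const _)]
        simp [m]
      simp [mFourier_zero, this]
    rw [hk, h0]
    simp
  · nlinarith [one_le_freqSq hk, sq_nonneg ‖mFourierCoeff (fun x => ((f x - m : ℝ) : ℂ)) k‖]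

/-- The gradient of a `C²` function is controlled by the Hessian, since its mean vanishes. -/
lemma integral_grad_sq_le {f : T3 → ℝ} (hf : IsCn 2 f) :
    ∫ x, ∑ i, pd i f x ^ 2 ∂vol ≤ ∫ x, sq9 (fun i j => pd j (pd i f) x) ∂vol := by
  have h2 : ((1 : WithTop ℕ∞) + 1 ≤ 2) := by norm_num
  have hf1 : IsCn 1 f := hf.of_le (by norm_num)
  have hpd : ∀ i, IsCn 1 (pd i f) := fun i => hf.pd h2 i
  simp only [sq9]
  rw [integral_finsetSum _ fun i _ => integrable_of_continuous (f := fun x => pd i f x ^ 2)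
      ((hpd i).continuous.pow 2),
    integral_finsetSum _ fun i _ => integrable_of_continuous
      (f := fun x => ∑ j, pd j (pd i f) x ^ 2)
      (continuous_finsetSum _ fun j _ => (continuous_pd (hpd i) j).pow 2)]
  refine Finset.sum_le_sum fun i _ => ?_
  have h := poincare (hpd i)
  simpa [integral_pd hf1 i] using h

open Classical in
lemma summable_freqSq_inv : Summable fun k : Fin 3 → ℤ => (freqSq k ^ 2)⁻¹ := by
  let b := Pi.basisFun ℝ (Fin 3)
  let L : Submodule ℤ Vec := Submodule.span ℤ (Set.range b)
  have hmem : ∀ k : Fin 3 → ℤ, (fun i => (k i : ℝ)) ∈ L := by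
    intro k
    have : (fun i => (k i : ℝ)) = ∑ i, k i • b i := by
      ext j
      simp [b, Finset.sum_apply, Pi.single_apply]
    rw [this]
    exact Submodule.sum_mem _ fun i _ => Submodule.smul_mem _ _ (Submodule.subset_span ⟨i, rfl⟩)
  have hrank : Module.finrank ℤ L = 3 := by
    rw [ZLattice.rank ℝ L]; simp
  have hs := ZLattice.summable_norm_pow_inv L 4 (by rw [hrank]; norm_num)
  have hinj : Function.Injective fun k : Fin 3 → ℤ => (⟨_, hmem k⟩ : L) := by
    intro k l h
    ext i
    have := congrFun (congrArg Subtype.val h) i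
    simpa using this
  have hs2 := hs.comp_injective hinj
  refine Summable.of_nonneg_of_le (fun k => by positivity) (fun k => ?_) hs2
  by_cases hk : k = 0
  · simp [hk, freqSq]
  have hv : (fun i => (k i : ℝ)) ≠ 0 := fun h => hk (by
    ext i; simpa using congrFun h i)
  simp only [Function.comp_apply, Submodule.coe_norm]
  rw [inv_pow]
  have hpos : 0 < ‖(fun i => (k i : ℝ) : Vec)‖ := norm_pos_iff.2 hv
  refine inv_anti₀ (by positivity) ?_
  have hle : ‖(fun i => (k i : ℝ) : Vec)‖ ^ 2 ≤ freqSq k := by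
    obtain ⟨i, hi⟩ : ∃ i, ‖(fun i => (k i : ℝ) : Vec)‖ = ‖(k i : ℝ)‖ := by
      obtain ⟨i, -, hi⟩ := Finset.exists_mem_eq_sup' (s := Finset.univ) Finset.univ_nonempty
        (fun i => ‖(k i : ℝ)‖₊)
      refine ⟨i, ?_⟩
      rw [Pi.norm_def, ← Finset.sup'_eq_sup Finset.univ_nonempty, hi]
      rfl
    rw [hi, Real.norm_eq_abs, sq_abs]
    exact Finset.single_le_sum (f := fun i => (k i : ℝ) ^ 2)
      (fun j _ => sq_nonneg _) (Finset.mem_univ i)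
  calc ‖(fun i => (k i : ℝ) : Vec)‖ ^ 4 = (‖(fun i => (k i : ℝ) : Vec)‖ ^ 2) ^ 2 := by ring
    _ ≤ freqSq k ^ 2 := by gcongr

open UnitAddTorus in
lemma summable_freqSq_sq_mul {f : T3 → ℝ} (hf : IsCn 2 f) :
    Summable (fun k => freqSq k ^ 2 * ‖mFourierCoeff (fun x => (f x : ℂ)) k‖ ^ 2) ∧
    ∑' k, freqSq k ^ 2 * ‖mFourierCoeff (fun x => (f x : ℂ)) k‖ ^ 2 ≤
      ∫ x, sq9 (fun i j => pd j (pd i f) x) ∂vol := by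
  have h2 : ((1 : WithTop ℕ∞) + 1 ≤ 2) := by norm_num
  have hf1 : IsCn 1 f := hf.of_le (by norm_num)
  have hpd : ∀ i, IsCn 1 (pd i f) := fun i => hf.pd h2 i
  have hs := hasSum_sum (s := Finset.univ)
    fun i _ => (summable_freqSq_mul (hpd i)).1.hasSum
  have hle : ∀ k, freqSq k ^ 2 * ‖mFourierCoeff (fun x => (f x : ℂ)) k‖ ^ 2 ≤
      ∑ i, freqSq k * ‖mFourierCoeff (fun x => (pd i f x : ℂ)) k‖ ^ 2 := by
    intro k
    rw [pow_two, mul_assoc, ← Finset.mul_sum]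
    refine mul_le_mul_of_nonneg_left ?_ (Finset.sum_nonneg fun i _ => sq_nonneg _)
    rw [freqSq, Finset.sum_mul]
    exact Finset.sum_le_sum fun i _ => norm_mFourierCoeff_pd_sq hf1 i k
  have hsum := Summable.of_nonneg_of_le (fun k => by positivity) hle hs.summable
  refine ⟨hsum, (hasSum_le hle hsum.hasSum hs).trans ?_⟩
  simp only [sq9]
  rw [integral_finsetSum _ fun i _ => integrable_of_continuous
      (f := fun x => ∑ j, pd j (pd i f) x ^ 2)
      (continuous_finsetSum _ fun j _ => (continuous_pd (hpd i) j).pow 2)]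
  exact Finset.sum_le_sum fun i _ => (summable_freqSq_mul (hpd i)).2

open UnitAddTorus in
/-- The embedding `W^{2,2}(𝕋³) ⊂ L^∞` for the oscillation of a `C²` function: by Cauchy-Schwarz,
the Fourier series of `f - f̂(0)` is absolutely summable because `∑ |k|⁻⁴` converges in dimension
three. -/
lemma exists_sq_sub_le_hessian : ∃ C : ℝ, 0 < C ∧ ∀ f : T3 → ℝ, IsCn 2 f → ∀ x y,
    (f x - f y) ^ 2 ≤ C * ∫ x, sq9 (fun i j => pd j (pd i f) x) ∂vol := by
  set S := ∑' k : Fin 3 → ℤ, (freqSq k ^ 2)⁻¹ with hS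
  have hS0 : 0 ≤ S := tsum_nonneg fun k => by positivity
  refine ⟨4 * S + 1, by positivity, fun f hf x y => ?_⟩
  set c := fun k => mFourierCoeff (fun x => (f x : ℂ)) k with hc
  obtain ⟨h1, h2⟩ := summable_freqSq_sq_mul hf
  set X := ∫ x, sq9 (fun i j => pd j (pd i f) x) ∂vol
  set W := ∑' k, freqSq k ^ 2 * ‖c k‖ ^ 2
  have hX0 : 0 ≤ X := (tsum_nonneg fun k => by positivity).trans h2
  -- Cauchy-Schwarz for the nonzero frequencies
  have hterm : ∀ k, k ≠ 0 → ‖c k‖ = (freqSq k)⁻¹ * (freqSq k * ‖c k‖) := by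
    intro k hk
    have := one_le_freqSq hk
    field_simp
  have hcs := Real.inner_le_Lp_mul_Lq_hasSum_of_nonneg (ι := Fin 3 → ℤ)
    (p := 2) (q := 2) (f := fun k => (freqSq k)⁻¹) (g := fun k => freqSq k * ‖c k‖)
    Real.HolderConjugate.two_two (A := Real.sqrt S) (B := Real.sqrt W)
    (Real.sqrt_nonneg _) (Real.sqrt_nonneg _)
    (fun k => inv_nonneg.2 (Finset.sum_nonneg fun i _ => sq_nonneg _))
    (fun k => mul_nonneg (Finset.sum_nonneg fun i _ => sq_nonneg _) (norm_nonneg _))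
    (by
      simp only [Real.rpow_two, inv_pow]
      rw [Real.sq_sqrt hS0]
      exact summable_freqSq_inv.hasSum)
    (by
      simp only [Real.rpow_two, mul_pow]
      rw [Real.sq_sqrt (tsum_nonneg fun k => by positivity)]
      exact h1.hasSum)
  obtain ⟨A, hA0, hA, hAsum⟩ := hcs
  -- summability of all the coefficients
  have hsum : Summable fun k => ‖c k‖ := by
    rw [← (Finset.summable_compl_iff {(0 : Fin 3 → ℤ)})]
    refine (hAsum.summable.subtype _).congr fun k => ?_
    exact (hterm k (by simpa using k.2)).symm
  let F : C(T3, ℂ) := ⟨fun x => (f x : ℂ), by have := hf.continuous; fun_prop⟩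
  have hF : ∀ x, HasSum (fun k => c k • mFourier k x) (f x : ℂ) :=
    hasSum_mFourier_series_apply_of_summable (f := F) (Summable.of_norm hsum)
  have hdiff := (hF x).sub (hF y)
  have hbound : ∀ k, ‖c k • mFourier k x - c k • mFourier k y‖ ≤
      2 * ((freqSq k)⁻¹ * (freqSq k * ‖c k‖)) := by
    intro k
    by_cases hk : k = 0
    · simp [hk, mFourier_zero, freqSq]
    · rw [← hterm k hk, ← smul_sub, norm_smul, mul_comm]
      gcongr
      have h3 : ∀ z, ‖mFourier k z‖ ≤ 1 := fun z =>
        ((mFourier k).norm_coe_le_norm z).trans_eq mFourier_norm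
      linarith [norm_sub_le (mFourier k x) (mFourier k y), h3 x, h3 y]
  have hfin : ‖(f x : ℂ) - f y‖ ≤ 2 * A := by
    rw [← hdiff.tsum_eq]
    exact tsum_of_norm_bounded (hAsum.mul_left 2) hbound
  rw [← Complex.ofReal_sub, Complex.norm_real, Real.norm_eq_abs] at hfin
  have hA2 : A ^ 2 ≤ S * W := by
    calc A ^ 2 ≤ (Real.sqrt S * Real.sqrt W) ^ 2 := by gcongr
      _ = S * W := by
        rw [mul_pow, Real.sq_sqrt hS0, Real.sq_sqrt (tsum_nonneg fun k => by positivity)]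
  calc (f x - f y) ^ 2 = |f x - f y| ^ 2 := (sq_abs _).symm
    _ ≤ (2 * A) ^ 2 := by gcongr
    _ = 4 * A ^ 2 := by ring
    _ ≤ 4 * (S * W) := by gcongr
    _ ≤ 4 * (S * X) := by gcongr
    _ ≤ (4 * S + 1) * X := by nlinarith

/-! ### Potentials and relative values -/

/-- A derivative bound integrates to a bound on increments. -/
lemma sub_le_mul_sub_of_deriv_le {g Z g' Z' : ℝ → ℝ} {a b C : ℝ} (hab : a ≤ b)
    (hg : ∀ s ∈ Icc a b, HasDerivAt g (g' s) s) (hZ : ∀ s ∈ Icc a b, HasDerivAt Z (Z' s) s)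
    (h : ∀ s ∈ Icc a b, g' s ≤ C * Z' s) : g b - g a ≤ C * (Z b - Z a) := by
  have hd : ∀ s ∈ Icc a b, HasDerivAt (fun s => C * Z s - g s) (C * Z' s - g' s) s := fun s hs =>
    ((hZ s hs).const_mul C).sub (hg s hs)
  have hm : MonotoneOn (fun s => C * Z s - g s) (Icc a b) := by
    refine monotoneOn_of_deriv_nonneg (convex_Icc a b)
      (fun s hs => (hd s hs).continuousAt.continuousWithinAt)
      (fun s hs => (hd s (interior_subset hs)).differentiableAt.differentiableWithinAt)
      fun s hs => ?_
    rw [(hd s (interior_subset hs)).deriv]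
    linarith [h s (interior_subset hs)]
  have := hm (left_mem_Icc.2 hab) (right_mem_Icc.2 hab) hab
  simp only at this
  linarith

lemma exists_le_mul_of_continuousOn {φ ψ : ℝ → ℝ} {a b : ℝ}
    (hφ : ContinuousOn φ (Icc a b)) (hψ : ContinuousOn ψ (Icc a b))
    (hpos : ∀ s ∈ Icc a b, 0 < ψ s) : ∃ C : ℝ, 0 < C ∧ ∀ s ∈ Icc a b, φ s ≤ C * ψ s := by
  obtain ⟨K, hK⟩ := isCompact_Icc.exists_bound_of_continuousOn
    (hφ.div hψ fun s hs => (hpos s hs).ne')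
  refine ⟨max K 1, by positivity, fun s hs => ?_⟩
  have h := (le_abs_self _).trans ((hK s hs).trans (le_max_left K 1))
  simp only [Pi.div_apply] at h
  rwa [div_le_iff₀ (hpos s hs)] at h

lemma hasDerivAt_primitive {f : ℝ → ℝ} (hf : ContinuousOn f (Ioi 0)) {c s : ℝ} (hc : 0 < c)
    (hs : 0 < s) : HasDerivAt (fun t => ∫ τ in c..t, f τ) (f s) s := by
  have hsub : uIcc c s ⊆ Ioi 0 := fun x hx => (lt_min hc hs).trans_le hx.1
  exact intervalIntegral.integral_hasDerivAt_right (hf.mono hsub).intervalIntegrable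
    (hf.stronglyMeasurableAtFilter isOpen_Ioi s hs) (hf.continuousAt (Ioi_mem_nhds hs))

/-- The derivative `∫₁^s f(τ) τ⁻² dτ + f(s) / s` of the potential of `f`. -/
def potentialDeriv (f : ℝ → ℝ) (s : ℝ) : ℝ := (∫ τ in (1 : ℝ)..s, f τ / τ ^ 2) + f s / s

section Potential

variable {f : ℝ → ℝ} {s r c : ℝ}

lemma potential_eq (hs : 0 < s) : potential f s = s * potentialDeriv f s - f s := by
  unfold potential potentialDeriv
  field_simp
  ring

lemma hasDerivAt_integral_div_sq (hf : ContinuousOn f (Ioi 0)) (hs : 0 < s) :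
    HasDerivAt (fun t => ∫ τ in (1 : ℝ)..t, f τ / τ ^ 2) (f s / s ^ 2) s :=
  hasDerivAt_primitive (f := fun τ => f τ / τ ^ 2)
    (hf.div (by fun_prop) fun τ hτ => (pow_pos hτ 2).ne') one_pos hs

lemma hasDerivAt_potential (hf : ContinuousOn f (Ioi 0)) (hs : 0 < s) :
    HasDerivAt (potential f) (potentialDeriv f s) s := by
  have h : HasDerivAt (potential f) _ s :=
    (hasDerivAt_id s).fun_mul (hasDerivAt_integral_div_sq hf hs)
  refine h.congr_deriv ?_
  unfold potentialDeriv
  simp only [id]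
  field_simp

lemma hasDerivAt_potentialDeriv (hf : ContDiffOn ℝ 1 f (Ioi 0)) (hs : 0 < s) :
    HasDerivAt (potentialDeriv f) (deriv f s / s) s := by
  have hd := ((hf.differentiableOn one_ne_zero).differentiableAt (Ioi_mem_nhds hs)).hasDerivAt
  have h : HasDerivAt (potentialDeriv f) _ s :=
    (hasDerivAt_integral_div_sq hf.continuousOn hs).fun_add
      (hd.fun_div (hasDerivAt_id s) hs.ne')
  refine h.congr_deriv ?_
  field_simp
  ring

lemma deriv_deriv_potential (hf : ContDiffOn ℝ 1 f (Ioi 0)) (hs : 0 < s) :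
    deriv (deriv (potential f)) s = deriv f s / s := by
  have h : deriv (potential f) =ᶠ[𝓝 s] potentialDeriv f := by
    filter_upwards [Ioi_mem_nhds hs] with t ht
    exact (hasDerivAt_potential hf.continuousOn ht).deriv
  rw [h.deriv_eq, (hasDerivAt_potentialDeriv hf hs).deriv]

lemma relative_potential_eq (hf : ContinuousOn f (Ioi 0)) (hr : 0 < r) :
    relative (potential f) s r =
      potential f s - potential f r - potentialDeriv f r * (s - r) := by
  rw [relative, (hasDerivAt_potential hf hr).deriv]

lemma relative_potential_zero (hf : ContinuousOn f (Ioi 0)) (hr : 0 < r) :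
    relative (potential f) 0 r = f r := by
  rw [relative_potential_eq hf hr, potential_eq hr]
  simp only [potential]
  ring

lemma potentialDeriv_mono (hf : ContDiffOn ℝ 1 f (Ioi 0)) (h1 : ∀ s, 0 < s → 0 ≤ deriv f s) :
    MonotoneOn (potentialDeriv f) (Ioi 0) := by
  refine monotoneOn_of_deriv_nonneg (convex_Ioi 0)
    (fun s hs => (hasDerivAt_potentialDeriv hf hs).continuousAt.continuousWithinAt)
    (fun s hs => (hasDerivAt_potentialDeriv hf
      (interior_subset hs)).differentiableAt.differentiableWithinAt) fun s hs => ?_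
  have hs' : 0 < s := interior_subset hs
  rw [(hasDerivAt_potentialDeriv hf hs').deriv]
  exact div_nonneg (h1 s hs') hs'.le

/-- Convexity of the potential: it lies above its tangents. -/
lemma potential_tangent_le (hf : ContDiffOn ℝ 1 f (Ioi 0)) (h1 : ∀ s, 0 < s → 0 ≤ deriv f s)
    (hs : 0 < s) (hr : 0 < r) : potentialDeriv f r * (s - r) ≤ potential f s - potential f r := by
  have hm := potentialDeriv_mono hf h1
  have hpot : ∀ t, 0 < t → HasDerivAt (potential f) (potentialDeriv f t) t := fun t ht =>
    hasDerivAt_potential hf.continuousOn ht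
  rcases le_total r s with h | h
  · have h2 := sub_le_mul_sub_of_deriv_le (g := id) (g' := fun _ => 1) (Z := id) (Z' := fun _ => 1)
      (C := 1) h (fun t _ => hasDerivAt_id t) (fun t _ => hasDerivAt_id t) (by simp)
    have h3 := sub_le_mul_sub_of_deriv_le (g := fun t => potentialDeriv f r * t)
      (g' := fun _ => potentialDeriv f r * 1) (Z := potential f) (Z' := potentialDeriv f) (C := 1) h
      (fun t _ => (hasDerivAt_id t).const_mul _) (fun t ht => hpot t (hr.trans_le ht.1))
      (fun t ht => by simpa using hm hr (hr.trans_le ht.1) ht.1)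
    linarith
  · have h3 := sub_le_mul_sub_of_deriv_le (g := potential f) (g' := potentialDeriv f)
      (Z := fun t => potentialDeriv f r * t) (Z' := fun _ => potentialDeriv f r * 1) (C := 1) h
      (fun t ht => hpot t (hs.trans_le ht.1)) (fun t _ => (hasDerivAt_id t).const_mul _)
      (fun t ht => by simpa using hm (hs.trans_le ht.1) hr ht.2)
    linarith

lemma relative_potential_nonneg (hf : ContDiffOn ℝ 1 f (Ioi 0)) (h0 : ∀ s, 0 < s → 0 ≤ f s)
    (h1 : ∀ s, 0 < s → 0 ≤ deriv f s) (hs : 0 ≤ s) (hr : 0 < r) :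
    0 ≤ relative (potential f) s r := by
  rcases hs.eq_or_lt with rfl | hs
  · rw [relative_potential_zero hf.continuousOn hr]
    exact h0 r hr
  · rw [relative_potential_eq hf.continuousOn hr]
    linarith [potential_tangent_le hf h1 hs hr]

lemma relative_potential_le_mul (hf : ContDiffOn ℝ 1 f (Ioi 0)) (h1 : ∀ s, 0 < s → 0 ≤ deriv f s)
    (hs : 0 < s) (hr : 0 < r) :
    relative (potential f) s r ≤ (potentialDeriv f s - potentialDeriv f r) * (s - r) := by
  rw [relative_potential_eq hf.continuousOn hr]
  linarith [potential_tangent_le hf h1 hr hs]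

/-- On bounded sets of densities the relative potential is controlled by the square of the
increment of any function `Z` with positive derivative: near `r` both are quadratic, and near
vacuum the relative potential stays bounded. -/
lemma exists_relative_potential_le_near (hf : ContDiffOn ℝ 1 f (Ioi 0))
    (h0 : ∀ s, 0 < s → 0 ≤ f s) (h1 : ∀ s, 0 < s → 0 ≤ deriv f s) {Z Z' : ℝ → ℝ}
    (hZ : ∀ s, 0 < s → HasDerivAt Z (Z' s) s) (hZc : ContinuousOn Z' (Ioi 0))
    (hZ' : ∀ s, 0 < s → 0 < Z' s) (hr : 0 < r) :
    ∃ C : ℝ, 0 < C ∧ ∀ s, 0 < s → s ≤ 2 * r →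
      relative (potential f) s r ≤ C * (Z s - Z r) ^ 2 := by
  have hsub : Icc (r / 2) (2 * r) ⊆ Ioi 0 := fun x hx => (half_pos hr).trans_le hx.1
  obtain ⟨C₁, hC₁, hb₁⟩ := exists_le_mul_of_continuousOn (φ := fun _ => 1) (ψ := Z')
    continuousOn_const (hZc.mono hsub) fun s hs => hZ' s (hsub hs)
  have hfc : ContinuousOn (fun s => deriv f s / s) (Ioi 0) :=
    (hf.continuousOn_deriv_of_isOpen isOpen_Ioi le_rfl).div continuousOn_id fun s hs => ne_of_gt hs
  obtain ⟨C₂, hC₂, hb₂⟩ := exists_le_mul_of_continuousOn (φ := fun s => deriv f s / s) (ψ := Z')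
    (hfc.mono hsub) (hZc.mono hsub) fun s hs => hZ' s (hsub hs)
  have hmono := potentialDeriv_mono hf h1
  have hZmono : StrictMonoOn Z (Ioi 0) :=
    strictMonoOn_of_deriv_pos (convex_Ioi 0)
      (fun s hs => (hZ s hs).continuousAt.continuousWithinAt) fun s hs => by
        rw [(hZ s (interior_subset hs)).deriv]; exact hZ' s (interior_subset hs)
  -- increments on the compact interval
  have hinc : ∀ a b, r / 2 ≤ a → a ≤ b → b ≤ 2 * r →
      (potentialDeriv f b - potentialDeriv f a) * (b - a) ≤ C₂ * C₁ * (Z b - Z a) ^ 2 := by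
    intro a b ha hab hb
    have hmem : ∀ t ∈ Icc a b, t ∈ Icc (r / 2) (2 * r) := fun t ht =>
      ⟨ha.trans ht.1, ht.2.trans hb⟩
    have e1 := sub_le_mul_sub_of_deriv_le (g := id) (g' := fun _ => 1) (Z := Z) (Z' := Z') hab
      (fun t _ => hasDerivAt_id t) (fun t ht => hZ t (hsub (hmem t ht)))
      (fun t ht => hb₁ t (hmem t ht))
    have e2 := sub_le_mul_sub_of_deriv_le (g := potentialDeriv f) (g' := fun s => deriv f s / s)
      (Z := Z) (Z' := Z') hab (fun t ht => hasDerivAt_potentialDeriv hf (hsub (hmem t ht)))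
      (fun t ht => hZ t (hsub (hmem t ht))) (fun t ht => hb₂ t (hmem t ht))
    simp only [id] at e1
    have hapos : 0 < a := (half_pos hr).trans_le ha
    have hp := sub_nonneg.2 (hmono (mem_Ioi.2 hapos) (mem_Ioi.2 (hapos.trans_le hab)) hab)
    calc _ ≤ (C₂ * (Z b - Z a)) * (C₁ * (Z b - Z a)) :=
          mul_le_mul e2 e1 (sub_nonneg.2 hab) (hp.trans e2)
      _ = _ := by ring
  -- a bound near vacuum
  obtain ⟨B, hB0, hB⟩ : ∃ B : ℝ, 0 < B ∧ ∀ s, 0 < s → s ≤ r / 2 →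
      relative (potential f) s r ≤ B := by
    set I := ∫ τ in (1 : ℝ)..(max 1 r), f τ / τ ^ 2 with hI
    have hint : ∀ a b : ℝ, 0 < a → 0 < b →
        IntervalIntegrable (fun τ => f τ / τ ^ 2) volume a b := by
      intro a b ha hb
      refine ContinuousOn.intervalIntegrable ?_
      have hs : uIcc a b ⊆ Ioi 0 := fun x hx => (lt_min ha hb).trans_le hx.1
      exact (hf.continuousOn.mono hs).div (by fun_prop) fun τ hτ => (pow_pos (hs hτ) 2).ne'
    have hnn : ∀ a b : ℝ, 0 < a → a ≤ b → 0 ≤ ∫ τ in a..b, f τ / τ ^ 2 := by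
      intro a b ha hab
      exact intervalIntegral.integral_nonneg hab fun τ hτ =>
        div_nonneg (h0 τ (ha.trans_le hτ.1)) (sq_nonneg τ)
    have hI0 : 0 ≤ I := hnn _ _ one_pos (le_max_left _ _)
    refine ⟨r * I + |potential f r| + |potentialDeriv f r| * r + 1, by positivity,
      fun s hs hsr => ?_⟩
    have hps : potential f s ≤ r * I := by
      unfold potential
      rcases le_total s 1 with hs1 | hs1
      · rw [intervalIntegral.integral_symm]
        have h2 := hnn s 1 hs hs1
        have h3 : 0 ≤ r * I := by positivity
        nlinarith
      · have h2 : ∫ τ in (1 : ℝ)..s, f τ / τ ^ 2 ≤ I := by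
          have hle : s ≤ max 1 r := by
            refine le_trans ?_ (le_max_right 1 r)
            linarith
          have h3 := intervalIntegral.integral_add_adjacent_intervals (hint 1 s one_pos hs)
            (hint s (max 1 r) hs (by positivity))
          linarith [hnn s (max 1 r) hs hle]
        exact mul_le_mul (by linarith) h2 (hnn 1 s one_pos hs1) hr.le
    rw [relative_potential_eq hf.continuousOn hr]
    have h4 : -(potentialDeriv f r * (s - r)) ≤ |potentialDeriv f r| * r := by
      rw [← mul_neg, neg_sub]
      calc potentialDeriv f r * (r - s) ≤ |potentialDeriv f r| * (r - s) := by
            gcongr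
            · linarith
            · exact le_abs_self _
        _ ≤ _ := by gcongr; linarith
    linarith [neg_abs_le (potential f r)]
  set z := Z r - Z (r / 2) with hz
  have hz0 : 0 < z := sub_pos.2 (hZmono (mem_Ioi.2 (half_pos hr)) (mem_Ioi.2 hr) (half_lt_self hr))
  refine ⟨C₂ * C₁ + B / z ^ 2, by positivity, fun s hs hs2 => ?_⟩
  rcases le_total s (r / 2) with hsr | hsr
  · have h5 : z ^ 2 ≤ (Z s - Z r) ^ 2 := by
      have : Z s ≤ Z (r / 2) := hZmono.monotoneOn (mem_Ioi.2 hs) (mem_Ioi.2 (half_pos hr)) hsr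
      nlinarith
    have h6 : B ≤ B / z ^ 2 * (Z s - Z r) ^ 2 := by
      calc B = B / z ^ 2 * z ^ 2 := by field_simp
        _ ≤ _ := by gcongr
    have h7 : 0 ≤ C₂ * C₁ * (Z s - Z r) ^ 2 := by positivity
    linarith [hB s hs hsr]
  · have h7 : 0 ≤ B / z ^ 2 * (Z s - Z r) ^ 2 := by positivity
    have h8 := relative_potential_le_mul hf h1 hs hr
    rcases le_total s r with h | h
    · have h9 := hinc s r hsr h (by linarith)
      have e : (Z r - Z s) ^ 2 = (Z s - Z r) ^ 2 := by ring
      rw [e] at h9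
      linarith
    · have h9 := hinc r s (by linarith) h hs2
      linarith

/-- For large densities, if the second derivative `f'(s) / s` of the potential is controlled by
`Z'`, then the relative potential is controlled by `s (Z(s) - Z(r))²`. -/
lemma exists_relative_potential_le_far (hf : ContDiffOn ℝ 1 f (Ioi 0))
    (h1 : ∀ s, 0 < s → 0 ≤ deriv f s) {Z Z' : ℝ → ℝ}
    (hZ : ∀ s, 0 < s → HasDerivAt Z (Z' s) s)
    (hZ' : ∀ s, 0 < s → 0 < Z' s) (hr : 0 < r) {C₁ : ℝ} (hC₁ : 0 ≤ C₁)
    (hdom : ∀ s, 2 * r ≤ s → deriv f s / s ≤ C₁ * Z' s) :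
    ∃ C : ℝ, 0 < C ∧ ∀ s, 2 * r ≤ s →
      relative (potential f) s r ≤ C * (s * (Z s - Z r) ^ 2) := by
  have hmono := potentialDeriv_mono hf h1
  have hZmono : StrictMonoOn Z (Ioi 0) :=
    strictMonoOn_of_deriv_pos (convex_Ioi 0)
      (fun s hs => (hZ s hs).continuousAt.continuousWithinAt) fun s hs => by
        rw [(hZ s (interior_subset hs)).deriv]; exact hZ' s (interior_subset hs)
  have h2r : 0 < 2 * r := by positivity
  set z := Z (2 * r) - Z r
  have hz : 0 < z := sub_pos.2 (hZmono (mem_Ioi.2 hr) (mem_Ioi.2 h2r) (by linarith))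
  set K := potentialDeriv f (2 * r) - potentialDeriv f r
  have hK : 0 ≤ K := sub_nonneg.2 (hmono (mem_Ioi.2 hr) (mem_Ioi.2 h2r) (by linarith))
  refine ⟨C₁ / z + K / z ^ 2 + 1, by positivity, fun s hs => ?_⟩
  have hs0 : 0 < s := h2r.trans_le hs
  have hzs : z ≤ Z s - Z r := by
    have := hZmono.monotoneOn (mem_Ioi.2 h2r) (mem_Ioi.2 hs0) hs
    simp only [z]; linarith
  have e1 := sub_le_mul_sub_of_deriv_le (g := potentialDeriv f) (g' := fun s => deriv f s / s)
    (Z := Z) (Z' := Z') hs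
    (fun t ht => hasDerivAt_potentialDeriv hf (h2r.trans_le ht.1))
    (fun t ht => hZ t (h2r.trans_le ht.1)) (fun t ht => hdom t ht.1)
  have e2 : C₁ * (Z s - Z (2 * r)) ≤ C₁ / z * (Z s - Z r) ^ 2 := by
    calc C₁ * (Z s - Z (2 * r)) ≤ C₁ * (Z s - Z r) := by
          gcongr
          simp only [z] at hz
          linarith
      _ = C₁ / z * (z * (Z s - Z r)) := by field_simp
      _ ≤ C₁ / z * ((Z s - Z r) * (Z s - Z r)) := by gcongr; linarith
      _ = _ := by ring
  have e3 : K ≤ K / z ^ 2 * (Z s - Z r) ^ 2 := by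
    calc K = K / z ^ 2 * z ^ 2 := by field_simp
      _ ≤ _ := by gcongr
  have e4 : potentialDeriv f s - potentialDeriv f r ≤
      (C₁ / z + K / z ^ 2 + 1) * (Z s - Z r) ^ 2 := by
    nlinarith [sq_nonneg (Z s - Z r)]
  have e5 : 0 ≤ (C₁ / z + K / z ^ 2 + 1) * (Z s - Z r) ^ 2 := by positivity
  calc relative (potential f) s r
      ≤ (potentialDeriv f s - potentialDeriv f r) * (s - r) :=
        relative_potential_le_mul hf h1 hs0 hr
    _ ≤ ((C₁ / z + K / z ^ 2 + 1) * (Z s - Z r) ^ 2) * s :=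
        mul_le_mul e4 (by linarith) (by linarith) e5
    _ = _ := by ring

end Potential

/-! ### Viscosity and pressure laws -/

namespace IsViscosity

variable {μ : ℝ → ℝ} {α₁ α₂ : ℝ} {s : ℝ}

lemma alpha₁_pos (h : IsViscosity μ α₁ α₂) : 0 < α₁ := by linarith [h.alpha_lt.1]

lemma alpha₂_pos (h : IsViscosity μ α₁ α₂) : 0 < α₂ := h.alpha₁_pos.trans h.alpha_lt.2.1

lemma deriv_pos (h : IsViscosity μ α₁ α₂) (hs : 0 < s) : 0 < deriv μ s := by
  have h1 := (h.bounds s hs).1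
  have h2 : 0 < 1 / α₂ := one_div_pos.2 h.alpha₂_pos
  exact (mul_pos_iff_of_pos_left hs).1 ((mul_pos_iff_of_pos_left h2).1 h1)

lemma pos (h : IsViscosity μ α₁ α₂) (hs : 0 < s) : 0 < μ s :=
  (h.bounds s hs).1.trans_le (h.bounds s hs).2.1

lemma mul_deriv_le (h : IsViscosity μ α₁ α₂) (hs : 0 < s) : s * deriv μ s ≤ α₂ * μ s := by
  have h1 := (h.bounds s hs).2.1
  rwa [one_div, inv_mul_le_iff₀ h.alpha₂_pos] at h1

lemma le_mul_deriv (h : IsViscosity μ α₁ α₂) (hs : 0 < s) : α₁ * μ s ≤ s * deriv μ s := by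
  have h1 := (h.bounds s hs).2.2
  rwa [one_div, le_inv_mul_iff₀ h.alpha₁_pos] at h1

lemma hasDerivAt (h : IsViscosity μ α₁ α₂) (hs : 0 < s) : HasDerivAt μ (deriv μ s) s :=
  ((h.smooth.differentiableOn two_ne_zero).differentiableAt (Ioi_mem_nhds hs)).hasDerivAt

lemma contDiffOn_deriv (h : IsViscosity μ α₁ α₂) : ContDiffOn ℝ 1 (deriv μ) (Ioi 0) :=
  h.smooth.deriv_of_isOpen isOpen_Ioi (by norm_num)

lemma contDiffOn_one (h : IsViscosity μ α₁ α₂) : ContDiffOn ℝ 1 μ (Ioi 0) :=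
  h.smooth.of_le (by norm_num)

lemma strictMonoOn (h : IsViscosity μ α₁ α₂) : StrictMonoOn μ (Ioi 0) :=
  strictMonoOn_of_deriv_pos (convex_Ioi 0) h.smooth.continuousOn fun _ hs =>
    h.deriv_pos (interior_subset hs)

lemma hasDerivAt_mul_rpow (h : IsViscosity μ α₁ α₂) (p : ℝ) (hs : 0 < s) :
    HasDerivAt (fun s => μ s * s ^ (-p)) (s ^ (-p - 1) * (s * deriv μ s - p * μ s)) s := by
  have h1 := (h.hasDerivAt hs).fun_mul (Real.hasDerivAt_rpow_const (p := -p) (Or.inl hs.ne'))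
  refine h1.congr_deriv ?_
  have : s ^ (-p) = s ^ (-p - 1) * s := by
    rw [← Real.rpow_add_one hs.ne']; ring_nf
  rw [this]
  ring

/-- If `s μ'(s) ≥ p μ(s)` on an interval, then `μ(s) / s^p` increases there. -/
lemma mul_rpow_le_mul_rpow (h : IsViscosity μ α₁ α₂) {p a b : ℝ} (ha : 0 < a) (hab : a ≤ b)
    (hp : ∀ s ∈ Icc a b, p * μ s ≤ s * deriv μ s) : μ a * b ^ p ≤ μ b * a ^ p := by
  have h1 := sub_le_mul_sub_of_deriv_le (g := fun _ => 0) (g' := fun _ => 0)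
    (Z := fun s => μ s * s ^ (-p)) (C := 1) hab
    (fun s _ => hasDerivAt_const s 0) (fun s hs => h.hasDerivAt_mul_rpow p (ha.trans_le hs.1))
    (fun s hs => by
      have h0 : 0 < s := ha.trans_le hs.1
      have := mul_nonneg (Real.rpow_nonneg h0.le (-p - 1)) (sub_nonneg.2 (hp s hs))
      simpa using this)
  have hb : 0 < b := ha.trans_le hab
  simp only [Real.rpow_neg ha.le, Real.rpow_neg hb.le, ← div_eq_mul_inv] at h1
  have h2 : μ a / a ^ p ≤ μ b / b ^ p := by linarith
  rwa [div_le_div_iff₀ (by positivity) (by positivity)] at h2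

/-- If `s μ'(s) ≤ p μ(s)` on an interval, then `μ(s) / s^p` decreases there. -/
lemma mul_rpow_le_mul_rpow' (h : IsViscosity μ α₁ α₂) {p a b : ℝ} (ha : 0 < a) (hab : a ≤ b)
    (hp : ∀ s ∈ Icc a b, s * deriv μ s ≤ p * μ s) : μ b * a ^ p ≤ μ a * b ^ p := by
  have h1 := sub_le_mul_sub_of_deriv_le (Z := fun _ => 0) (Z' := fun _ => 0)
    (g := fun s => μ s * s ^ (-p)) (C := 1) hab
    (fun s hs => h.hasDerivAt_mul_rpow p (ha.trans_le hs.1)) (fun s _ => hasDerivAt_const s 0)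
    (fun s hs => by
      have h0 : 0 < s := ha.trans_le hs.1
      have := mul_nonneg (Real.rpow_nonneg h0.le (-p - 1)) (sub_nonneg.2 (hp s hs))
      simp only [mul_zero]
      linarith)
  have hb : 0 < b := ha.trans_le hab
  simp only [Real.rpow_neg ha.le, Real.rpow_neg hb.le, ← div_eq_mul_inv] at h1
  have h2 : μ b / b ^ p ≤ μ a / a ^ p := by linarith
  rwa [div_le_div_iff₀ (by positivity) (by positivity)] at h2

lemma le_rpow (h : IsViscosity μ α₁ α₂) (hs : 0 < s) (hs1 : s ≤ 1) : μ s ≤ μ 1 * s ^ α₁ := by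
  have := h.mul_rpow_le_mul_rpow (p := α₁) hs hs1 fun t ht => h.le_mul_deriv (hs.trans_le ht.1)
  simpa using this

lemma tendsto_zero (h : IsViscosity μ α₁ α₂) : Tendsto μ (𝓝[>] 0) (𝓝 0) := by
  have h1 : Tendsto (fun s : ℝ => μ 1 * s ^ α₁) (𝓝[>] 0) (𝓝 0) := by
    have := ((Real.continuousAt_rpow_const 0 α₁ (Or.inr h.alpha₁_pos.le)).tendsto.const_mul (μ 1))
    rw [Real.zero_rpow h.alpha₁_pos.ne', mul_zero] at this
    exact this.mono_left nhdsWithin_le_nhds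
  refine tendsto_of_tendsto_of_tendsto_of_le_of_le' tendsto_const_nhds h1 ?_ ?_
  · filter_upwards [self_mem_nhdsWithin] with s hs using (h.pos hs).le
  · filter_upwards [Ioc_mem_nhdsGT one_pos] with s hs using h.le_rpow hs.1 hs.2

/-- Far from vacuum the viscosity grows at least linearly. -/
lemma exists_mul_le (h : IsViscosity μ α₁ α₂) (hinf : InfinityBehaviour μ) {s₁ : ℝ}
    (hs₁ : 0 < s₁) : ∃ c : ℝ, 0 < c ∧ ∀ s, s₁ ≤ s → c * s ≤ μ s := by
  obtain ⟨S, c, hS, hc, hfar⟩ : ∃ S c : ℝ, 0 < S ∧ 0 < c ∧ ∀ s, S ≤ s → c * s ≤ μ s := by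
    rcases hinf with ⟨β, hβ, -, hlim⟩ | ⟨M, hM, hM'⟩
    · obtain ⟨S, hS⟩ := eventually_atTop.1 (hlim.eventually_const_le hβ)
      refine ⟨max S 1, μ (max S 1) / max S 1, by positivity,
        div_pos (h.pos (by positivity)) (by positivity), fun s hs => ?_⟩
      have h0 : 0 < max S 1 := by positivity
      have h1 := h.mul_rpow_le_mul_rpow (p := 1) h0 hs fun t ht => by
        have h2 := hS t ((le_max_left _ _).trans ht.1)
        rwa [le_div_iff₀ (h.pos (h0.trans_le ht.1))] at h2
      rw [Real.rpow_one, Real.rpow_one] at h1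
      rwa [div_mul_eq_mul_div, div_le_iff₀ h0]
    · exact ⟨M, 1, hM, one_pos, fun s hs => by rw [hM' s hs, one_mul]⟩
  refine ⟨min c (μ s₁ / S), lt_min hc (div_pos (h.pos hs₁) hS), fun s hs => ?_⟩
  have hs0 : 0 < s := hs₁.trans_le hs
  rcases le_total S s with h1 | h1
  · exact (mul_le_mul_of_nonneg_right (min_le_left _ _) hs0.le).trans (hfar s h1)
  · calc min c (μ s₁ / S) * s ≤ μ s₁ / S * S :=
          mul_le_mul (min_le_right _ _) h1 hs0.le (div_pos (h.pos hs₁) hS).le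
      _ = μ s₁ := by field_simp
      _ ≤ μ s := h.strictMonoOn.monotoneOn hs₁ hs0 hs

/-- For each density, either the viscosity dominates the density, or `μ'` is dominated by the
second derivative of the pressure potential (up to a factor `s`). This is where the
alternative in the behaviour near vacuum is used. -/
lemma exists_le_or_deriv_le (h : IsViscosity μ α₁ α₂) {γ α : ℝ}
    (hvac : VacuumBehaviour μ γ α) (hinf : InfinityBehaviour μ) :
    ∃ C : ℝ, 0 < C ∧ ∀ s, 0 < s → s ≤ C * μ s ∨ deriv μ s ≤ C * s ^ (γ - 1) := by
  obtain ⟨s₁, C, hs₁, hC, hnear⟩ : ∃ s₁ C : ℝ, 0 < s₁ ∧ 0 < C ∧ ∀ s, 0 < s → s ≤ s₁ →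
      s ≤ C * μ s ∨ deriv μ s ≤ C * s ^ (γ - 1) := by
    obtain ⟨hlim, -, -, (hα | ⟨s₀, c, hs₀, hc, hsc⟩) | ⟨-, hγ⟩⟩ := hvac
    · obtain ⟨s₁, hs₁, hb⟩ := mem_nhdsGT_iff_exists_Ioc_subset.1 (hlim.eventually_le_const hα)
      have hs₁' : 0 < s₁ := hs₁
      refine ⟨s₁, s₁ / μ s₁, hs₁, div_pos hs₁ (h.pos hs₁), fun s hs hle => Or.inl ?_⟩
      have h1 := h.mul_rpow_le_mul_rpow' (p := 1) hs hle fun t ht => by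
        have ht0 : 0 < t := hs.trans_le ht.1
        have h2 : t * deriv μ t / μ t ≤ 1 := hb ⟨ht0, ht.2⟩
        rwa [div_le_iff₀ (h.pos ht0)] at h2
      rw [Real.rpow_one, Real.rpow_one] at h1
      rw [div_mul_eq_mul_div, le_div_iff₀ (h.pos hs₁)]
      linarith
    · refine ⟨s₀ / 2, 1 / c, half_pos hs₀, by positivity, fun s hs hle => Or.inl ?_⟩
      rw [one_div, le_inv_mul_iff₀ hc]
      exact hsc s hs (by linarith)
    · obtain ⟨s₁, hs₁, hb⟩ := mem_nhdsGT_iff_exists_Ioc_subset.1 (hlim.eventually_const_le hγ)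
      have hs₁' : 0 < s₁ := hs₁
      have hK : 0 < α₂ * (μ s₁ / s₁ ^ γ) :=
        mul_pos h.alpha₂_pos (div_pos (h.pos hs₁) (by positivity))
      refine ⟨s₁, _, hs₁, hK, fun s hs hle => Or.inr ?_⟩
      have h1 := h.mul_rpow_le_mul_rpow (p := γ) hs hle fun t ht => by
        have ht0 : 0 < t := hs.trans_le ht.1
        have h2 : γ ≤ t * deriv μ t / μ t := hb ⟨ht0, ht.2⟩
        rwa [le_div_iff₀ (h.pos ht0)] at h2
      have h3 : μ s ≤ μ s₁ / s₁ ^ γ * s ^ γ := by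
        rw [div_mul_eq_mul_div, le_div_iff₀ (by positivity)]
        exact h1
      have h4 : deriv μ s * s ≤ α₂ * (μ s₁ / s₁ ^ γ) * s ^ (γ - 1) * s := by
        rw [mul_assoc, ← Real.rpow_add_one hs.ne', sub_add_cancel]
        have := h.mul_deriv_le hs
        have h5 := mul_le_mul_of_nonneg_left h3 h.alpha₂_pos.le
        linarith
      exact le_of_mul_le_mul_right h4 hs
  obtain ⟨c, hc, hfar⟩ := h.exists_mul_le hinf hs₁
  refine ⟨max C (1 / c), by positivity, fun s hs => ?_⟩
  rcases le_total s s₁ with h1 | h1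
  · refine (hnear s hs h1).imp (fun h2 => ?_) fun h2 => ?_
    · exact h2.trans (mul_le_mul_of_nonneg_right (le_max_left _ _) (h.pos hs).le)
    · exact h2.trans (mul_le_mul_of_nonneg_right (le_max_left _ _) (by positivity))
  · left
    have h2 : s ≤ 1 / c * μ s := by
      rw [one_div, le_inv_mul_iff₀ hc]
      exact hfar s h1
    exact h2.trans (mul_le_mul_of_nonneg_right (le_max_right _ _) (h.pos hs).le)

/-- The derivative `√μ(s) μ'(s) / s` of `Z`. -/
lemma contDiffOn_bigZ_deriv (h : IsViscosity μ α₁ α₂) :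
    ContDiffOn ℝ 1 (fun s => Real.sqrt (μ s) * deriv μ s / s) (Ioi 0) :=
  ((h.contDiffOn_one.sqrt fun _ hs => (h.pos hs).ne').mul h.contDiffOn_deriv).div contDiffOn_id
    fun _ hs => ne_of_gt hs

lemma bigZ_deriv_pos (h : IsViscosity μ α₁ α₂) (hs : 0 < s) :
    0 < Real.sqrt (μ s) * deriv μ s / s :=
  div_pos (mul_pos (Real.sqrt_pos.2 (h.pos hs)) (h.deriv_pos hs)) hs

lemma intervalIntegrable_bigZ (h : IsViscosity μ α₁ α₂) {a : ℝ} (ha : 0 ≤ a) (hs : 0 < s) :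
    IntervalIntegrable (fun s => Real.sqrt (μ s) * deriv μ s / s) volume a s := by
  have hcont := h.contDiffOn_bigZ_deriv.continuousOn
  -- near vacuum the integrand is bounded by a multiple of `s ^ (3 α₁ / 2 - 2)`
  have h01 : IntervalIntegrable (fun s => Real.sqrt (μ s) * deriv μ s / s) volume 0 1 := by
    have hmaj : IntervalIntegrable
        (fun s : ℝ => Real.sqrt (μ 1) * (α₂ * μ 1) * s ^ (3 / 2 * α₁ - 2)) volume 0 1 :=
      (intervalIntegral.intervalIntegrable_rpow' (by linarith [h.alpha_lt.1])).const_mul _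
    rw [intervalIntegrable_iff_integrableOn_Ioc_of_le zero_le_one] at hmaj ⊢
    refine hmaj.mono' ((hcont.mono fun x hx => hx.1).aestronglyMeasurable measurableSet_Ioc) ?_
    refine (ae_restrict_iff' measurableSet_Ioc).2 (Eventually.of_forall fun s hs => ?_)
    have hs0 : 0 < s := hs.1
    rw [Real.norm_of_nonneg (h.bigZ_deriv_pos hs0).le]
    have h1 := h.le_rpow hs0 hs.2
    have h2 : Real.sqrt (μ s) ≤ Real.sqrt (μ 1) * s ^ (α₁ / 2) := by
      have := Real.sqrt_le_sqrt h1
      rwa [Real.sqrt_mul (h.pos one_pos).le, Real.sqrt_eq_rpow (s ^ α₁), ← Real.rpow_mul hs0.le,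
        mul_one_div] at this
    have h3 : deriv μ s ≤ α₂ * μ 1 * s ^ (α₁ - 1) := by
      have h4 : deriv μ s * s ≤ α₂ * μ 1 * s ^ (α₁ - 1) * s := by
        rw [mul_assoc _ (s ^ (α₁ - 1)), ← Real.rpow_add_one hs0.ne', sub_add_cancel]
        have := h.mul_deriv_le hs0
        have h5 := mul_le_mul_of_nonneg_left h1 h.alpha₂_pos.le
        linarith
      exact le_of_mul_le_mul_right h4 hs0
    rw [div_le_iff₀ hs0]
    calc Real.sqrt (μ s) * deriv μ s
        ≤ (Real.sqrt (μ 1) * s ^ (α₁ / 2)) * (α₂ * μ 1 * s ^ (α₁ - 1)) :=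
          mul_le_mul h2 h3 (h.deriv_pos hs0).le (by positivity)
      _ = Real.sqrt (μ 1) * (α₂ * μ 1) * (s ^ (α₁ / 2) * s ^ (α₁ - 1)) := by ring
      _ = Real.sqrt (μ 1) * (α₂ * μ 1) * (s ^ (3 / 2 * α₁ - 2) * s) := by
        rw [← Real.rpow_add hs0, ← Real.rpow_add_one hs0.ne']
        congr 2
        ring
      _ = _ := by ring
  have hpos : ∀ {a b : ℝ}, 0 < a → 0 < b →
      IntervalIntegrable (fun s => Real.sqrt (μ s) * deriv μ s / s) volume a b := fun ha hb =>
    (hcont.mono fun x hx => (lt_min ha hb).trans_le hx.1).intervalIntegrable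
  rcases ha.eq_or_lt with rfl | ha
  · exact h01.trans (hpos one_pos hs)
  · exact hpos ha hs

lemma hasDerivAt_bigZ (h : IsViscosity μ α₁ α₂) (hs : 0 < s) :
    HasDerivAt (bigZ μ) (Real.sqrt (μ s) * deriv μ s / s) s :=
  intervalIntegral.integral_hasDerivAt_right (h.intervalIntegrable_bigZ le_rfl hs)
    (h.contDiffOn_bigZ_deriv.continuousOn.stronglyMeasurableAtFilter isOpen_Ioi s hs)
    (h.contDiffOn_bigZ_deriv.continuousOn.continuousAt (Ioi_mem_nhds hs))

lemma contDiffOn_bigZ (h : IsViscosity μ α₁ α₂) : ContDiffOn ℝ 2 (bigZ μ) (Ioi 0) := by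
  have h2 : (2 : WithTop ℕ∞) = 1 + 1 := by norm_num
  rw [h2, contDiffOn_succ_iff_deriv_of_isOpen isOpen_Ioi]
  refine ⟨fun s hs => (h.hasDerivAt_bigZ hs).differentiableAt.differentiableWithinAt, by simp,
    h.contDiffOn_bigZ_deriv.congr fun s hs => (h.hasDerivAt_bigZ hs).deriv⟩

lemma hasDerivAt_sFun (h : IsViscosity μ α₁ α₂) (hs : 0 < s) :
    HasDerivAt (sFun μ) (deriv μ s / s) s :=
  hasDerivAt_primitive (f := fun τ => deriv μ τ / τ)
    (h.contDiffOn_deriv.continuousOn.div continuousOn_id fun _ hs => ne_of_gt hs) one_pos hs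

/-- The relative potential of the viscosity is controlled by the increments of `Z`. -/
lemma exists_relative_smallh_le (h : IsViscosity μ α₁ α₂) {r : ℝ} (hr : 0 < r) :
    ∃ C : ℝ, 0 < C ∧ ∀ s, 0 < s →
      relative (smallh μ) s r ≤ C * ((1 + s) * (bigZ μ s - bigZ μ r) ^ 2) := by
  have h0 : ∀ s, 0 < s → 0 ≤ μ s := fun s hs => (h.pos hs).le
  have h1 : ∀ s, 0 < s → 0 ≤ deriv μ s := fun s hs => (h.deriv_pos hs).le
  have h2r : 0 < 2 * r := by positivity
  obtain ⟨C₁, hC₁, hnear⟩ := exists_relative_potential_le_near h.contDiffOn_one h0 h1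
    (fun s hs => h.hasDerivAt_bigZ hs) h.contDiffOn_bigZ_deriv.continuousOn
    (fun s hs => h.bigZ_deriv_pos hs) hr
  obtain ⟨C₂, hC₂, hfar⟩ := exists_relative_potential_le_far h.contDiffOn_one h1
    (fun s hs => h.hasDerivAt_bigZ hs) (fun s hs => h.bigZ_deriv_pos hs) hr
    (C₁ := 1 / Real.sqrt (μ (2 * r))) (by positivity) (fun s hs => by
      have hs0 : 0 < s := h2r.trans_le hs
      have h3 : Real.sqrt (μ (2 * r)) ≤ Real.sqrt (μ s) :=
        Real.sqrt_le_sqrt (h.strictMonoOn.monotoneOn h2r hs0 hs)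
      have h4 : 0 < Real.sqrt (μ (2 * r)) := Real.sqrt_pos.2 (h.pos h2r)
      rw [one_div, le_inv_mul_iff₀ h4, mul_div_assoc]
      exact mul_le_mul_of_nonneg_right h3 (div_nonneg (h1 s hs0) hs0.le))
  refine ⟨C₁ + C₂, by positivity, fun s hs => ?_⟩
  have hq := sq_nonneg (bigZ μ s - bigZ μ r)
  have hcross : (C₁ + C₂) * ((1 + s) * (bigZ μ s - bigZ μ r) ^ 2) =
      C₁ * (bigZ μ s - bigZ μ r) ^ 2 + C₂ * (s * (bigZ μ s - bigZ μ r) ^ 2) +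
      (C₁ * s + C₂) * (bigZ μ s - bigZ μ r) ^ 2 := by ring
  have e1 : 0 ≤ C₁ * (bigZ μ s - bigZ μ r) ^ 2 := by positivity
  have e2 : 0 ≤ C₂ * (s * (bigZ μ s - bigZ μ r) ^ 2) := by positivity
  have e3 : 0 ≤ (C₁ * s + C₂) * (bigZ μ s - bigZ μ r) ^ 2 := by positivity
  rw [hcross]
  rcases le_total s (2 * r) with hle | hle
  · have := hnear s hs hle
    unfold smallh
    linarith
  · have := hfar s hle
    unfold smallh
    linarith

end IsViscosity

section Pressure

variable {a γ s : ℝ}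

lemma contDiffOn_pres (a γ : ℝ) : ContDiffOn ℝ 1 (pres a γ) (Ioi 0) :=
  contDiffOn_const.mul (contDiffOn_id.rpow_const_of_ne fun _ hs => ne_of_gt hs)

lemma hasDerivAt_pres (a γ : ℝ) (hs : 0 < s) :
    HasDerivAt (pres a γ) (a * (γ * s ^ (γ - 1))) s :=
  (Real.hasDerivAt_rpow_const (Or.inl hs.ne')).const_mul a

lemma pres_nonneg (ha : 0 < a) (hs : 0 < s) : 0 ≤ pres a γ s := by unfold pres; positivity

lemma deriv_pres_nonneg (ha : 0 < a) (hγ : 1 ≤ γ) (hs : 0 < s) : 0 ≤ deriv (pres a γ) s := by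
  rw [(hasDerivAt_pres a γ hs).deriv]
  have : 0 ≤ γ := by linarith
  positivity

lemma deriv_pres_div (a γ : ℝ) (hs : 0 < s) : deriv (pres a γ) s / s = a * γ * s ^ (γ - 2) := by
  rw [(hasDerivAt_pres a γ hs).deriv, div_eq_iff hs.ne', mul_assoc (a * γ),
    ← Real.rpow_add_one hs.ne', mul_assoc]
  congr 3
  ring

lemma deriv_deriv_bigH (a γ : ℝ) (hs : 0 < s) :
    deriv (deriv (bigH a γ)) s = a * γ * s ^ (γ - 2) := by
  rw [bigH, deriv_deriv_potential (contDiffOn_pres a γ) hs, deriv_pres_div a γ hs]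

end Pressure

/-- A primitive of `√(μ'(s) s^(γ-2))`: the dissipation `μ'(ρ) H''(ρ) |∇ρ|²` is a multiple of the
squared gradient of this function of `ρ`. -/
def bigF (μ : ℝ → ℝ) (γ s : ℝ) : ℝ := ∫ τ in (1 : ℝ)..s, Real.sqrt (deriv μ τ * τ ^ (γ - 2))

namespace IsViscosity

variable {μ : ℝ → ℝ} {α₁ α₂ : ℝ} {s : ℝ}

lemma contDiffOn_bigF_deriv (h : IsViscosity μ α₁ α₂) (γ : ℝ) :
    ContDiffOn ℝ 1 (fun s => Real.sqrt (deriv μ s * s ^ (γ - 2))) (Ioi 0) :=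
  (h.contDiffOn_deriv.mul (contDiffOn_id.rpow_const_of_ne fun _ hs => ne_of_gt hs)).sqrt
    fun _ hs => (mul_pos (h.deriv_pos hs) (Real.rpow_pos_of_pos hs _)).ne'

lemma hasDerivAt_bigF (h : IsViscosity μ α₁ α₂) (γ : ℝ) (hs : 0 < s) :
    HasDerivAt (bigF μ γ) (Real.sqrt (deriv μ s * s ^ (γ - 2))) s :=
  hasDerivAt_primitive (h.contDiffOn_bigF_deriv γ).continuousOn one_pos hs

lemma contDiffOn_bigF (h : IsViscosity μ α₁ α₂) (γ : ℝ) : ContDiffOn ℝ 1 (bigF μ γ) (Ioi 0) := by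
  have h2 : (1 : WithTop ℕ∞) = 0 + 1 := by norm_num
  rw [h2, contDiffOn_succ_iff_deriv_of_isOpen isOpen_Ioi]
  refine ⟨fun s hs => (h.hasDerivAt_bigF γ hs).differentiableAt.differentiableWithinAt, by simp,
    ((h.contDiffOn_bigF_deriv γ).of_le (by simp)).congr fun s hs => (h.hasDerivAt_bigF γ hs).deriv⟩

lemma strictMonoOn_bigZ (h : IsViscosity μ α₁ α₂) : StrictMonoOn (bigZ μ) (Ioi 0) :=
  strictMonoOn_of_deriv_pos (convex_Ioi 0)
    (fun s hs => (h.hasDerivAt_bigZ hs).continuousAt.continuousWithinAt) fun s hs => by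
      rw [(h.hasDerivAt_bigZ (interior_subset hs)).deriv]
      exact h.bigZ_deriv_pos (interior_subset hs)

lemma exists_le_deriv (h : IsViscosity μ α₁ α₂) (hinf : InfinityBehaviour μ) {s₁ : ℝ}
    (hs₁ : 0 < s₁) : ∃ c : ℝ, 0 < c ∧ ∀ s, s₁ ≤ s → c ≤ deriv μ s := by
  obtain ⟨c, hc, hfar⟩ := h.exists_mul_le hinf hs₁
  refine ⟨α₁ * c, mul_pos h.alpha₁_pos hc, fun s hs => ?_⟩
  have hs0 : 0 < s := hs₁.trans_le hs
  have h1 := h.le_mul_deriv hs0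
  have h2 := mul_le_mul_of_nonneg_left (hfar s hs) h.alpha₁_pos.le
  have h3 : α₁ * c * s ≤ deriv μ s * s := by linarith
  exact le_of_mul_le_mul_right h3 hs0

/-- The relative pressure potential is controlled by the increments of `Z` and, for large
densities, of `bigF`. If `γ = 1` the function `Z` suffices; if `γ > 1` then `H(s|r)` grows like
`s^γ`, and `bigF` at least like `s^(γ/2)`. -/
lemma exists_relative_bigH_le (h : IsViscosity μ α₁ α₂) (hinf : InfinityBehaviour μ) {a γ r : ℝ}
    (ha : 0 < a) (hγ : 1 ≤ γ) (hr : 0 < r) :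
    ∃ C : ℝ, 0 < C ∧ ∀ s, 0 < s →
      relative (bigH a γ) s r ≤ C * ((1 + s) * (bigZ μ s - bigZ μ r) ^ 2 +
        max 0 (bigF μ γ s - bigF μ γ (2 * r)) ^ 2) := by
  have h0 : ∀ s, 0 < s → 0 ≤ pres a γ s := fun s hs => pres_nonneg ha hs
  have h1 : ∀ s, 0 < s → 0 ≤ deriv (pres a γ) s := fun s hs => deriv_pres_nonneg ha hγ hs
  have h2r : 0 < 2 * r := by positivity
  obtain ⟨C₁, hC₁, hnear⟩ := exists_relative_potential_le_near (contDiffOn_pres a γ) h0 h1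
    (fun s hs => h.hasDerivAt_bigZ hs) h.contDiffOn_bigZ_deriv.continuousOn
    (fun s hs => h.bigZ_deriv_pos hs) hr
  obtain ⟨c, hc, hcμ⟩ := h.exists_le_deriv hinf h2r
  -- the far field
  obtain ⟨C₂, hC₂, hfar⟩ : ∃ C : ℝ, 0 < C ∧ ∀ s, 2 * r ≤ s →
      relative (bigH a γ) s r ≤ C * ((1 + s) * (bigZ μ s - bigZ μ r) ^ 2 +
        max 0 (bigF μ γ s - bigF μ γ (2 * r)) ^ 2) := by
    rcases hγ.eq_or_lt with rfl | hγ1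
    · obtain ⟨C₂, hC₂, hfar⟩ := exists_relative_potential_le_far (contDiffOn_pres a 1) h1
        (fun s hs => h.hasDerivAt_bigZ hs) (fun s hs => h.bigZ_deriv_pos hs) hr
        (C₁ := a / (Real.sqrt (μ (2 * r)) * c)) (by positivity) (fun s hs => by
          have hs0 : 0 < s := h2r.trans_le hs
          have h3 : Real.sqrt (μ (2 * r)) ≤ Real.sqrt (μ s) :=
            Real.sqrt_le_sqrt (h.strictMonoOn.monotoneOn h2r hs0 hs)
          have h4 : 0 < Real.sqrt (μ (2 * r)) := Real.sqrt_pos.2 (h.pos h2r)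
          rw [(hasDerivAt_pres a 1 hs0).deriv, ← mul_div_assoc]
          refine div_le_div_of_nonneg_right ?_ hs0.le
          simp only [sub_self, Real.rpow_zero, mul_one]
          rw [div_mul_eq_mul_div, le_div_iff₀ (by positivity)]
          exact mul_le_mul_of_nonneg_left
            (mul_le_mul h3 (hcμ s hs) hc.le (Real.sqrt_nonneg _)) ha.le)
      refine ⟨C₂, hC₂, fun s hs => (hfar s hs).trans ?_⟩
      refine mul_le_mul_of_nonneg_left ?_ hC₂.le
      nlinarith [sq_nonneg (bigZ μ s - bigZ μ r), sq_nonneg (max 0 (bigF μ 1 s - bigF μ 1 (2 * r)))]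
    · set K := a * γ / (γ - 1)
      have hγ1' : 0 < γ - 1 := by linarith
      have hK : 0 < K := by positivity
      set z := bigZ μ (2 * r) - bigZ μ r with hz_def
      have hz : 0 < z := sub_pos.2
        (h.strictMonoOn_bigZ (mem_Ioi.2 hr) (mem_Ioi.2 h2r) (by linarith))
      set D := γ / 2 / Real.sqrt c
      have hsc : 0 < Real.sqrt c := Real.sqrt_pos.2 hc
      have hD : 0 < D := by positivity
      refine ⟨K * (2 * (2 * r) ^ γ / z ^ 2 + 2 * D ^ 2), by positivity, fun s hs => ?_⟩
      have hs0 : 0 < s := h2r.trans_le hs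
      have e1 := sub_le_mul_sub_of_deriv_le (g := potentialDeriv (pres a γ))
        (g' := fun s => deriv (pres a γ) s / s) (Z := fun s : ℝ => s ^ (γ - 1))
        (Z' := fun s => (γ - 1) * s ^ (γ - 1 - 1)) (a := r) (b := s) (C := K) (by linarith)
        (fun t ht => hasDerivAt_potentialDeriv (contDiffOn_pres a γ) (hr.trans_le ht.1))
        (fun t ht => Real.hasDerivAt_rpow_const (Or.inl (hr.trans_le ht.1).ne'))
        (fun t ht => by
          rw [deriv_pres_div a γ (hr.trans_le ht.1), ← mul_assoc]
          refine le_of_eq ?_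
          simp only [K]
          rw [div_mul_cancel₀ _ hγ1'.ne']
          congr 2
          ring)
      have e2 : potentialDeriv (pres a γ) s - potentialDeriv (pres a γ) r ≤ K * s ^ (γ - 1) := by
        have : 0 ≤ K * r ^ (γ - 1) := by positivity
        linarith
      have e3 : relative (bigH a γ) s r ≤ K * s ^ γ := by
        calc relative (bigH a γ) s r
            ≤ (potentialDeriv (pres a γ) s - potentialDeriv (pres a γ) r) * (s - r) :=
              relative_potential_le_mul (contDiffOn_pres a γ) h1 hs0 hr
          _ ≤ K * s ^ (γ - 1) * s :=
              mul_le_mul e2 (by linarith) (by linarith) (by positivity)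
          _ = K * s ^ γ := by
              rw [mul_assoc, ← Real.rpow_add_one hs0.ne', sub_add_cancel]
      have e4 := sub_le_mul_sub_of_deriv_le (g := fun s : ℝ => s ^ (γ / 2))
        (g' := fun s => γ / 2 * s ^ (γ / 2 - 1)) (Z := bigF μ γ)
        (Z' := fun s => Real.sqrt (deriv μ s * s ^ (γ - 2))) (C := D) hs
        (fun t ht => Real.hasDerivAt_rpow_const (Or.inl (h2r.trans_le ht.1).ne'))
        (fun t ht => h.hasDerivAt_bigF γ (h2r.trans_le ht.1))
        (fun t ht => by
          have ht0 : 0 < t := h2r.trans_le ht.1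
          have e5 : Real.sqrt (t ^ (γ - 2)) = t ^ (γ / 2 - 1) := by
            rw [Real.sqrt_eq_rpow, ← Real.rpow_mul ht0.le]
            congr 1
            ring
          rw [Real.sqrt_mul (h.deriv_pos ht0).le, e5, ← mul_assoc]
          refine mul_le_mul_of_nonneg_right ?_ (by positivity)
          simp only [D]
          rw [div_mul_eq_mul_div, le_div_iff₀ hsc]
          exact mul_le_mul_of_nonneg_left (Real.sqrt_le_sqrt (hcμ t ht.1)) (by positivity))
      have hhalf : ∀ t : ℝ, 0 < t → (t ^ (γ / 2)) ^ 2 = t ^ γ := by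
        intro t ht
        rw [← Real.rpow_natCast, ← Real.rpow_mul ht.le]
        congr 1
        push_cast
        ring
      set f := max 0 (bigF μ γ s - bigF μ γ (2 * r)) with hf_def
      have e6 : s ^ (γ / 2) ≤ (2 * r) ^ (γ / 2) + D * f := by
        have := mul_le_mul_of_nonneg_left (le_max_right 0 (bigF μ γ s - bigF μ γ (2 * r))) hD.le
        linarith
      have e7 : s ^ γ ≤ 2 * (2 * r) ^ γ + 2 * D ^ 2 * f ^ 2 := by
        rw [← hhalf s hs0, ← hhalf _ h2r]
        have h7 : (s ^ (γ / 2)) ^ 2 ≤ ((2 * r) ^ (γ / 2) + D * f) ^ 2 := by gcongr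
        nlinarith [sq_nonneg ((2 * r) ^ (γ / 2) - D * f)]
      have e8 : 2 * (2 * r) ^ γ ≤ 2 * (2 * r) ^ γ / z ^ 2 * ((1 + s) *
          (bigZ μ s - bigZ μ r) ^ 2) := by
        have h8 : z ≤ bigZ μ s - bigZ μ r := by
          have := h.strictMonoOn_bigZ.monotoneOn (mem_Ioi.2 h2r) (mem_Ioi.2 hs0) hs
          linarith
        have h9 : z ^ 2 ≤ (bigZ μ s - bigZ μ r) ^ 2 := by gcongr
        have h10 : z ^ 2 ≤ (1 + s) * (bigZ μ s - bigZ μ r) ^ 2 := by nlinarith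
        calc 2 * (2 * r) ^ γ = 2 * (2 * r) ^ γ / z ^ 2 * z ^ 2 := by field_simp
          _ ≤ _ := by gcongr
      refine e3.trans ?_
      rw [mul_assoc K]
      refine mul_le_mul_of_nonneg_left ?_ hK.le
      set X := (1 + s) * (bigZ μ s - bigZ μ r) ^ 2
      have hX : 0 ≤ X := by positivity
      have h11 : 0 ≤ 2 * D ^ 2 * X := by positivity
      have h12 : 0 ≤ 2 * (2 * r) ^ γ / z ^ 2 * f ^ 2 := by positivity
      linarith
  refine ⟨C₁ + C₂, by positivity, fun s hs => ?_⟩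
  set X := (1 + s) * (bigZ μ s - bigZ μ r) ^ 2 + max 0 (bigF μ γ s - bigF μ γ (2 * r)) ^ 2
    with hX
  have hX0 : (bigZ μ s - bigZ μ r) ^ 2 ≤ X := by
    have := mul_nonneg hs.le (sq_nonneg (bigZ μ s - bigZ μ r))
    nlinarith [sq_nonneg (max 0 (bigF μ γ s - bigF μ γ (2 * r)))]
  have hX1 : 0 ≤ X := (sq_nonneg _).trans hX0
  rcases le_total s (2 * r) with hle | hle
  · have := hnear s hs hle
    have h3 := mul_le_mul_of_nonneg_left hX0 hC₁.le
    unfold bigH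
    nlinarith
  · have := hfar s hle
    nlinarith

end IsViscosity

/-! ### The dissipation controls the relative entropy -/

/-- A Poincaré inequality for the part of `f` above a level that is not exceeded on at least half
of the torus. -/
lemma integral_truncation_sq_le {f : T3 → ℝ} (hf : IsCn 1 f) {K : ℝ}
    (hK : 1 / 2 ≤ vol.real {x | f x ≤ K}) :
    ∫ x, max 0 (f x - K) ^ 2 ∂vol ≤ 6 * ∫ x, ∑ i, pd i f x ^ 2 ∂vol := by
  set m := ∫ y, f y ∂vol
  have hp := poincare hf
  have hc := hf.continuous
  have hi : Integrable (fun x => (f x - m) ^ 2) vol := integrable_of_continuous (by fun_prop)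
  set V := ∫ x, (f x - m) ^ 2 ∂vol
  -- the mean exceeds the level by at most a multiple of the standard deviation
  have h1 : max 0 (m - K) ^ 2 ≤ 2 * V := by
    rcases le_total m K with h | h
    · rw [max_eq_left (by linarith)]
      have : 0 ≤ V := integral_nonneg fun x => sq_nonneg _
      linarith
    · rw [max_eq_right (by linarith)]
      have h2 := mul_meas_ge_le_integral_of_nonneg (μ := vol)
        (Eventually.of_forall fun x => sq_nonneg (f x - m)) hi ((m - K) ^ 2)
      have h3 : vol.real {x | f x ≤ K} ≤ vol.real {x | (m - K) ^ 2 ≤ (f x - m) ^ 2} := by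
        refine measureReal_mono fun x hx => ?_
        have hx' : f x ≤ K := hx
        change (m - K) ^ 2 ≤ (f x - m) ^ 2
        nlinarith
      have h4 : (m - K) ^ 2 * (1 / 2) ≤
          (m - K) ^ 2 * vol.real {x | (m - K) ^ 2 ≤ (f x - m) ^ 2} :=
        mul_le_mul_of_nonneg_left (hK.trans h3) (sq_nonneg _)
      linarith
  have h2 : ∀ x, max 0 (f x - K) ^ 2 ≤ 2 * (f x - m) ^ 2 + 2 * max 0 (m - K) ^ 2 := by
    intro x
    rcases le_total (f x) K with h | h
    · rw [max_eq_left (by linarith), zero_pow two_ne_zero]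
      positivity
    · rw [max_eq_right (sub_nonneg.2 h)]
      have h5 : f x - K ≤ |f x - m| + max 0 (m - K) := by
        linarith [le_abs_self (f x - m), le_max_right 0 (m - K)]
      have h6 : (f x - K) ^ 2 ≤ (|f x - m| + max 0 (m - K)) ^ 2 :=
        pow_le_pow_left₀ (sub_nonneg.2 h) h5 2
      nlinarith [sq_nonneg (|f x - m| - max 0 (m - K)), sq_abs (f x - m)]
  have h3 : ∫ x, max 0 (f x - K) ^ 2 ∂vol ≤
      ∫ x, (2 * (f x - m) ^ 2 + 2 * max 0 (m - K) ^ 2) ∂vol :=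
    integral_mono (integrable_of_continuous (by fun_prop)) (integrable_of_continuous (by fun_prop)) h2
  rw [integral_add (hi.const_mul 2) (integrable_const _), integral_const_mul] at h3
  simp only [integral_const, probReal_univ, smul_eq_mul, one_mul] at h3
  have h4 : ∫ x, (f x - m) ^ 2 ∂vol = V := rfl
  linarith

lemma continuous_comp_of_pos {G : ℝ → ℝ} (hG : ContinuousOn G (Ioi 0)) {ρ : T3 → ℝ}
    (hρ : Continuous ρ) (hpos : ∀ x, 0 < ρ x) : Continuous fun x => G (ρ x) :=
  hG.comp_continuous hρ hpos

lemma continuousOn_relative_potential {f : ℝ → ℝ} (hf : ContinuousOn f (Ioi 0)) (r : ℝ) :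
    ContinuousOn (fun s => relative (potential f) s r) (Ioi 0) := by
  have h : ContinuousOn (potential f) (Ioi 0) := fun s hs =>
    (hasDerivAt_potential hf hs).continuousAt.continuousWithinAt
  unfold relative
  fun_prop

section State

variable {μ : ℝ → ℝ} {α₁ α₂ : ℝ} {ρ : T3 → ℝ}

lemma vClassical_apply (h : IsViscosity μ α₁ α₂) (hρ : IsCn 1 ρ) (hpos : ∀ x, 0 < ρ x)
    (x : T3) (i : Fin 3) : vClassical μ ρ x i = 2 * (deriv μ (ρ x) / ρ x * pd i ρ x) := by
  rw [vClassical, pd_comp hρ i x (h.hasDerivAt_sFun (hpos x))]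

lemma continuous_vClassical (h : IsViscosity μ α₁ α₂) (hρ : IsCn 1 ρ) (hpos : ∀ x, 0 < ρ x)
    (i : Fin 3) : Continuous fun x => vClassical μ ρ x i := by
  simp only [vClassical_apply h hρ hpos]
  have h1 : ContinuousOn (fun s => deriv μ s / s) (Ioi 0) :=
    h.contDiffOn_deriv.continuousOn.div continuousOn_id fun _ hs => ne_of_gt hs
  exact continuous_const.mul ((continuous_comp_of_pos h1 hρ.continuous hpos).mul
    (continuous_pd hρ i))

lemma continuous_sq3 {v : T3 → Vec} (hv : ∀ i, Continuous fun x => v x i) :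
    Continuous fun x => sq3 (v x) :=
  continuous_finsetSum _ fun i _ => (hv i).pow 2

lemma sq3_nonneg (v : Vec) : 0 ≤ sq3 v := Finset.sum_nonneg fun _ _ => sq_nonneg _

lemma sum_pd_comp_sq {G G' : ℝ → ℝ} (hG : ∀ s, 0 < s → HasDerivAt G (G' s) s) (hρ : IsCn 1 ρ)
    (hpos : ∀ x, 0 < ρ x) (x : T3) :
    ∑ i, pd i (fun y => G (ρ y)) x ^ 2 = G' (ρ x) ^ 2 * sq3 fun i => pd i ρ x := by
  simp only [pd_comp hρ _ x (hG _ (hpos x)), mul_pow, ← Finset.mul_sum, sq3]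

lemma continuous_relDensity {P : Params} (h : IsViscosity P.μ α₁ α₂) (θ r : ℝ) {u : T3 → Vec}
    (hρ : IsCn 1 ρ) (hpos : ∀ x, 0 < ρ x) (hu : Continuous u) :
    Continuous fun x => relDensity P θ r (ρ x) (u x) (vClassical P.μ ρ x) := by
  have hv := continuous_vClassical h hρ hpos
  have hu' : ∀ i, Continuous fun x => u x i := fun i => (continuous_apply i).comp hu
  have h1 : Continuous fun x => sq3 (vClassical P.μ ρ x) := continuous_sq3 hv
  have h2 : Continuous fun x => sq3 (wVel P.κ (u x) (vClassical P.μ ρ x)) :=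
    continuous_sq3 fun i => (hu' i).add (continuous_const.mul (hv i))
  have h3 := continuous_comp_of_pos
    (continuousOn_relative_potential (contDiffOn_pres P.a P.γ).continuousOn r) hρ.continuous hpos
  have h4 := continuous_comp_of_pos
    (continuousOn_relative_potential h.contDiffOn_one.continuousOn r) hρ.continuous hpos
  have h5 := hρ.continuous
  unfold relDensity bigH smallh
  fun_prop

lemma sq3_wVel_le (κ : ℝ) (u v : Vec) : sq3 (wVel κ u v) ≤ 2 * sq3 u + 2 * κ ^ 2 * sq3 v := by
  simp only [sq3, wVel, Finset.mul_sum, ← Finset.sum_add_distrib]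
  refine Finset.sum_le_sum fun i _ => ?_
  nlinarith [sq_nonneg (u i - κ * v i)]

/-- The kinetic part `ρ |v|²` is controlled by `|∇Z(ρ)|²` where the viscosity dominates the
density, and by the pressure dissipation elsewhere. -/
lemma exists_mul_sq3_vClassical_le (h : IsViscosity μ α₁ α₂) {γ α : ℝ}
    (hvac : VacuumBehaviour μ γ α) (hinf : InfinityBehaviour μ) :
    ∃ C : ℝ, 0 < C ∧ ∀ ρ : T3 → ℝ, IsCn 1 ρ → (∀ x, 0 < ρ x) → ∀ x,
      ρ x * sq3 (vClassical μ ρ x) ≤ C * (∑ i, pd i (fun y => bigZ μ (ρ y)) x ^ 2 +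
        ∑ i, pd i (fun y => bigF μ γ (ρ y)) x ^ 2) := by
  obtain ⟨C, hC, halt⟩ := h.exists_le_or_deriv_le hvac hinf
  refine ⟨4 * C, by positivity, fun ρ hρ hpos x => ?_⟩
  rw [sum_pd_comp_sq (fun s hs => h.hasDerivAt_bigZ hs) hρ hpos,
    sum_pd_comp_sq (fun s hs => h.hasDerivAt_bigF γ hs) hρ hpos]
  set s := ρ x
  have hs : 0 < s := hpos x
  have hd := h.deriv_pos hs
  set q := sq3 fun i => pd i ρ x with hq
  have hq0 : 0 ≤ q := sq3_nonneg _
  have e1 : s * sq3 (vClassical μ ρ x) = 4 * (deriv μ s ^ 2 / s) * q := by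
    simp only [hq, sq3, vClassical_apply h hρ hpos, Finset.mul_sum]
    refine Finset.sum_congr rfl fun i _ => ?_
    simp only [s] at hs ⊢
    field_simp
    ring
  rw [e1, div_pow, mul_pow, Real.sq_sqrt (h.pos hs).le,
    Real.sq_sqrt (mul_nonneg hd.le (by positivity)), ← add_mul, ← mul_assoc]
  refine mul_le_mul_of_nonneg_right ?_ hq0
  have hA : 0 ≤ μ s * deriv μ s ^ 2 / s ^ 2 := by have := h.pos hs; positivity
  have hB : 0 ≤ deriv μ s * s ^ (γ - 2) := by positivity
  rw [mul_assoc]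
  refine mul_le_mul_of_nonneg_left ?_ (by norm_num)
  rcases halt s hs with h1 | h1
  · have : deriv μ s ^ 2 / s ≤ C * (μ s * deriv μ s ^ 2 / s ^ 2) := by
      calc deriv μ s ^ 2 / s = s * (deriv μ s ^ 2 / s ^ 2) := by field_simp
        _ ≤ C * μ s * (deriv μ s ^ 2 / s ^ 2) := by gcongr
        _ = _ := by ring
    nlinarith
  · have : deriv μ s ^ 2 / s ≤ C * (deriv μ s * s ^ (γ - 2)) := by
      have e2 : s ^ (γ - 1) = s ^ (γ - 2) * s := by
        rw [← Real.rpow_add_one hs.ne']; congr 1; ring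
      calc deriv μ s ^ 2 / s = deriv μ s * deriv μ s / s := by ring
        _ ≤ C * s ^ (γ - 1) * deriv μ s / s := by gcongr
        _ = _ := by rw [e2]; field_simp
    nlinarith

/-- At a density equal to its mean, `Z(ρ)` takes the value `Z(r)`; hence the Hessian controls the
distance of `Z(ρ)` to `Z(r)` uniformly on the torus. -/
lemma exists_sq_bigZ_sub_le (h : IsViscosity μ α₁ α₂) :
    ∃ C : ℝ, 0 < C ∧ ∀ ρ : T3 → ℝ, IsCn 2 ρ → (∀ x, 0 < ρ x) → ∀ x,
      (bigZ μ (ρ x) - bigZ μ (∫ y, ρ y ∂vol)) ^ 2 ≤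
        C * ∫ x, sq9 (fun i j => pd j (pd i fun y => bigZ μ (ρ y)) x) ∂vol := by
  obtain ⟨C, hC, hb⟩ := exists_sq_sub_le_hessian
  refine ⟨C, hC, fun ρ hρ hpos x => ?_⟩
  obtain ⟨x₀, hx₀⟩ := mem_range_of_exists_le_of_exists_ge hρ.continuous
    (exists_le_integral (μ := vol) hρ.integrable) (exists_integral_le (μ := vol) hρ.integrable)
  rw [← hx₀]
  exact hb _ (hρ.comp_of_pos h.contDiffOn_bigZ hpos) x x₀

lemma half_le_vol_bigF_le (h : IsViscosity μ α₁ α₂) (γ : ℝ) (hρ : IsCn 1 ρ)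
    (hpos : ∀ x, 0 < ρ x) {r : ℝ} (hr : 0 < r) (hmean : ∫ x, ρ x ∂vol = r) :
    1 / 2 ≤ vol.real {x | bigF μ γ (ρ x) ≤ bigF μ γ (2 * r)} := by
  have h1 := mul_meas_ge_le_integral_of_nonneg (μ := vol)
    (Eventually.of_forall fun x => (hpos x).le) hρ.integrable (2 * r)
  rw [hmean] at h1
  have h2 : vol.real {x | 2 * r ≤ ρ x} ≤ 1 / 2 := by
    by_contra hcon
    push Not at hcon
    nlinarith
  have hmeas : MeasurableSet {x | 2 * r ≤ ρ x} :=
    (isClosed_le continuous_const hρ.continuous).measurableSet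
  have h3 := probReal_compl_eq_one_sub (μ := vol) hmeas
  have hmono : MonotoneOn (bigF μ γ) (Ioi 0) :=
    monotoneOn_of_deriv_nonneg (convex_Ioi 0)
      (fun s hs => (h.hasDerivAt_bigF γ hs).continuousAt.continuousWithinAt)
      (fun s hs => (h.hasDerivAt_bigF γ
        (interior_subset hs)).differentiableAt.differentiableWithinAt) fun s hs => by
      rw [(h.hasDerivAt_bigF γ (interior_subset hs)).deriv]
      exact Real.sqrt_nonneg _
  have h4 : vol.real {x | 2 * r ≤ ρ x}ᶜ ≤ vol.real {x | bigF μ γ (ρ x) ≤ bigF μ γ (2 * r)} := by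
    refine measureReal_mono fun x hx => ?_
    have hx' : ρ x < 2 * r := not_le.1 hx
    exact hmono (mem_Ioi.2 (hpos x)) (mem_Ioi.2 (by positivity)) hx'.le
  linarith

end State

/-- The dissipation of a regularized state controls its relative entropy, with a constant that
depends only on the data and on the mean density. -/
lemma exists_mul_relEntropyClassical_le {P : Params} {α₁ α₂ α C₀ θ r : ℝ}
    (ha : 0 < P.a) (hγ : 1 ≤ P.γ) (hε : 0 < P.ε) (hr₃ : 0 < P.r₃)
    (hκ : 0 < P.κ) (hκ' : P.κ < 1) (hC₀ : 0 < C₀) (hθ : 0 < θ) (hr : 0 < r)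
    (hμ : IsViscosity P.μ α₁ α₂)
    (hvac : VacuumBehaviour P.μ P.γ α) (hinf : InfinityBehaviour P.μ) :
    ∃ C : ℝ, 0 < C ∧ ∀ (ρ : T3 → ℝ) (u : T3 → Vec), IsCn 2 ρ → (∀ x, 0 < ρ x) → Continuous u →
      ∫ x, ρ x ∂vol = r →
      C * relEntropyClassical P θ r ρ u ≤
        P.ε * C₀ * ∫ x, sq9 (fun i j => pd j (pd i fun y => bigZ P.μ (ρ y)) x) ∂vol +
        P.κ * ∫ x, deriv P.μ (ρ x) * deriv (deriv (bigH P.a P.γ)) (ρ x) *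
          sq3 (fun i => pd i ρ x) ∂vol +
        ∫ x, P.r₃ * (ρ x * sq3 (u x)) ∂vol := by
  obtain ⟨C₁, hC₁, hv⟩ := exists_mul_sq3_vClassical_le hμ hvac hinf
  obtain ⟨C₂, hC₂, hZ⟩ := exists_sq_bigZ_sub_le hμ
  obtain ⟨C₃, hC₃, hh⟩ := hμ.exists_relative_smallh_le hr
  obtain ⟨C₄, hC₄, hH⟩ := hμ.exists_relative_bigH_le hinf ha hγ hr
  set c := 2 * P.κ ^ 2 + (P.κ * (1 - P.κ) + P.ε) with hc_def
  have hc : 0 < c := by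
    have : 0 < 1 - P.κ := by linarith
    positivity
  set B₁ := θ * (c * C₁) + (1 + r) * (C₄ * C₂ + 2 * P.κ * P.r₃ * (C₃ * C₂)) with hB₁
  set B₂ := θ * (c * C₁) + 6 * C₄ with hB₂
  have hB₁0 : 0 < B₁ := by positivity
  have hB₂0 : 0 < B₂ := by positivity
  have haγ : 0 < P.a * P.γ := mul_pos ha (by linarith)
  set C := min (P.ε * C₀ / B₁) (min (P.κ * (P.a * P.γ) / B₂) (P.r₃ / (2 * θ)))
  have hCpos : 0 < C := by positivity
  refine ⟨C, hCpos, fun ρ u hρ hpos hu hmean => ?_⟩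
  have hρ1 : IsCn 1 ρ := hρ.of_le (by norm_num)
  have hcu : ∀ i, Continuous fun x => u x i := fun i => (continuous_apply i).comp hu
  have hcρ := hρ.continuous
  have hZ2 : IsCn 2 fun y => bigZ P.μ (ρ y) := hρ.comp_of_pos hμ.contDiffOn_bigZ hpos
  have hZ1 : IsCn 1 fun y => bigZ P.μ (ρ y) := hZ2.of_le (by norm_num)
  have hF1 : IsCn 1 fun y => bigF P.μ P.γ (ρ y) := hρ1.comp_of_pos (hμ.contDiffOn_bigF P.γ) hpos
  set X := ∫ x, sq9 (fun i j => pd j (pd i fun y => bigZ P.μ (ρ y)) x) ∂vol with hX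
  set gZ : T3 → ℝ := fun x => ∑ i, pd i (fun y => bigZ P.μ (ρ y)) x ^ 2 with hgZ
  set gF : T3 → ℝ := fun x => ∑ i, pd i (fun y => bigF P.μ P.γ (ρ y)) x ^ 2 with hgF
  have hgZc : Continuous gZ := continuous_finsetSum _ fun i _ => (continuous_pd hZ1 i).pow 2
  have hgFc : Continuous gF := continuous_finsetSum _ fun i _ => (continuous_pd hF1 i).pow 2
  set Y := ∫ x, gF x ∂vol with hY
  set T : T3 → ℝ := fun x => max 0 (bigF P.μ P.γ (ρ x) - bigF P.μ P.γ (2 * r)) ^ 2 with hT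
  have hTc : Continuous T := by have := hF1.continuous; fun_prop
  set k : T3 → ℝ := fun x => ρ x * sq3 (u x) with hk
  have hkc : Continuous k := hcρ.mul (continuous_sq3 hcu)
  set K := ∫ x, k x ∂vol with hK
  have hX0 : 0 ≤ X := integral_nonneg fun x =>
    Finset.sum_nonneg fun i _ => Finset.sum_nonneg fun j _ => sq_nonneg _
  have hY0 : 0 ≤ Y := integral_nonneg fun x => Finset.sum_nonneg fun i _ => sq_nonneg _
  have hK0 : 0 ≤ K := integral_nonneg fun x => mul_nonneg (hpos x).le (sq3_nonneg _)
  have hTY : ∫ x, T x ∂vol ≤ 6 * Y :=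
    integral_truncation_sq_le hF1 (half_le_vol_bigF_le hμ P.γ hρ1 hpos hr hmean)
  have hZX : ∫ x, gZ x ∂vol ≤ X := integral_grad_sq_le hZ2
  -- the pressure dissipation is a multiple of `∫ |∇F(ρ)|²`
  have hYeq : ∫ x, deriv P.μ (ρ x) * deriv (deriv (bigH P.a P.γ)) (ρ x) *
      sq3 (fun i => pd i ρ x) ∂vol = P.a * P.γ * Y := by
    rw [hY, ← integral_const_mul]
    refine integral_congr_ae (Eventually.of_forall fun x => ?_)
    simp only [hgF]
    rw [sum_pd_comp_sq (fun s hs => hμ.hasDerivAt_bigF P.γ hs) hρ1 hpos,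
      Real.sq_sqrt (mul_nonneg (hμ.deriv_pos (hpos x)).le (Real.rpow_nonneg (hpos x).le _)),
      deriv_deriv_bigH _ _ (hpos x)]
    ring
  have hKeq : ∫ x, P.r₃ * (ρ x * sq3 (u x)) ∂vol = P.r₃ * K := integral_const_mul _ _
  -- the pointwise bound of the entropy density
  have hpt : ∀ x, relDensity P θ r (ρ x) (u x) (vClassical P.μ ρ x) ≤
      2 * θ * k x + θ * (c * C₁) * (gZ x + gF x) +
        (C₄ * C₂ + 2 * P.κ * P.r₃ * (C₃ * C₂)) * X * (1 + ρ x) + C₄ * T x := by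
    intro x
    have hρx := hpos x
    have hκ1 : 0 < 1 - P.κ := by linarith
    have e1 : ρ x * (sq3 (wVel P.κ (u x) (vClassical P.μ ρ x)) +
        (P.κ * (1 - P.κ) + P.ε) * sq3 (vClassical P.μ ρ x)) ≤
        2 * k x + c * (C₁ * (gZ x + gF x)) := by
      have e2 := mul_le_mul_of_nonneg_left (sq3_wVel_le P.κ (u x) (vClassical P.μ ρ x)) hρx.le
      have e3 := mul_le_mul_of_nonneg_left (hv ρ hρ1 hpos x) hc.le
      simp only [hk, hgZ, hgF, hc_def] at e3 ⊢
      linarith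
    have e4 := hZ ρ hρ hpos x
    rw [hmean] at e4
    have e5 : (1 + ρ x) * (bigZ P.μ (ρ x) - bigZ P.μ r) ^ 2 ≤ (1 + ρ x) * (C₂ * X) :=
      mul_le_mul_of_nonneg_left e4 (by linarith)
    have e6 : relative (bigH P.a P.γ) (ρ x) r ≤ C₄ * ((1 + ρ x) * (C₂ * X) + T x) :=
      (hH _ hρx).trans (mul_le_mul_of_nonneg_left (by simp only [hT]; linarith) hC₄.le)
    have e7 : relative (smallh P.μ) (ρ x) r ≤ C₃ * ((1 + ρ x) * (C₂ * X)) :=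
      (hh _ hρx).trans (mul_le_mul_of_nonneg_left e5 hC₃.le)
    have e8 := mul_le_mul_of_nonneg_left e7 (by positivity : (0 : ℝ) ≤ 2 * P.κ * P.r₃)
    have e9 := mul_le_mul_of_nonneg_left e1 hθ.le
    unfold relDensity
    linarith
  have hE : relEntropyClassical P θ r ρ u ≤ 2 * θ * K + B₁ * X + B₂ * Y := by
    have hi1 : Integrable (fun x => 2 * θ * k x) vol := integrable_of_continuous (by fun_prop)
    have hi2 : Integrable (fun x => θ * (c * C₁) * (gZ x + gF x)) vol :=
      integrable_of_continuous (by fun_prop)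
    have hi3 : Integrable (fun x => (C₄ * C₂ + 2 * P.κ * P.r₃ * (C₃ * C₂)) * X * (1 + ρ x)) vol :=
      integrable_of_continuous (by fun_prop)
    have hi4 : Integrable (fun x => C₄ * T x) vol := integrable_of_continuous (by fun_prop)
    have hi12 : Integrable (fun x => 2 * θ * k x + θ * (c * C₁) * (gZ x + gF x)) vol :=
      hi1.add hi2
    have hi123 : Integrable (fun x => 2 * θ * k x + θ * (c * C₁) * (gZ x + gF x) +
        (C₄ * C₂ + 2 * P.κ * P.r₃ * (C₃ * C₂)) * X * (1 + ρ x)) vol := hi12.add hi3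
    have h1 := integral_mono
      (integrable_of_continuous (continuous_relDensity hμ θ r hρ1 hpos hu))
      (hi123.add hi4) hpt
    have h2 : ∫ x, (1 + ρ x) ∂vol = 1 + r := by
      rw [integral_add (integrable_const _) hρ.integrable, hmean]
      simp
    simp only [Pi.add_apply] at h1
    rw [integral_add hi123 hi4, integral_add hi12 hi3,
      integral_add hi1 hi2, integral_const_mul, integral_const_mul, integral_const_mul,
      integral_const_mul, integral_add (integrable_of_continuous hgZc)
      (integrable_of_continuous hgFc), h2] at h1
    have e1 : θ * (c * C₁) * (∫ x, gZ x ∂vol + ∫ x, gF x ∂vol) ≤ θ * (c * C₁) * (X + Y) :=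
      mul_le_mul_of_nonneg_left (by linarith) (by positivity)
    have e2 : C₄ * ∫ x, T x ∂vol ≤ C₄ * (6 * Y) := mul_le_mul_of_nonneg_left hTY hC₄.le
    unfold relEntropyClassical
    simp only [hB₁, hB₂, hK]
    linarith
  rw [hYeq, hKeq]
  have m1 : C * B₁ ≤ P.ε * C₀ := by
    rw [← le_div_iff₀ hB₁0]; exact min_le_left _ _
  have m2 : C * B₂ ≤ P.κ * (P.a * P.γ) := by
    rw [← le_div_iff₀ hB₂0]; exact (min_le_right _ _).trans (min_le_left _ _)
  have m3 : C * (2 * θ) ≤ P.r₃ := by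
    rw [← le_div_iff₀ (by positivity)]; exact (min_le_right _ _).trans (min_le_right _ _)
  calc C * relEntropyClassical P θ r ρ u ≤ C * (2 * θ * K + B₁ * X + B₂ * Y) :=
        mul_le_mul_of_nonneg_left hE hCpos.le
    _ = C * B₁ * X + C * B₂ * Y + C * (2 * θ) * K := by ring
    _ ≤ P.ε * C₀ * X + P.κ * (P.a * P.γ) * Y + P.r₃ * K := by gcongr
    _ = _ := by ring

/-- Exponential decay of the relative entropy of regularized solutions. -/
lemma exists_regularized_decay {P : Params} {α₁ α₂ α C₀ θ r : ℝ}
    (ha : 0 < P.a) (hγ : 1 ≤ P.γ) (hε : 0 < P.ε) (hr₃ : 0 < P.r₃)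
    (hκ : 0 < P.κ) (hκ' : P.κ < 1) (hC₀ : 0 < C₀) (hθ : 0 < θ) (hr : 0 < r)
    (hμ : IsViscosity P.μ α₁ α₂)
    (hvac : VacuumBehaviour P.μ P.γ α) (hinf : InfinityBehaviour P.μ) :
    ∃ C : ℝ, 0 < C ∧ ∀ (ρ : ℝ → T3 → ℝ) (u : ℝ → T3 → Vec), IsRegularized P C₀ θ r ρ u →
      ∀ t, 0 ≤ t → relEntropyClassical P θ r (ρ t) (u t) ≤
        relEntropyClassical P θ r (ρ 0) (u 0) * Real.exp (-(C * t)) := by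
  obtain ⟨C, hC, hcoer⟩ := exists_mul_relEntropyClassical_le ha hγ hε hr₃ hκ hκ' hC₀ hθ hr hμ
    hvac hinf
  refine ⟨C, hC, fun ρ u hreg t ht => ?_⟩
  set E := fun t => relEntropyClassical P θ r (ρ t) (u t) with hE
  have hd : ∀ s, 0 < s → HasDerivAt (fun s => E s * Real.exp (C * s))
      (deriv E s * Real.exp (C * s) + E s * (Real.exp (C * s) * C)) s := fun s hs => by
    have h1 : HasDerivAt (fun s => Real.exp (C * s)) (Real.exp (C * s) * C) s := by
      simpa using ((hasDerivAt_id s).const_mul C).exp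
    exact (hreg.ent_diff s hs).hasDerivAt.fun_mul h1
  have hanti : AntitoneOn (fun s => E s * Real.exp (C * s)) (Ici 0) := by
    refine antitoneOn_of_deriv_nonpos (convex_Ici 0)
      (hreg.ent_cont.mul (by fun_prop)) (fun s hs => ?_) fun s hs => ?_
    · rw [interior_Ici] at hs
      exact (hd s hs).differentiableAt.differentiableWithinAt
    · rw [interior_Ici] at hs
      have hs0 : 0 < s := hs
      rw [(hd s hs).deriv]
      have h1 := hreg.dissipation s hs
      have h2 := hcoer (ρ s) (u s) (hreg.rho_C2 s hs0.le) (hreg.rho_pos s hs0.le)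
        (hreg.u_cont s hs0.le) (hreg.mean s hs0.le)
      have h3 : deriv E s + C * E s ≤ 0 := by
        simp only [hE]
        linarith
      have h4 := mul_nonpos_of_nonpos_of_nonneg h3 (Real.exp_pos (C * s)).le
      linarith
  have h := hanti (mem_Ici.2 le_rfl) (mem_Ici.2 ht) ht
  simp only [mul_zero, Real.exp_zero, mul_one] at h
  rw [Real.exp_neg, ← div_eq_mul_inv, le_div_iff₀ (Real.exp_pos _)]
  exact h

/-! ### Mollification on the torus -/

/-- A smooth function on the torus with values in `[0, 1]` and a unique maximum at `0`; its
normalized powers are the mollifiers below. -/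
def bump (x : T3) : ℝ := ∑ i, (1 + (UnitAddTorus.mFourier (Pi.single i 1) x).re) / 6

lemma isCn_bump : IsCn ∞ bump := by
  have h : ∀ i : Fin 3, ContDiff ℝ ∞
      fun y : Vec => (1 + (UnitAddTorus.mFourier (Pi.single i 1) (toTorus y)).re) / 6 := fun i =>
    (contDiff_const.add (isCn_mFourier (Pi.single i 1)).1).div_const 6
  exact ContDiff.sum fun i _ => h i

lemma norm_mFourier_apply (k : Fin 3 → ℤ) (x : T3) : ‖UnitAddTorus.mFourier k x‖ ≤ 1 :=
  ((UnitAddTorus.mFourier k).norm_coe_le_norm x).trans_eq UnitAddTorus.mFourier_norm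

lemma abs_re_mFourier_le (k : Fin 3 → ℤ) (x : T3) : |(UnitAddTorus.mFourier k x).re| ≤ 1 :=
  (Complex.abs_re_le_norm _).trans (norm_mFourier_apply k x)

lemma bump_nonneg (x : T3) : 0 ≤ bump x :=
  Finset.sum_nonneg fun i _ => by linarith [(abs_le.1 (abs_re_mFourier_le (Pi.single i 1) x)).1]

lemma bump_zero : bump 0 = 1 := by
  have h : ∀ k : Fin 3 → ℤ, UnitAddTorus.mFourier k 0 = 1 := fun k => by
    simp [UnitAddTorus.mFourier]
  simp only [bump, h, Complex.one_re, Finset.sum_const, Finset.card_univ, Fintype.card_fin]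
  norm_num

lemma bump_lt_one {x : T3} (hx : x ≠ 0) : bump x < bump 0 := by
  obtain ⟨i, hi⟩ := Function.ne_iff.1 hx
  have h1 : (UnitAddTorus.mFourier (Pi.single i 1) x).re < 1 := by
    refine lt_of_le_of_ne (abs_le.1 (abs_re_mFourier_le _ _)).2 fun h => hi ?_
    rw [UnitAddTorus.mFourier_single, fourier_one] at h
    have h2 : (AddCircle.toCircle (x i) : ℂ) = 1 := by
      have h3 := Complex.sq_norm (AddCircle.toCircle (x i) : ℂ)
      rw [Complex.normSq_apply, Circle.norm_coe, h] at h3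
      apply Complex.ext
      · simpa using h
      · simp only [Complex.one_im]
        nlinarith
    refine AddCircle.injective_toCircle one_ne_zero (Circle.ext ?_)
    rw [h2]
    simp
  have h0 : bump 0 = ∑ _i : Fin 3, (1 + 1) / (6 : ℝ) := by
    rw [bump_zero]; norm_num
  rw [h0, bump]
  refine Finset.sum_lt_sum (fun j _ => ?_) ⟨i, Finset.mem_univ i, ?_⟩
  · have := (abs_le.1 (abs_re_mFourier_le (Pi.single j 1) x)).2
    linarith
  · linarith

lemma integral_bump_pow_pos (n : ℕ) : 0 < ∫ x, bump x ^ n ∂vol := by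
  refine Continuous.integral_pos_of_hasCompactSupport_nonneg_nonzero (x := 0)
    (isCn_bump.continuous.pow n) (HasCompactSupport.of_compactSpace _)
    (fun x => pow_nonneg (bump_nonneg x) n) ?_
  simp [bump_zero]

/-- Smooth nonnegative mollifiers on the torus. -/
def mollifier (n : ℕ) (x : T3) : ℝ := (∫ y, bump y ^ n ∂vol)⁻¹ * bump x ^ n

lemma isCn_mollifier (n : ℕ) : IsCn ∞ (mollifier n) := (IsCn.const _).mul (isCn_bump.pow n)

lemma mollifier_nonneg (n : ℕ) (x : T3) : 0 ≤ mollifier n x :=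
  mul_nonneg (inv_nonneg.2 (integral_bump_pow_pos n).le) (pow_nonneg (bump_nonneg x) n)

lemma integral_mollifier (n : ℕ) : ∫ x, mollifier n x ∂vol = 1 := by
  unfold mollifier
  rw [integral_const_mul, inv_mul_cancel₀ (integral_bump_pow_pos n).ne']

lemma tendsto_integral_mollifier_mul {g : T3 → ℝ} (hg : Continuous g) :
    Tendsto (fun n => ∫ x, mollifier n x * g x ∂vol) atTop (𝓝 (g 0)) := by
  have h := tendsto_setIntegral_pow_smul_of_unique_maximum_of_isCompact_of_continuousOn (μ := vol)
    (s := univ) (x₀ := (0 : T3)) isCompact_univ isCn_bump.continuous.continuousOn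
    (fun y _ hy => bump_lt_one hy) (fun x _ => bump_nonneg x) (by rw [bump_zero]; norm_num)
    (by simp) hg.continuousOn
  refine h.congr fun n => ?_
  simp only [setIntegral_univ, smul_eq_mul, mollifier, mul_assoc]
  rw [integral_const_mul]

/-- Convolution of `q` with the `n`-th mollifier. -/
def mollify (q : T3 → ℝ) (n : ℕ) (x : T3) : ℝ := ∫ y, q y * mollifier n (x - y) ∂vol

section

variable {q g : T3 → ℝ}

lemma continuous_mollify (hq : Integrable q vol) (n : ℕ) : Continuous (mollify q n) := by
  obtain ⟨K, hK⟩ := isCompact_univ.exists_bound_of_continuousOn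
    (isCn_mollifier n).continuous.continuousOn
  refine BddAbove.continuous_convolution_right_of_integrable (ContinuousLinearMap.mul ℝ ℝ)
    ⟨K, ?_⟩ hq (isCn_mollifier n).continuous
  rintro _ ⟨x, rfl⟩
  exact hK x (mem_univ x)

lemma integrable_mul_continuous (hq : Integrable q vol) (hg : Continuous g) :
    Integrable (fun x => q x * g x) vol := by
  obtain ⟨K, hK⟩ := isCompact_univ.exists_bound_of_continuousOn hg.continuousOn
  exact hq.mul_bdd hg.aestronglyMeasurable (Eventually.of_forall fun x => hK x (mem_univ x))

lemma isCn_mollifier_sub (n : ℕ) (x : T3) : IsCn ∞ fun y => mollifier n (x - y) :=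
  (isCn_mollifier n).sub_left x

lemma mollify_sub (hq : Integrable q vol) (hg : Integrable g vol) (n : ℕ) (x : T3) :
    mollify (fun y => q y - g y) n x = mollify q n x - mollify g n x := by
  have hc := (isCn_mollifier_sub n x).continuous
  simp only [mollify, sub_mul]
  exact integral_sub (integrable_mul_continuous hq hc) (integrable_mul_continuous hg hc)

instance : vol.IsNegInvariant :=
  haveI : vol.Regular := Measure.Regular.of_sigmaCompactSpace_of_isLocallyFiniteMeasure vol
  inferInstance

lemma lintegral_mollifier_sub (n : ℕ) (y : T3) :
    ∫⁻ x, ENNReal.ofReal (mollifier n (x - y)) ∂vol = 1 := by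
  rw [lintegral_sub_right_eq_self (fun x => ENNReal.ofReal (mollifier n x)),
    ← ofReal_integral_eq_lintegral_ofReal (isCn_mollifier n).integrable
      (Eventually.of_forall (mollifier_nonneg n)), integral_mollifier, ENNReal.ofReal_one]

lemma integral_mollifier_sub (n : ℕ) (x : T3) : ∫ y, mollifier n (x - y) ∂vol = 1 := by
  rw [integral_sub_left_eq_self (mollifier n), integral_mollifier]

/-- Mollification preserves the integral of a nonnegative function. -/
lemma lintegral_mollify {G : T3 → ℝ≥0∞} (hG : AEMeasurable G vol) (n : ℕ) :
    ∫⁻ x, ∫⁻ y, G y * ENNReal.ofReal (mollifier n (x - y)) ∂vol ∂vol = ∫⁻ y, G y ∂vol := by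
  have hc : Measurable fun z : T3 × T3 => ENNReal.ofReal (mollifier n (z.1 - z.2)) :=
    (((isCn_mollifier n).continuous.comp
      (continuous_fst.sub continuous_snd)).measurable).ennreal_ofReal
  rw [lintegral_lintegral_swap (hG.comp_snd.mul hc.aemeasurable)]
  refine lintegral_congr fun y => ?_
  have hy : Measurable fun x => ENNReal.ofReal (mollifier n (x - y)) :=
    (((isCn_mollifier n).continuous.comp
      (continuous_id.sub continuous_const)).measurable).ennreal_ofReal
  rw [lintegral_const_mul _ hy, lintegral_mollifier_sub, mul_one]

lemma lintegral_enorm_mollify_le (hq : Integrable q vol) (n : ℕ) :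
    ∫⁻ x, ‖mollify q n x‖ₑ ∂vol ≤ ∫⁻ x, ‖q x‖ₑ ∂vol := by
  rw [← lintegral_mollify hq.aestronglyMeasurable.enorm n]
  refine lintegral_mono fun x => ?_
  refine (enorm_integral_le_lintegral_enorm _).trans_eq (lintegral_congr fun y => ?_)
  rw [enorm_mul, Real.enorm_of_nonneg (mollifier_nonneg n _)]

lemma tendsto_mollify_of_continuous (hg : Continuous g) (x : T3) :
    Tendsto (fun n => mollify g n x) atTop (𝓝 (g x)) := by
  have h := tendsto_integral_mollifier_mul (g := fun y => g (x - y)) (by fun_prop)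
  rw [sub_zero] at h
  refine h.congr fun n => ?_
  rw [mollify, ← integral_sub_left_eq_self (fun y => g y * mollifier n (x - y)) vol x]
  refine integral_congr_ae (Eventually.of_forall fun y => ?_)
  simp only [sub_sub_cancel]
  ring

lemma tendsto_lintegral_mollify_sub_of_continuous (hg : Continuous g) :
    Tendsto (fun n => ∫⁻ x, ‖mollify g n x - g x‖ₑ ∂vol) atTop (𝓝 0) := by
  obtain ⟨K, hK⟩ := isCompact_univ.exists_bound_of_continuousOn hg.continuousOn
  have hgi := integrable_of_continuous hg
  have hb : ∀ n x, ‖mollify g n x‖ ≤ K := by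
    intro n x
    have hc := (isCn_mollifier_sub n x).continuous
    calc ‖mollify g n x‖ ≤ ∫ y, ‖g y * mollifier n (x - y)‖ ∂vol :=
          norm_integral_le_integral_norm _
      _ ≤ ∫ y, K * mollifier n (x - y) ∂vol := by
          refine integral_mono (integrable_mul_continuous hgi hc).norm
            (integrable_of_continuous (by fun_prop)) fun y => ?_
          rw [norm_mul, Real.norm_of_nonneg (mollifier_nonneg n _)]
          exact mul_le_mul_of_nonneg_right (hK y (mem_univ y)) (mollifier_nonneg n _)
      _ = K := by rw [integral_const_mul, integral_mollifier_sub, mul_one]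
  have h := tendsto_lintegral_of_dominated_convergence' (μ := vol)
    (F := fun n x => ‖mollify g n x - g x‖ₑ) (f := fun _ => 0)
    (fun _ => ENNReal.ofReal (2 * K))
    (fun n => ((continuous_mollify hgi n).sub hg).enorm.measurable.aemeasurable)
    (fun n => Eventually.of_forall fun x => by
      change ‖mollify g n x - g x‖ₑ ≤ ENNReal.ofReal (2 * K)
      rw [← ofReal_norm]
      refine ENNReal.ofReal_le_ofReal ((norm_sub_le _ _).trans ?_)
      linarith [hb n x, hK x (mem_univ x)])
    (by rw [lintegral_const, measure_univ, mul_one]; exact ENNReal.ofReal_ne_top)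
    (Eventually.of_forall fun x => by
      have h1 := ((tendsto_mollify_of_continuous hg x).sub_const (g x)).enorm
      simpa using h1)
  simpa using h

/-- Mollifications of an integrable function converge in `L¹`. -/
lemma tendsto_lintegral_mollify_sub (hq : Integrable q vol) :
    Tendsto (fun n => ∫⁻ x, ‖mollify q n x - q x‖ₑ ∂vol) atTop (𝓝 0) := by
  rw [ENNReal.tendsto_nhds_zero]
  intro ε hε
  have hε3 : ε / 3 ≠ 0 := (ENNReal.div_pos hε.ne' (by norm_num)).ne'
  obtain ⟨g, -, hg1, hgc, -⟩ := (memLp_one_iff_integrable.2 hq).exists_hasCompactSupport_eLpNorm_sub_le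
    ENNReal.one_ne_top hε3
  have hgi := integrable_of_continuous hgc
  rw [eLpNorm_one_eq_lintegral_enorm] at hg1
  filter_upwards [ENNReal.tendsto_nhds_zero.1 (tendsto_lintegral_mollify_sub_of_continuous hgc)
    (ε / 3) (pos_iff_ne_zero.2 hε3)] with n hn
  have hd : Integrable (fun x => q x - g x) vol := hq.sub hgi
  have h1 : ∫⁻ x, ‖mollify (fun y => q y - g y) n x‖ₑ ∂vol ≤ ε / 3 :=
    (lintegral_enorm_mollify_le hd n).trans hg1
  calc ∫⁻ x, ‖mollify q n x - q x‖ₑ ∂vol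
      ≤ ∫⁻ x, (‖mollify (fun y => q y - g y) n x‖ₑ + ‖mollify g n x - g x‖ₑ +
          ‖q x - g x‖ₑ) ∂vol := by
        refine lintegral_mono fun x => ?_
        have e : mollify q n x - q x = mollify (fun y => q y - g y) n x +
            (mollify g n x - g x) - (q x - g x) := by
          rw [mollify_sub hq hgi]; ring
        rw [e]
        exact enorm_sub_le.trans (add_le_add_left (enorm_add_le _ _) _)
    _ = ∫⁻ x, ‖mollify (fun y => q y - g y) n x‖ₑ ∂vol +
          ∫⁻ x, ‖mollify g n x - g x‖ₑ ∂vol + ∫⁻ x, ‖q x - g x‖ₑ ∂vol := by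
        rw [lintegral_add_left, lintegral_add_left]
        · exact (continuous_mollify hd n).enorm.measurable
        · exact (continuous_mollify hd n).enorm.measurable.add
            ((continuous_mollify hgi n).sub hgc).enorm.measurable
    _ ≤ ε / 3 + ε / 3 + ε / 3 := add_le_add (add_le_add h1 hn) hg1
    _ = ε := ENNReal.add_thirds ε

end

/-! ### Lower semicontinuity of convex functionals -/

section LowerSemicontinuity

variable {ι K : Type*} [Fintype ι]

/-- The supremum of a family of affine functions, cut off at `0`. -/
def affineSup (A : K → ℝ) (B : K → ι → ℝ) (z : ι → ℝ) : ℝ≥0∞ :=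
  ⨆ k, ENNReal.ofReal (A k + ∑ i, B k i * z i)

variable (A : K → ℝ) (B : K → ι → ℝ)

lemma measurable_affineSup : Measurable (affineSup A B) := by
  refine LowerSemicontinuous.measurable (lowerSemicontinuous_iSup fun k => ?_)
  exact (ENNReal.continuous_ofReal.comp (by fun_prop)).lowerSemicontinuous

lemma affineSup_le_liminf {z : ι → ℝ} {zn : ℕ → ι → ℝ}
    (h : ∀ i, Tendsto (fun n => zn n i) atTop (𝓝 (z i))) :
    affineSup A B z ≤ liminf (fun n => affineSup A B (zn n)) atTop := by
  refine iSup_le fun k => ?_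
  have h1 : Tendsto (fun n => ENNReal.ofReal (A k + ∑ i, B k i * zn n i)) atTop
      (𝓝 (ENNReal.ofReal (A k + ∑ i, B k i * z i))) :=
    ENNReal.tendsto_ofReal (tendsto_const_nhds.add
      (tendsto_finsetSum _ fun i _ => (h i).const_mul (B k i)))
  rw [← h1.liminf_eq]
  exact liminf_le_liminf (Eventually.of_forall fun n =>
    le_iSup (fun k => ENNReal.ofReal (A k + ∑ i, B k i * zn n i)) k)

lemma ofReal_integral_le_lintegral_ofReal {g : T3 → ℝ} (hg : Integrable g vol) :
    ENNReal.ofReal (∫ x, g x ∂vol) ≤ ∫⁻ x, ENNReal.ofReal (g x) ∂vol := by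
  rw [integral_eq_lintegral_pos_part_sub_lintegral_neg_part hg]
  refine (ENNReal.ofReal_le_ofReal (sub_le_self _ ENNReal.toReal_nonneg)).trans ?_
  exact ENNReal.ofReal_toReal_le

/-- Jensen's inequality for the mollification of a vector field. -/
lemma affineSup_mollify_le {q : T3 → ι → ℝ} (hq : ∀ i, Integrable (fun x => q x i) vol) (n : ℕ)
    (x : T3) : affineSup A B (fun i => mollify (fun y => q y i) n x) ≤
      ∫⁻ y, affineSup A B (q y) * ENNReal.ofReal (mollifier n (x - y)) ∂vol := by
  refine iSup_le fun k => ?_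
  have hc := (isCn_mollifier_sub n x).continuous
  have hi : ∀ i, Integrable (fun y => B k i * (q y i * mollifier n (x - y))) vol := fun i =>
    (integrable_mul_continuous (hq i) hc).const_mul _
  have hA : Integrable (fun y => A k * mollifier n (x - y)) vol :=
    integrable_of_continuous (by fun_prop)
  have hS : Integrable (fun y => ∑ i, B k i * (q y i * mollifier n (x - y))) vol :=
    integrable_finsetSum _ fun i _ => hi i
  have e : A k + ∑ i, B k i * mollify (fun y => q y i) n x =
      ∫ y, (A k + ∑ i, B k i * q y i) * mollifier n (x - y) ∂vol := by
    have e1 : ∀ y, (A k + ∑ i, B k i * q y i) * mollifier n (x - y) =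
        A k * mollifier n (x - y) + ∑ i, B k i * (q y i * mollifier n (x - y)) := by
      intro y
      rw [add_mul, Finset.sum_mul]
      simp only [mul_assoc]
    simp only [e1]
    rw [integral_add hA hS, integral_const_mul, integral_mollifier_sub, mul_one,
      integral_finsetSum _ fun i _ => hi i]
    simp only [integral_const_mul, mollify]
  have hint : Integrable (fun y => (A k + ∑ i, B k i * q y i) * mollifier n (x - y)) vol := by
    refine (hA.add hS).congr (Eventually.of_forall fun y => ?_)
    simp only [Pi.add_apply]
    rw [add_mul, Finset.sum_mul]
    simp only [mul_assoc]
  rw [e]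
  refine (ofReal_integral_le_lintegral_ofReal hint).trans (lintegral_mono fun y => ?_)
  rw [ENNReal.ofReal_mul' (mollifier_nonneg n _)]
  gcongr
  exact le_iSup (fun k => ENNReal.ofReal (A k + ∑ i, B k i * q y i)) k

lemma lintegral_affineSup_mollify_le {q : T3 → ι → ℝ}
    (hq : ∀ i, Integrable (fun x => q x i) vol) (n : ℕ) :
    ∫⁻ x, affineSup A B (fun i => mollify (fun y => q y i) n x) ∂vol ≤
      ∫⁻ x, affineSup A B (q x) ∂vol := by
  rw [← lintegral_mollify (G := fun y => affineSup A B (q y))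
    ((measurable_affineSup A B).comp_aemeasurable
      (aemeasurable_pi_lambda _ fun i => (hq i).aestronglyMeasurable.aemeasurable)) n]
  exact lintegral_mono fun x => affineSup_mollify_le A B hq n x

/-- Functionals with a convex integrand, written as a supremum of affine functions, are lower
semicontinuous under convergence in the sense of distributions. After mollification the
convergence is pointwise, so that Fatou's lemma and Jensen's inequality apply; then the
mollification is removed by Fatou's lemma. -/
lemma lintegral_affineSup_le_liminf {q : T3 → ι → ℝ} {qn : ℕ → T3 → ι → ℝ}
    (hq : ∀ i, Integrable (fun x => q x i) vol)
    (hqn : ∀ n i, Integrable (fun x => qn n x i) vol)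
    (hconv : ∀ φ : T3 → ℝ, IsCn ∞ φ → ∀ i,
      Tendsto (fun n => ∫ x, qn n x i * φ x ∂vol) atTop (𝓝 (∫ x, q x i * φ x ∂vol))) :
    ∫⁻ x, affineSup A B (q x) ∂vol ≤
      liminf (fun n => ∫⁻ x, affineSup A B (qn n x) ∂vol) atTop := by
  have hmeas : ∀ (p : T3 → ι → ℝ), (∀ i, Integrable (fun x => p x i) vol) → ∀ j,
      Measurable fun x => affineSup A B (fun i => mollify (fun y => p y i) j x) := fun p hp j =>
    (measurable_affineSup A B).comp
      (measurable_pi_lambda _ fun i => (continuous_mollify (hp i) j).measurable)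
  -- the bound for mollified fields
  have h1 : ∀ j, ∫⁻ x, affineSup A B (fun i => mollify (fun y => q y i) j x) ∂vol ≤
      liminf (fun n => ∫⁻ x, affineSup A B (qn n x) ∂vol) atTop := by
    intro j
    calc ∫⁻ x, affineSup A B (fun i => mollify (fun y => q y i) j x) ∂vol
        ≤ ∫⁻ x, liminf (fun n => affineSup A B (fun i => mollify (fun y => qn n y i) j x)) atTop
            ∂vol := lintegral_mono fun x =>
          affineSup_le_liminf A B fun i => hconv _ (isCn_mollifier_sub j x) i
      _ ≤ liminf (fun n => ∫⁻ x, affineSup A B (fun i => mollify (fun y => qn n y i) j x) ∂vol)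
            atTop := lintegral_liminf_le fun n => hmeas _ (hqn n) j
      _ ≤ _ := liminf_le_liminf (Eventually.of_forall fun n =>
          lintegral_affineSup_mollify_le A B (hqn n) j)
  -- almost everywhere convergence of the mollifications along a subsequence
  have hsum : Tendsto (fun j => ∫⁻ x, ∑ i, ‖mollify (fun y => q y i) j x - q x i‖ₑ ∂vol) atTop
      (𝓝 0) := by
    have h2 : ∀ j, ∫⁻ x, ∑ i, ‖mollify (fun y => q y i) j x - q x i‖ₑ ∂vol =
        ∑ i, ∫⁻ x, ‖mollify (fun y => q y i) j x - q x i‖ₑ ∂vol := fun j =>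
      lintegral_finsetSum' _ fun i _ =>
        ((continuous_mollify (hq i) j).aestronglyMeasurable.sub
          (hq i).aestronglyMeasurable).enorm
    simp only [h2]
    have h3 := tendsto_finsetSum (Finset.univ : Finset ι)
      fun i _ => tendsto_lintegral_mollify_sub (hq i)
    simpa using h3
  set D : ℕ → T3 → ℝ := fun j x => ∑ i, |mollify (fun y => q y i) j x - q x i| with hD
  have hDm : ∀ j, AEStronglyMeasurable (D j) vol := fun j =>
    Finset.aestronglyMeasurable_fun_sum _ fun i _ =>
      ((continuous_mollify (hq i) j).aestronglyMeasurable.sub (hq i).aestronglyMeasurable).norm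
  have hD0 : Tendsto (fun j => eLpNorm (D j - fun _ => 0) 1 vol) atTop (𝓝 0) := by
    refine tendsto_of_tendsto_of_tendsto_of_le_of_le tendsto_const_nhds hsum
      (fun _ => zero_le) fun j => ?_
    rw [eLpNorm_one_eq_lintegral_enorm]
    refine lintegral_mono fun x => ?_
    simp only [Pi.sub_apply, sub_zero, hD]
    refine (enorm_sum_le _ _).trans_eq (Finset.sum_congr rfl fun i _ => ?_)
    exact Real.enorm_abs _
  obtain ⟨ns, -, hns⟩ := (tendstoInMeasure_of_tendsto_eLpNorm one_ne_zero hDm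
    aestronglyMeasurable_const hD0).exists_seq_tendsto_ae
  have hae : ∀ᵐ x ∂vol, affineSup A B (q x) ≤
      liminf (fun j => affineSup A B (fun i => mollify (fun y => q y i) (ns j) x)) atTop := by
    filter_upwards [hns] with x hx
    refine affineSup_le_liminf A B fun i => ?_
    rw [tendsto_iff_norm_sub_tendsto_zero]
    refine squeeze_zero (fun _ => norm_nonneg _) (fun j => ?_) hx
    exact Finset.single_le_sum (f := fun i => |mollify (fun y => q y i) (ns j) x - q x i|)
      (fun _ _ => abs_nonneg _) (Finset.mem_univ i)
  calc ∫⁻ x, affineSup A B (q x) ∂vol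
      ≤ ∫⁻ x, liminf (fun j => affineSup A B (fun i => mollify (fun y => q y i) (ns j) x)) atTop
          ∂vol := lintegral_mono_ae hae
    _ ≤ liminf (fun j => ∫⁻ x, affineSup A B (fun i => mollify (fun y => q y i) (ns j) x) ∂vol)
          atTop := lintegral_liminf_le fun j => hmeas q hq (ns j)
    _ ≤ _ := liminf_le_of_frequently_le' (Frequently.of_forall fun j => h1 (ns j))

end LowerSemicontinuity

/-! ### Existence of the drift velocity of a limit of regularized states -/

/-- The space of smooth functions on the torus. -/
def smoothFunctions : Submodule ℝ (T3 → ℝ) where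
  carrier := {f | IsCn ∞ f}
  add_mem' {f g} hf hg := IsCn.add (f := f) (g := g) (n := ∞) hf hg
  zero_mem' := IsCn.const (n := ∞) 0
  smul_mem' c f hf := IsCn.mul (f := fun _ => c) (g := f) (n := ∞) (IsCn.const c) hf

lemma isCn_coe (φ : smoothFunctions) : IsCn ∞ φ.1 := φ.2

section Riesz

variable {ρ : T3 → ℝ}

lemma memLp_sqrt_mul (hρ : Integrable ρ vol) (h0 : ∀ᵐ x ∂vol, 0 ≤ ρ x) {φ : T3 → ℝ}
    (hφ : Continuous φ) : MemLp (fun x => Real.sqrt (ρ x) * φ x) 2 vol := by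
  have hm : AEStronglyMeasurable (fun x => Real.sqrt (ρ x) * φ x) vol :=
    (Real.continuous_sqrt.comp_aestronglyMeasurable hρ.aestronglyMeasurable).mul
      hφ.aestronglyMeasurable
  rw [memLp_two_iff_integrable_sq hm]
  refine (integrable_mul_continuous hρ (hφ.pow 2)).congr ?_
  filter_upwards [h0] with x hx
  rw [mul_pow, Real.sq_sqrt hx, Pi.pow_apply]

/-- The map `φ ↦ √ρ φ` from smooth functions to `L²`. -/
def sqrtMulLp (hρ : Integrable ρ vol) (h0 : ∀ᵐ x ∂vol, 0 ≤ ρ x) :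
    smoothFunctions →ₗ[ℝ] Lp ℝ 2 vol where
  toFun φ := (memLp_sqrt_mul hρ h0 (isCn_coe φ).continuous).toLp _
  map_add' φ ψ := by
    rw [← MemLp.toLp_add]
    refine MemLp.toLp_congr _ _ (Eventually.of_forall fun x => ?_)
    simp [mul_add]
  map_smul' c φ := by
    rw [RingHom.id_apply, ← MemLp.toLp_const_smul]
    refine MemLp.toLp_congr _ _ (Eventually.of_forall fun x => ?_)
    simp [mul_left_comm]

lemma norm_sqrtMulLp_sq (hρ : Integrable ρ vol) (h0 : ∀ᵐ x ∂vol, 0 ≤ ρ x)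
    (φ : smoothFunctions) : ‖sqrtMulLp hρ h0 φ‖ ^ 2 = ∫ x, ρ x * φ.1 x ^ 2 ∂vol := by
  rw [← real_inner_self_eq_norm_sq, L2.inner_def]
  refine integral_congr_ae ?_
  filter_upwards [h0, (memLp_sqrt_mul hρ h0 (isCn_coe φ).continuous).coeFn_toLp] with x hx hx2
  simp only [sqrtMulLp, LinearMap.coe_mk, AddHom.coe_mk, hx2]
  rw [real_inner_self_eq_norm_sq, Real.norm_eq_abs, sq_abs, mul_pow, Real.sq_sqrt hx]

/-- Riesz representation in `L²(ρ dx)`: a functional on smooth functions that is bounded by the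
norm of `L²(ρ dx)` has a density `ρ v`. It is extended from the image of `φ ↦ √ρ φ` in
`L²(dx)` by the Hahn-Banach theorem. -/
lemma exists_density_of_bounded (hρ : Integrable ρ vol) (h0 : ∀ᵐ x ∂vol, 0 ≤ ρ x)
    (L : smoothFunctions →ₗ[ℝ] ℝ) {M : ℝ} (hM : 0 ≤ M)
    (hL : ∀ φ : smoothFunctions, (L φ) ^ 2 ≤ M ^ 2 * ∫ x, ρ x * φ.1 x ^ 2 ∂vol) :
    ∃ v : T3 → ℝ, Integrable (fun x => ρ x * v x) vol ∧
      ∀ φ : smoothFunctions, L φ = ∫ x, ρ x * v x * φ.1 x ∂vol := by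
  set J := sqrtMulLp hρ h0 with hJ
  have hbound : ∀ φ, |L φ| ≤ M * ‖J φ‖ := by
    intro φ
    refine abs_le_of_sq_le_sq ?_ (by positivity)
    rw [mul_pow, norm_sqrtMulLp_sq]
    exact hL φ
  obtain ⟨S, hS⟩ := J.rangeRestrict.exists_rightInverse_of_surjective J.range_rangeRestrict
  have hS' : ∀ y : LinearMap.range J, J (S y) = y := fun y => by
    have := LinearMap.congr_fun hS y
    simpa using congrArg Subtype.val this
  let f : StrongDual ℝ (LinearMap.range J) := (L ∘ₗ S).mkContinuous M fun y => by
    have := hbound (S y)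
    rw [hS' y] at this
    simpa using this
  obtain ⟨F, hF, -⟩ := exists_extension_norm_eq (LinearMap.range J) f
  set g := (InnerProductSpace.toDual ℝ (Lp ℝ 2 vol)).symm F with hg
  have hLg : ∀ φ, L φ = inner ℝ g (J φ) := by
    intro φ
    have e1 : inner ℝ g (J φ) = F (J φ) := by
      rw [hg, InnerProductSpace.toDual_symm_apply]
    have e2 : F (J φ) = L (S ⟨J φ, LinearMap.mem_range_self J φ⟩) := by
      have := hF ⟨J φ, LinearMap.mem_range_self J φ⟩
      rw [this]
      simp [f]
    have e3 : L (S ⟨J φ, LinearMap.mem_range_self J φ⟩ - φ) = 0 := by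
      have := hbound (S ⟨J φ, LinearMap.mem_range_self J φ⟩ - φ)
      rw [map_sub J, hS', sub_self, norm_zero, mul_zero] at this
      exact abs_eq_zero.1 (le_antisymm this (abs_nonneg _))
    rw [map_sub, sub_eq_zero] at e3
    rw [e1, e2, e3]
  have hρv : ∀ᵐ x ∂vol, ρ x * (g x / Real.sqrt (ρ x)) = g x * Real.sqrt (ρ x) := by
    filter_upwards [h0] with x hx
    rcases hx.eq_or_lt with h | h
    · simp [← h]
    · have hs : 0 < Real.sqrt (ρ x) := Real.sqrt_pos.2 h
      rw [← mul_div_assoc, div_eq_iff hs.ne', mul_assoc, Real.mul_self_sqrt hx, mul_comm]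
  have hint : Integrable (fun x => g x * Real.sqrt (ρ x)) vol := by
    have h1 := memLp_sqrt_mul hρ h0 (continuous_const (y := (1 : ℝ)))
    simp only [mul_one] at h1
    exact (Lp.memLp g).integrable_mul h1
  refine ⟨fun x => g x / Real.sqrt (ρ x), hint.congr (hρv.mono fun x hx => hx.symm), fun φ => ?_⟩
  rw [hLg, L2.inner_def]
  refine integral_congr_ae ?_
  filter_upwards [hρv, (memLp_sqrt_mul hρ h0 (isCn_coe φ).continuous).coeFn_toLp] with x hx hx2
  simp only [hJ, sqrtMulLp, LinearMap.coe_mk, AddHom.coe_mk, hx2, hx]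
  simp only [RCLike.inner_apply, conj_trivial]
  ring

end Riesz

lemma sq_integral_mul_mul_le {ρ f g : T3 → ℝ} (hρ : Continuous ρ) (hpos : ∀ x, 0 ≤ ρ x)
    (hf : Continuous f) (hg : Continuous g) :
    (∫ x, ρ x * f x * g x ∂vol) ^ 2 ≤ (∫ x, ρ x * f x ^ 2 ∂vol) * ∫ x, ρ x * g x ^ 2 ∂vol := by
  have h : ∀ t : ℝ, 0 ≤ (∫ x, ρ x * g x ^ 2 ∂vol) * (t * t) +
      (2 * ∫ x, ρ x * f x * g x ∂vol) * t + ∫ x, ρ x * f x ^ 2 ∂vol := by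
    intro t
    have h1 : 0 ≤ ∫ x, ρ x * (f x + t * g x) ^ 2 ∂vol :=
      integral_nonneg fun x => mul_nonneg (hpos x) (sq_nonneg _)
    have e : ∀ x, ρ x * (f x + t * g x) ^ 2 =
        (t * t) * (ρ x * g x ^ 2) + (2 * t) * (ρ x * f x * g x) + ρ x * f x ^ 2 := fun x => by ring
    have i1 : Integrable (fun x => (t * t) * (ρ x * g x ^ 2)) vol :=
      integrable_of_continuous (by fun_prop)
    have i2 : Integrable (fun x => (2 * t) * (ρ x * f x * g x)) vol :=
      integrable_of_continuous (by fun_prop)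
    have i3 : Integrable (fun x => ρ x * f x ^ 2) vol := integrable_of_continuous (by fun_prop)
    have i12 : Integrable (fun x => (t * t) * (ρ x * g x ^ 2) + (2 * t) * (ρ x * f x * g x)) vol :=
      i1.add i2
    simp only [e] at h1
    rw [integral_add i12 i3, integral_add i1 i2, integral_const_mul, integral_const_mul] at h1
    linarith
  have h2 := discrim_le_zero h
  unfold discrim at h2
  linarith

section Drift

variable {μ : ℝ → ℝ} {α₁ α₂ : ℝ}

/-- The weak form of `ρ v = 2 ∇μ(ρ)` for regularized states. -/
lemma integral_mul_vClassical (h : IsViscosity μ α₁ α₂) {ρ : T3 → ℝ} (hρ : IsCn 1 ρ)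
    (hpos : ∀ x, 0 < ρ x) {φ : T3 → ℝ} (hφ : IsCn 1 φ) (i : Fin 3) :
    ∫ x, ρ x * vClassical μ ρ x i * φ x ∂vol = -2 * ∫ x, μ (ρ x) * pd i φ x ∂vol := by
  have h1 := integral_pd_mul (hρ.comp_of_pos h.contDiffOn_one hpos) hφ i
  have h2 : ∀ x, ρ x * vClassical μ ρ x i * φ x = 2 * (pd i (fun x => μ (ρ x)) x * φ x) := by
    intro x
    rw [vClassical_apply h hρ hpos, pd_comp hρ i x (h.hasDerivAt (hpos x))]
    have := (hpos x).ne'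
    field_simp
  simp only [h2]
  rw [integral_const_mul, h1]
  ring

/-- If the kinetic parts `∫ ρₙ |vₙ|²` of regularized states are bounded and the states converge in
the sense of distributions, then the limit has a drift velocity. -/
lemma exists_isDriftVel (h : IsViscosity μ α₁ α₂) {ρ : T3 → ℝ} {ρn : ℕ → T3 → ℝ}
    (hρ : Integrable ρ vol) (h0 : ∀ᵐ x ∂vol, 0 ≤ ρ x) (hμρ : Integrable (fun x => μ (ρ x)) vol)
    (hρn : ∀ n, IsCn 1 (ρn n)) (hpos : ∀ n x, 0 < ρn n x)
    (hconv : ∀ φ : T3 → ℝ, IsCn ∞ φ →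
      Tendsto (fun n => ∫ x, ρn n x * φ x ∂vol) atTop (𝓝 (∫ x, ρ x * φ x ∂vol)))
    (hconvμ : ∀ φ : T3 → ℝ, IsCn ∞ φ →
      Tendsto (fun n => ∫ x, μ (ρn n x) * φ x ∂vol) atTop (𝓝 (∫ x, μ (ρ x) * φ x ∂vol)))
    {M : ℝ} (hM : 0 ≤ M)
    (hbound : ∀ᶠ n in atTop, ∫ x, ρn n x * sq3 (vClassical μ (ρn n) x) ∂vol ≤ M ^ 2) :
    ∃ v, IsDriftVel μ ρ v := by
  have hsm : ∀ φ : smoothFunctions, IsCn 1 φ.1 := fun φ => (isCn_coe φ).of_le (by simp)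
  have hpdsm : ∀ (φ : smoothFunctions) i, IsCn ∞ (pd i φ.1) := fun φ i => (isCn_coe φ).pd (by simp) i
  have hint : ∀ (φ : smoothFunctions) i, Integrable (fun x => μ (ρ x) * pd i φ.1 x) vol :=
    fun φ i => integrable_mul_continuous hμρ (hpdsm φ i).continuous
  let L : Fin 3 → smoothFunctions →ₗ[ℝ] ℝ := fun i =>
    { toFun := fun φ => -2 * ∫ x, μ (ρ x) * pd i φ.1 x ∂vol
      map_add' := fun φ ψ => by
        have e : ∀ x, pd i (φ + ψ : smoothFunctions).1 x = pd i φ.1 x + pd i ψ.1 x := fun x =>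
          pd_add (hsm φ) (hsm ψ) i x
        simp only [e, mul_add]
        rw [integral_add (hint φ i) (hint ψ i)]
        ring
      map_smul' := fun c φ => by
        have e : ∀ x, pd i (c • φ : smoothFunctions).1 x = c * pd i φ.1 x := fun x =>
          pd_const_mul c (hsm φ) i x
        simp only [e, mul_left_comm _ c, integral_const_mul, RingHom.id_apply, smul_eq_mul] }
  have hLbound : ∀ i φ, (L i φ) ^ 2 ≤ M ^ 2 * ∫ x, ρ x * φ.1 x ^ 2 ∂vol := by
    intro i φ
    have t1 := ((hconvμ _ (hpdsm φ i)).const_mul (-2)).pow 2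
    have t2 := (hconv _ ((isCn_coe φ).pow 2)).const_mul (M ^ 2)
    refine le_of_tendsto_of_tendsto t1 t2 ?_
    filter_upwards [hbound] with n hn
    rw [← integral_mul_vClassical h (hρn n) (hpos n) (hsm φ) i]
    have hv := continuous_vClassical h (hρn n) (hpos n)
    have hc := (hρn n).continuous
    refine (sq_integral_mul_mul_le hc (fun x => (hpos n x).le) (hv i)
      (hsm φ).continuous).trans ?_
    refine mul_le_mul_of_nonneg_right (le_trans ?_ hn)
      (integral_nonneg fun x => mul_nonneg (hpos n x).le (sq_nonneg _))
    refine integral_mono (integrable_of_continuous (hc.mul ((hv i).pow 2)))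
      (integrable_of_continuous (hc.mul (continuous_sq3 hv))) fun x => ?_
    refine mul_le_mul_of_nonneg_left ?_ (hpos n x).le
    exact Finset.single_le_sum (f := fun i => vClassical μ (ρn n) x i ^ 2)
      (fun _ _ => sq_nonneg _) (Finset.mem_univ i)
  choose v hvint hv using fun i => exists_density_of_bounded hρ h0 (L i) hM (hLbound i)
  refine ⟨fun x i => v i x, hμρ, fun i => (hvint i).div_const 2, fun φ hφ i => ?_⟩
  have e := hv i ⟨φ, hφ⟩
  have e2 : ∀ x, ρ x * v i x / 2 * φ x = 1 / 2 * (ρ x * v i x * φ x) := fun x => by ring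
  simp only [e2, integral_const_mul]
  simp only [L, LinearMap.coe_mk, AddHom.coe_mk] at e
  rw [← e]
  ring

end Drift

/-! ### Lower semicontinuity of the relative entropy -/

/-- Density, `ρ w` and `ρ v`, as one vector. -/
def stateVec (P : Params) (ρ : ℝ) (u v : Vec) : Unit ⊕ Fin 3 ⊕ Fin 3 → ℝ :=
  Sum.elim (fun _ => ρ) (Sum.elim (fun i => ρ * wVel P.κ u v i) fun i => ρ * v i)

/-- Slope of the tangent at `c` of the convex function `relative (potential f) · r`. -/
def relSlope (f : ℝ → ℝ) (r c : ℝ) : ℝ := potentialDeriv f c - potentialDeriv f r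

/-- Value at `0` of the tangent at `c` of the convex function `relative (potential f) · r`. -/
def relIntercept (f : ℝ → ℝ) (r c : ℝ) : ℝ := f r - f c

/-- Constant terms of the affine minorants of the entropy density; they are indexed by a positive
density `c` and by two velocities, the dual variables of `ρ`, `ρ w` and `ρ v`. -/
def minorantConst (P : Params) (r : ℝ) (k : Ioi (0 : ℝ) × Vec × Vec) : ℝ :=
  relIntercept (pres P.a P.γ) r k.1 + 2 * P.κ * P.r₃ * relIntercept P.μ r k.1

/-- Linear coefficients of the affine minorants of the entropy density. -/
def minorantCoeff (P : Params) (θ r : ℝ) (k : Ioi (0 : ℝ) × Vec × Vec) :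
    Unit ⊕ Fin 3 ⊕ Fin 3 → ℝ :=
  Sum.elim
    (fun _ => relSlope (pres P.a P.γ) r k.1 + 2 * P.κ * P.r₃ * relSlope P.μ r k.1 -
      θ * (sq3 k.2.1 + (P.κ * (1 - P.κ) + P.ε) * sq3 k.2.2))
    (Sum.elim (fun i => 2 * θ * k.2.1 i) fun i => 2 * θ * (P.κ * (1 - P.κ) + P.ε) * k.2.2 i)

/-- The relative entropy density as a convex function of `ρ`, `ρ w` and `ρ v`. -/
def convexDensity (P : Params) (θ r : ℝ) (z : Unit ⊕ Fin 3 ⊕ Fin 3 → ℝ) : ℝ≥0∞ :=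
  affineSup (minorantConst P r) (minorantCoeff P θ r) z

lemma relative_potential_eq_tangent {f : ℝ → ℝ} (hf : ContinuousOn f (Ioi 0)) {s r c : ℝ}
    (hr : 0 < r) (hc : 0 < c) : relIntercept f r c + relSlope f r c * s =
      relative (potential f) s r -
        (potential f s - potential f c - potentialDeriv f c * (s - c)) := by
  rw [relative_potential_eq hf hr, potential_eq hr, potential_eq hc, relIntercept, relSlope]
  ring

/-- Each affine minorant is the entropy density minus nonnegative terms. -/
lemma minorant_apply (P : Params) (θ r : ℝ) (k : Ioi (0 : ℝ) × Vec × Vec) (s : ℝ) (u v : Vec) :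
    minorantConst P r k + ∑ i, minorantCoeff P θ r k i * stateVec P s u v i =
      θ * (s * (sq3 (wVel P.κ u v) + (P.κ * (1 - P.κ) + P.ε) * sq3 v)) -
      θ * (s * (∑ i, (wVel P.κ u v i - k.2.1 i) ^ 2 +
        (P.κ * (1 - P.κ) + P.ε) * ∑ i, (v i - k.2.2 i) ^ 2)) +
      (relIntercept (pres P.a P.γ) r k.1 + relSlope (pres P.a P.γ) r k.1 * s) +
      2 * P.κ * P.r₃ * (relIntercept P.μ r k.1 + relSlope P.μ r k.1 * s) := by
  simp only [minorantConst, minorantCoeff, stateVec, Fintype.sum_sum_type, Sum.elim_inl,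
    Sum.elim_inr, Finset.univ_unique, Finset.sum_singleton, sq3, Fin.sum_univ_three]
  ring

section

variable {P : Params} {α₁ α₂ θ r : ℝ}

lemma convexDensity_le (hμ : IsViscosity P.μ α₁ α₂) (ha : 0 < P.a) (hγ : 1 ≤ P.γ) (hε : 0 < P.ε)
    (hr₃ : 0 < P.r₃) (hκ : 0 < P.κ) (hκ' : P.κ < 1) (hθ : 0 < θ) (hr : 0 < r) {s : ℝ} (hs : 0 < s)
    (u v : Vec) :
    convexDensity P θ r (stateVec P s u v) ≤ ENNReal.ofReal (relDensity P θ r s u v) := by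
  refine iSup_le fun k => ENNReal.ofReal_le_ofReal ?_
  have hk : 0 < (k.1 : ℝ) := k.1.2
  rw [minorant_apply, relative_potential_eq_tangent (contDiffOn_pres P.a P.γ).continuousOn hr hk,
    relative_potential_eq_tangent hμ.contDiffOn_one.continuousOn hr hk]
  have e1 := potential_tangent_le (contDiffOn_pres P.a P.γ)
    (fun s hs => deriv_pres_nonneg ha hγ hs) hs hk
  have e2 := potential_tangent_le hμ.contDiffOn_one (fun s hs => (hμ.deriv_pos hs).le) hs hk
  have e3 : 0 ≤ 2 * P.κ * P.r₃ * (potential P.μ s - potential P.μ k.1 -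
      potentialDeriv P.μ k.1 * (s - k.1)) := mul_nonneg (by positivity) (by linarith)
  have e4 : 0 ≤ θ * (s * (∑ i, (wVel P.κ u v i - k.2.1 i) ^ 2 +
        (P.κ * (1 - P.κ) + P.ε) * ∑ i, (v i - k.2.2 i) ^ 2)) := by
    have : 0 < 1 - P.κ := by linarith
    positivity
  unfold relDensity bigH smallh
  linarith

/-- At positive densities the supremum of the minorants is attained at the tangent; at vacuum it
is the limit for densities tending to zero, as pressure and viscosity vanish there. -/
lemma ofReal_relDensity_le (hμ : IsViscosity P.μ α₁ α₂) (hγ : 1 ≤ P.γ)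
    (hr : 0 < r) {s : ℝ} (hs : 0 ≤ s) (u v : Vec) :
    ENNReal.ofReal (relDensity P θ r s u v) ≤ convexDensity P θ r (stateVec P s u v) := by
  rcases hs.eq_or_lt with rfl | hs
  · have hp : Tendsto (pres P.a P.γ) (𝓝[>] 0) (𝓝 0) := by
      have h1 : Tendsto (pres P.a P.γ) (𝓝 0) (𝓝 (P.a * 0 ^ P.γ)) :=
        (Real.continuousAt_rpow_const 0 P.γ (Or.inr (by linarith))).tendsto.const_mul P.a
      rw [Real.zero_rpow (by linarith), mul_zero] at h1
      exact h1.mono_left nhdsWithin_le_nhds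
    have hlim : Tendsto (fun c => ENNReal.ofReal ((pres P.a P.γ r - pres P.a P.γ c) +
        2 * P.κ * P.r₃ * (P.μ r - P.μ c))) (𝓝[>] 0)
        (𝓝 (ENNReal.ofReal (relDensity P θ r 0 u v))) := by
      have e : relDensity P θ r 0 u v =
          (pres P.a P.γ r - 0) + 2 * P.κ * P.r₃ * (P.μ r - 0) := by
        rw [relDensity, bigH, smallh,
          relative_potential_zero (contDiffOn_pres P.a P.γ).continuousOn hr,
          relative_potential_zero hμ.contDiffOn_one.continuousOn hr]
        ring
      rw [e]
      exact ENNReal.tendsto_ofReal ((tendsto_const_nhds.sub hp).add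
        ((tendsto_const_nhds.sub hμ.tendsto_zero).const_mul _))
    refine le_of_tendsto hlim ?_
    filter_upwards [self_mem_nhdsWithin] with c hc
    refine le_trans (le_of_eq ?_) (le_iSup _ ((⟨c, hc⟩, 0, 0) : Ioi (0 : ℝ) × Vec × Vec))
    rw [minorant_apply]
    simp [relIntercept]
  · refine le_trans (le_of_eq ?_)
      (le_iSup _ ((⟨s, hs⟩, wVel P.κ u v, v) : Ioi (0 : ℝ) × Vec × Vec))
    rw [minorant_apply, relative_potential_eq_tangent (contDiffOn_pres P.a P.γ).continuousOn hr hs,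
      relative_potential_eq_tangent hμ.contDiffOn_one.continuousOn hr hs]
    simp [relDensity, bigH, smallh]

/-- The entropy density dominates the kinetic energy of the drift. -/
lemma mul_sq3_le_relDensity (hμ : IsViscosity P.μ α₁ α₂) (ha : 0 < P.a) (hγ : 1 ≤ P.γ)
    (hr₃ : 0 < P.r₃) (hκ : 0 < P.κ) (hθ : 0 < θ) (hr : 0 < r) {s : ℝ} (hs : 0 ≤ s) (u v : Vec) :
    θ * (P.κ * (1 - P.κ) + P.ε) * (s * sq3 v) ≤ relDensity P θ r s u v := by
  have e1 := relative_potential_nonneg (contDiffOn_pres P.a P.γ) (fun s hs => pres_nonneg ha hs)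
    (fun s hs => deriv_pres_nonneg ha hγ hs) hs hr
  have e2 := relative_potential_nonneg hμ.contDiffOn_one (fun s hs => (hμ.pos hs).le)
    (fun s hs => (hμ.deriv_pos hs).le) hs hr
  have e3 : 0 ≤ 2 * P.κ * P.r₃ * relative (potential P.μ) s r := by positivity
  have e4 : 0 ≤ θ * (s * sq3 (wVel P.κ u v)) :=
    mul_nonneg hθ.le (mul_nonneg hs (sq3_nonneg _))
  unfold relDensity bigH smallh
  linarith

/-- Lower semicontinuity of the relative entropy along regularized states that converge in the
sense of distributions with bounded entropy. -/
lemma relEntropy_le_liminf (hμ : IsViscosity P.μ α₁ α₂) (ha : 0 < P.a) (hγ : 1 ≤ P.γ)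
    (hε : 0 < P.ε) (hr₃ : 0 < P.r₃) (hκ : 0 < P.κ) (hκ' : P.κ < 1) (hθ : 0 < θ) (hr : 0 < r)
    {ρ : T3 → ℝ} {u : T3 → Vec} {ρn : ℕ → T3 → ℝ} {un : ℕ → T3 → Vec}
    (hρ : Integrable ρ vol) (h0 : ∀ᵐ x ∂vol, 0 ≤ ρ x)
    (hμρ : Integrable (fun x => P.μ (ρ x)) vol)
    (hρu : ∀ i, Integrable (fun x => ρ x * u x i) vol)
    (hρn : ∀ n, IsCn 1 (ρn n)) (hpos : ∀ n x, 0 < ρn n x) (hun : ∀ n, Continuous (un n))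
    (hconv : ∀ φ : T3 → ℝ, IsCn ∞ φ →
      Tendsto (fun n => ∫ x, ρn n x * φ x ∂vol) atTop (𝓝 (∫ x, ρ x * φ x ∂vol)))
    (hconvu : ∀ φ : T3 → ℝ, IsCn ∞ φ → ∀ i,
      Tendsto (fun n => ∫ x, ρn n x * un n x i * φ x ∂vol) atTop
        (𝓝 (∫ x, ρ x * u x i * φ x ∂vol)))
    (hconvμ : ∀ φ : T3 → ℝ, IsCn ∞ φ →
      Tendsto (fun n => ∫ x, P.μ (ρn n x) * φ x ∂vol) atTop (𝓝 (∫ x, P.μ (ρ x) * φ x ∂vol)))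
    {M : ℝ} (hM : ∀ᶠ n in atTop, relEntropyClassical P θ r (ρn n) (un n) ≤ M) :
    relEntropy P θ r ρ u ≤
      liminf (fun n => ENNReal.ofReal (relEntropyClassical P θ r (ρn n) (un n))) atTop := by
  have hκ1 : 0 < 1 - P.κ := by linarith
  set c := θ * (P.κ * (1 - P.κ) + P.ε) with hc_def
  have hc : 0 < c := by positivity
  have hcont : ∀ n, Continuous fun x =>
      relDensity P θ r (ρn n x) (un n x) (vClassical P.μ (ρn n) x) := fun n =>
    continuous_relDensity hμ θ r (hρn n) (hpos n) (hun n)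
  have hvc : ∀ n i, Continuous fun x => vClassical P.μ (ρn n) x i := fun n =>
    continuous_vClassical hμ (hρn n) (hpos n)
  have huc : ∀ n i, Continuous fun x => un n x i := fun n i => (continuous_apply i).comp (hun n)
  have hkin : ∀ n x, c * (ρn n x * sq3 (vClassical P.μ (ρn n) x)) ≤
      relDensity P θ r (ρn n x) (un n x) (vClassical P.μ (ρn n) x) := fun n x =>
    mul_sq3_le_relDensity hμ ha hγ hr₃ hκ hθ hr (hpos n x).le _ _
  have hnn : ∀ n x, 0 ≤ relDensity P θ r (ρn n x) (un n x) (vClassical P.μ (ρn n) x) :=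
    fun n x => (mul_nonneg hc.le (mul_nonneg (hpos n x).le (sq3_nonneg _))).trans (hkin n x)
  -- the drift velocity of the limit
  obtain ⟨v, hv⟩ : ∃ v, IsDriftVel P.μ ρ v := by
    refine exists_isDriftVel hμ hρ h0 hμρ hρn hpos hconv hconvμ (Real.sqrt_nonneg (|M| / c)) ?_
    filter_upwards [hM] with n hn
    rw [Real.sq_sqrt (by positivity), le_div_iff₀ hc, mul_comm, ← integral_const_mul]
    refine le_trans (integral_mono (integrable_of_continuous ?_)
      (integrable_of_continuous (hcont n)) (hkin n)) (hn.trans (le_abs_self M))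
    exact continuous_const.mul ((hρn n).continuous.mul (continuous_sq3 (hvc n)))
  obtain ⟨-, hvi, hvw⟩ := hv
  have hρv : ∀ i, Integrable (fun x => ρ x * v x i) vol := fun i => by
    refine ((hvi i).const_mul 2).congr (Eventually.of_forall fun x => ?_)
    ring
  -- convergence of the momenta of the drift
  have hconvv : ∀ φ : T3 → ℝ, IsCn ∞ φ → ∀ i,
      Tendsto (fun n => ∫ x, ρn n x * vClassical P.μ (ρn n) x i * φ x ∂vol) atTop
        (𝓝 (∫ x, ρ x * v x i * φ x ∂vol)) := by
    intro φ hφ i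
    have e1 : ∫ x, ρ x * v x i * φ x ∂vol = -2 * ∫ x, P.μ (ρ x) * pd i φ x ∂vol := by
      have e2 : ∀ x, ρ x * v x i * φ x = 2 * (ρ x * v x i / 2 * φ x) := fun x => by ring
      simp only [e2, integral_const_mul]
      rw [hvw φ hφ i]
      ring
    rw [e1]
    refine ((hconvμ _ (hφ.pd (by simp) i)).const_mul (-2)).congr fun n => ?_
    rw [integral_mul_vClassical hμ (hρn n) (hpos n) (hφ.of_le (by simp)) i]
  have key := lintegral_affineSup_le_liminf (minorantConst P r) (minorantCoeff P θ r)
    (q := fun x => stateVec P (ρ x) (u x) (v x))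
    (qn := fun n x => stateVec P (ρn n x) (un n x) (vClassical P.μ (ρn n) x))
    (by
      rintro (_ | i | i)
      · exact hρ
      · refine ((hρu i).add ((hρv i).const_mul P.κ)).congr (Eventually.of_forall fun x => ?_)
        simp only [Pi.add_apply, stateVec, Sum.elim_inr, Sum.elim_inl, wVel]
        ring
      · exact hρv i)
    (by
      have h1 := fun n => (hρn n).continuous
      rintro n (_ | i | i)
      · exact (hρn n).integrable
      · exact integrable_of_continuous
          ((h1 n).mul ((huc n i).add (continuous_const.mul (hvc n i))))
      · exact integrable_of_continuous ((h1 n).mul (hvc n i)))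
    (by
      rintro φ hφ (_ | i | i)
      · exact hconv φ hφ
      · have e1 : ∀ s a b t : ℝ, s * (a + P.κ * b) * t = s * a * t + P.κ * (s * b * t) :=
          fun s a b t => by ring
        simp only [stateVec, Sum.elim_inr, Sum.elim_inl, wVel, e1]
        rw [integral_add (integrable_mul_continuous (hρu i) hφ.continuous)
          ((integrable_mul_continuous (hρv i) hφ.continuous).const_mul _), integral_const_mul]
        refine ((hconvu φ hφ i).add ((hconvv φ hφ i).const_mul P.κ)).congr fun n => ?_
        have h1 := (hρn n).continuous
        have i1 : Integrable (fun x => ρn n x * un n x i * φ x) vol :=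
          integrable_of_continuous ((h1.mul (huc n i)).mul hφ.continuous)
        have i2 : Integrable (fun x => P.κ * (ρn n x * vClassical P.μ (ρn n) x i * φ x)) vol :=
          integrable_of_continuous
            (continuous_const.mul ((h1.mul (hvc n i)).mul hφ.continuous))
        rw [integral_add i1 i2, integral_const_mul]
      · exact hconvv φ hφ i)
  calc relEntropy P θ r ρ u
      ≤ ∫⁻ x, ENNReal.ofReal (relDensity P θ r (ρ x) (u x) (v x)) ∂vol :=
        iInf₂_le v ⟨hμρ, hvi, hvw⟩
    _ ≤ ∫⁻ x, convexDensity P θ r (stateVec P (ρ x) (u x) (v x)) ∂vol := by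
        refine lintegral_mono_ae ?_
        filter_upwards [h0] with x hx
        exact ofReal_relDensity_le hμ hγ hr hx _ _
    _ ≤ liminf (fun n => ∫⁻ x, convexDensity P θ r
          (stateVec P (ρn n x) (un n x) (vClassical P.μ (ρn n) x)) ∂vol) atTop := key
    _ ≤ _ := by
        refine liminf_le_liminf (Eventually.of_forall fun n => ?_)
        rw [relEntropyClassical, ofReal_integral_eq_lintegral_ofReal
          (integrable_of_continuous (hcont n)) (Eventually.of_forall (hnn n))]
        exact lintegral_mono fun x =>
          convexDensity_le hμ ha hγ hε hr₃ hκ hκ' hθ hr (hpos n x) _ _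

end

end

end NSK

/-! ### Exponential decay -/

open NSK in
theorem theorem1 (P : NSK.Params) (α₁ α₂ α ν C₀ θ r : ℝ)
    (ha : 0 < P.a) (hγ : 1 ≤ P.γ) (hε : 0 < P.ε) (hr₃ : 0 < P.r₃)
    (hκ : 0 < P.κ) (hκ' : P.κ < 1) (hC₀ : 0 < C₀) (hθ : 0 < θ)
    (hμ : NSK.IsViscosity P.μ α₁ α₂)
    (hν : 0 < ν) (hν' : ∀ s, 0 ≤ s → ν * P.μ s ≤ NSK.lam P.μ s + 2 * P.μ s / 3)
    (hvac : NSK.VacuumBehaviour P.μ P.γ α) (hinf : NSK.InfinityBehaviour P.μ) :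
    ∃ C : ℝ, 0 < C ∧
      ∀ (ρ : ℝ → NSK.T3 → ℝ) (u : ℝ → NSK.T3 → NSK.Vec),
        NSK.IsGlobalWeakSolution P ν C₀ θ r ρ u →
        ∀ t : ℝ, 0 ≤ t →
          NSK.relEntropy P θ r (ρ t) (u t) ≤
            NSK.relEntropy P θ r (ρ 0) (u 0) * ENNReal.ofReal (Real.exp (-(C * t))) := by
  by_cases hr : 0 < r
  swap
  · -- regularized densities are positive, so that their mean is positive
    refine ⟨1, one_pos, fun ρ u hsol => absurd ?_ hr⟩
    obtain ⟨ρn, un, hreg, -⟩ := hsol.limit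
    have h1 := (hreg 0).rho_C2 0 le_rfl
    rw [← (hreg 0).mean 0 le_rfl]
    exact h1.continuous.integral_pos_of_hasCompactSupport_nonneg_nonzero
      (HasCompactSupport.of_compactSpace _) (fun x => ((hreg 0).rho_pos 0 le_rfl x).le)
      ((hreg 0).rho_pos 0 le_rfl 0).ne'
  obtain ⟨C, hC, hdecay⟩ := exists_regularized_decay ha hγ hε hr₃ hκ hκ' hC₀ hθ hr hμ hvac hinf
  refine ⟨C, hC, fun ρ u hsol t ht => ?_⟩
  obtain ⟨⟨A, hA⟩, -, ρn, un, hreg, hconv, hinit⟩ := hsol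
  have hexp := Real.exp_pos (-(C * t))
  by_cases htop : relEntropy P θ r (ρ 0) (u 0) = ⊤
  · rw [htop, ENNReal.top_mul (ENNReal.ofReal_pos.2 hexp).ne']
    exact le_top
  have hlim := ENNReal.Tendsto.mul_const (b := ENNReal.ofReal (Real.exp (-(C * t)))) hinit
    (Or.inr ENNReal.ofReal_ne_top)
  have hle : ∀ n, ENNReal.ofReal (relEntropyClassical P θ r (ρn n t) (un n t)) ≤
      ENNReal.ofReal (relEntropyClassical P θ r (ρn n 0) (un n 0)) *
        ENNReal.ofReal (Real.exp (-(C * t))) := fun n => by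
    rw [← ENNReal.ofReal_mul' hexp.le]
    exact ENNReal.ofReal_le_ofReal (hdecay _ _ (hreg n) t ht)
  have hfin := ENNReal.mul_ne_top htop (ENNReal.ofReal_ne_top (r := Real.exp (-(C * t))))
  have hM : ∀ᶠ n in Filter.atTop, relEntropyClassical P θ r (ρn n t) (un n t) ≤
      (relEntropy P θ r (ρ 0) (u 0) * ENNReal.ofReal (Real.exp (-(C * t))) + 1).toReal := by
    filter_upwards [hlim.eventually_le_const (ENNReal.lt_add_right hfin one_ne_zero)] with n hn
    exact (ENNReal.ofReal_le_iff_le_toReal (by finiteness)).1 ((hle n).trans hn)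
  have hγ' : 1 ≤ ENNReal.ofReal P.γ := ENNReal.one_le_ofReal.2 hγ
  have hγ'' : 1 ≤ ENNReal.ofReal (2 * P.γ / (P.γ + 1)) := by
    rw [ENNReal.one_le_ofReal, le_div_iff₀ (by linarith)]
    linarith
  have h32 : (1 : ENNReal) ≤ 3 / 2 := by
    rw [ENNReal.le_div_iff_mul_le (by norm_num) (by norm_num)]
    norm_num
  refine (relEntropy_le_liminf hμ ha hγ hε hr₃ hκ hκ' hθ hr
    ((hA.rho_cont.1 t ht).integrable hγ') (hA.rho_nonneg t ht)
    ((hA.mu_cont.1 t ht).integrable h32)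
    (fun i => ((hA.mom_cont i).1 t ht).integrable hγ'')
    (fun n => ((hreg n).rho_C2 t ht).of_le (by norm_num)) (fun n => (hreg n).rho_pos t ht)
    (fun n => (hreg n).u_cont t ht) (fun φ hφ => (hconv t ht φ hφ).1)
    (fun φ hφ => (hconv t ht φ hφ).2.1) (fun φ hφ => (hconv t ht φ hφ).2.2) hM).trans ?_
  exact (Filter.liminf_le_liminf (Filter.Eventually.of_forall hle)).trans hlim.liminf_eq.le
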